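/- **Setting.** A *variable-time sampler* $\mathcal S$ over a finite set $\Omega\subset[0,\infty)$ with integer stopping times $0=t_0<t_1<\dots<t_m$ acts on $\mathcal H_F\otimes\mathcal H_C$, where $\mathcal H_F=\bigotimes_{i=1}^m\mathcal H_{F_i}$ consists of $m$ flag qubits with basis $\{|\mathrm{stop}\rangle,|\mathrm{cont}\rangle\}$ and $\mathcal H_C=\mathcal H_g\otimes\mathcal H_\Omega$ is finite-dimensional, $\mathcal H_\Omega$ having the basis $\{|x\rangle\}_{x\in\Omega}$. It is a product $U=U_m\cdots U_1$ of unitaries, where $U_i$ acts on $\mathcal H_{F_i}\otimes\mathcal H_C$ controlled on the first $i-1$ flags being $|\mathrm{cont}\rangle$, and one use of $U_i$ takes time $t_i-t_{i-1}$. Put $|\mathrm{init}\rangle=|\mathrm{cont}\rangle^{\otimes m}|0\rangle$, where $|0\rangle=|0\rangle|0\rangle$ is a fixed basis state of $\mathcal H_g\otimes\mathcal H_\Omega$, and let $\Pi_{\mathrm{stop}}$ be the projector on $\mathrm{span}\{|\mathrm{cont}\rangle^{\otimes m}\}^{\perp}\otimes\mathcal H_C$. All branches have stopped at the end: $\|\Pi_{\mathrm{stop}}U|\mathrm{init}\rangle\|=1$.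 Let $p_{\mathrm{stop},i}=\|\Pi_{\mathrm{stop}}U_i\cdots U_1|\mathrm{init}\rangle\|^2-\|\Pi_{\mathrm{stop}}U_{i-1}\cdots U_1|\mathrm{init}\rangle\|^2$, $T_{\ell_2}(\mathcal S)=\big(\sum_{i=1}^m p_{\mathrm{stop},i}\,t_i^2\big)^{1/2}$ and $T_{\max}(\mathcal S)=t_m$. The output of $\mathcal S$ is the result of measuring the $\Omega$ register of $U|\mathrm{init}\rangle$; $\mu_{\mathcal S}$ is its mean and $\phi_{\mathcal S}^2$ its second moment. A quantum algorithm with access to $\mathcal S$ is a classically controlled sequence of quantum circuits. Each circuit starts from $|\mathrm{init}\rangle$ and work qubits $|0\rangle$ and ends with a measurement of the work qubits; later circuits and the real number finally output depend on the outcomes. Its choices depend on $\mathcal S$ only through the stopping times and the measurement outcomes. The gates, with their times, are: arbitrary two-qubit gates on flag and work qubits (time $1$); $U_i^{\pm1}$, possibly controlled by a work qubit (time $t_i-t_{i-1}$); $R_{a,b}^{\pm1}$ for $0\le a<b$ (time $1$), where $R_{a,b}$ rotates a work qubit, $|x\rangle|0\rangle\mapsto|x\rangle\big(\sqrt{1-x/b}\,|0\rangle+\sqrt{x/b}\,|1\rangle\big)$,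 if the $\Omega$ register is $|x\rangle$ with $a\le x<b$, and is the identity for the other $x\in\Omega$; and flipping a work qubit if $\mathcal H_C$ is in the state $|0\rangle$ (time $1$). The time complexity is the largest total time of the gates over all execution paths. **Theorem.** There are universal constants $K$ and $k$ and an algorithm that, given a variable-time sampler $\mathcal S$, an integer $\Delta\ge0$, reals $0<L<H$, a real $T_{\ell_2}\ge1$ and reals $0<\epsilon,\delta<1$, outputs an estimate $\widetilde\mu_{\mathcal S}$ such that: 1. if $\Delta\ge\phi_{\mathcal S}/\mu_{\mathcal S}$, $T_{\ell_2}\ge T_{\ell_2}(\mathcal S)$ and $L<\mu_{\mathcal S}<H$, then $|\widetilde\mu_{\mathcal S}-\mu_{\mathcal S}|\le\epsilon\,\mu_{\mathcal S}$ with probability at least $1-\delta$; 2. for all values of $\Delta,L,H,T_{\ell_2}$ as above, $\widetilde\mu_{\mathcal S}\le2\mu_{\mathcal S}$ with probability at least $1-\delta$; 3. for all values of the inputs, the time complexity is at most $K\,X\,(1+\log X)^k$ (and it is $0$ if $\Delta=0$), that is $\widetilde O(X)$, where $$X=\Delta\left(\epsilon^{-2}+\log\frac HL\right)T_{\ell_2}\,\big(1+\log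 T_{\max}(\mathcal S)\big)^4\Big(1+\log\frac1\delta\Big).$$ -/

import Mathlib

open scoped NNReal BigOperators

universe u

noncomputable section

namespace QMean

/-! ## States and controlled operations

A quantum register consists of qubits indexed by `Q` and of one register with basis `C`; its states
are the amplitude functions `(Q → Bool) × C → ℂ` in the computational basis. -/

/-- The (squared norm of the) projection of `ψ` on the basis states that satisfy `E`, i.e. the
probability of `E` when `ψ` is measured in the computational basis. -/
def weight {B : Type*} [Fintype B] (E : B → Prop) [DecidablePred E] (ψ : B → ℂ) : ℝ :=
  ∑ s : B, if E s then ‖ψ s‖ ^ 2 else 0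

/-- The basis state in which all qubits are `|false⟩` and the register `C` is `|c₀⟩`. -/
def initState {Q C : Type*} [Fintype Q] [DecidableEq C] (c₀ : C) : (Q → Bool) × C → ℂ :=
  fun s => if (∀ q, s.1 q = false) ∧ s.2 = c₀ then 1 else 0

/-- Apply the matrix `M` to qubit `q` and the register `C` in the branches whose qubits satisfy the
control `P` (a condition on the qubits other than `q`), and the identity in the other branches.
Rows of `M` index the output. -/
def applyCtrl {Q C : Type*} [DecidableEq Q] [Fintype C]
    (P : (Q → Bool) → Prop) [DecidablePred P] (q : Q) (M : Matrix (Bool × C) (Bool × C) ℂ)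
    (ψ : (Q → Bool) × C → ℂ) : (Q → Bool) × C → ℂ :=
  fun s =>
    if P s.1 then ∑ r : Bool × C, M (s.1 q, s.2) r * ψ (Function.update s.1 q r.1, r.2) else ψ s

/-- Apply the two-qubit matrix `M` to the qubits `p` and `q`. -/
def applyTwo {Q C : Type*} [DecidableEq Q] (p q : Q) (M : Matrix (Bool × Bool) (Bool × Bool) ℂ)
    (ψ : (Q → Bool) × C → ℂ) : (Q → Bool) × C → ℂ :=
  fun s => ∑ r : Bool × Bool,
    M (s.1 p, s.1 q) r * ψ (Function.update (Function.update s.1 p r.1) q r.2, s.2)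

/-! ## Variable-time algorithms and samplers -/

/-- Stopping times `0 = t₀ < t₁ < ⋯ < t_m` (times are numbers of gates). -/
structure Schedule (m : ℕ) where
  time : Fin (m + 1) → ℕ
  time_zero : time 0 = 0
  strictMono : StrictMono time

/-- `T_max = t_m`. -/
def Schedule.Tmax {m : ℕ} (τ : Schedule m) : ℕ := τ.time (Fin.last m)

/-- The time complexity `t_i - t_{i-1}` of one use of `U_i` (the steps are numbered from `0` here). -/
def Schedule.duration {m : ℕ} (τ : Schedule m) (i : Fin m) : ℕ :=
  τ.time i.succ - τ.time i.castSucc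

/-- A variable-time algorithm on `H_F ⊗ H_C`. The space `H_F` consists of `m` flag qubits, with
`false = cont` and `true = stop`, and `H_C` has the orthonormal basis `C`, with initial basis
state `start`. The `i`-th step `U_i` applies the unitary `core i` to `H_{F_i} ⊗ H_C`, controlled on
all the previous flags being `cont`. -/
structure VarTimeAlgorithm (m : ℕ) (C : Type u) [Fintype C] [DecidableEq C] where
  sched : Schedule m
  core : Fin m → Matrix.unitaryGroup (Bool × C) ℂ
  start : C

namespace VarTimeAlgorithm

variable {m : ℕ} {C : Type u} [Fintype C] [DecidableEq C]

/-- The step `U_i` (or its inverse, if `inv`), in a system whose qubits `Q` contain the flag qubits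
through `flag` and possibly others, with an additional control `P`. -/
def applyStep (A : VarTimeAlgorithm m C) {Q : Type*} [DecidableEq Q] (flag : Fin m → Q)
    (P : (Q → Bool) → Prop) [DecidablePred P] (i : Fin m) (inv : Bool)
    (ψ : (Q → Bool) × C → ℂ) : (Q → Bool) × C → ℂ :=
  applyCtrl (fun z => (∀ j, j < i → z (flag j) = false) ∧ P z) (flag i)
    ((if inv then (A.core i)⁻¹ else A.core i : Matrix.unitaryGroup (Bool × C) ℂ) :
      Matrix (Bool × C) (Bool × C) ℂ) ψ

/-- The state `U_i ⋯ U_1 |init⟩`, where `|init⟩ = |cont⟩^m |start⟩`. -/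
def stateAfter (A : VarTimeAlgorithm m C) : Fin (m + 1) → ((Fin m → Bool) × C → ℂ) :=
  Fin.induction (motive := fun _ => (Fin m → Bool) × C → ℂ) (initState A.start)
    (fun i ψ => A.applyStep id (fun _ => True) i false ψ)

/-- `‖Π_stop U_i ⋯ U_1 |init⟩‖²`: the probability that the computation has stopped after step `i`. -/
def stopWeight (A : VarTimeAlgorithm m C) (i : Fin (m + 1)) : ℝ :=
  weight (fun s : (Fin m → Bool) × C => ∃ j, s.1 j = true) (A.stateAfter i)

/-- The probability to stop at a given step. -/
def pStop (A : VarTimeAlgorithm m C) (i : Fin m) : ℝ :=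
  A.stopWeight i.succ - A.stopWeight i.castSucc

/-- The `ℓ₂`-average running time. -/
def Tl2 (A : VarTimeAlgorithm m C) : ℝ :=
  √(∑ i : Fin m, A.pStop i * (A.sched.time i.succ : ℝ) ^ 2)

end VarTimeAlgorithm

/-- A variable-time sampler over the finite sample space `Ω ⊆ [0, ∞)`: a variable-time algorithm with
`H_C = H_g ⊗ H_Ω` all of whose branches have stopped after the last step. Its output is obtained by
measuring the `Ω` register of the final state. -/
structure VarTimeSampler (m : ℕ) (G : Type u) [Fintype G] [DecidableEq G] (Ω : Finset ℝ≥0)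
    extends VarTimeAlgorithm m (G × Ω) where
  halts : toVarTimeAlgorithm.stopWeight (Fin.last m) = 1

namespace VarTimeSampler

variable {m : ℕ} {G : Type u} [Fintype G] [DecidableEq G] {Ω : Finset ℝ≥0}

/-- The distribution `d` of the output: the final state is `∑ x, √(d x) |ψ_x⟩ |x⟩` for some unit
vectors `ψ_x` of `H_F ⊗ H_g`. -/
def dist (S : VarTimeSampler m G Ω) (x : Ω) : ℝ :=
  weight (fun s : (Fin m → Bool) × (G × Ω) => s.2.2 = x) (S.stateAfter (Fin.last m))

/-- The mean `μ_S` of the output. -/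
def mean (S : VarTimeSampler m G Ω) : ℝ := ∑ x : Ω, S.dist x * ((x : ℝ≥0) : ℝ)

/-- `φ_S`, the square root of the second moment of the output. -/
def phi (S : VarTimeSampler m G Ω) : ℝ := √(∑ x : Ω, S.dist x * ((x : ℝ≥0) : ℝ) ^ 2)

end VarTimeSampler

/-! ## Quantum algorithms with access to a variable-time sampler -/

/-- The rotation of one qubit with `|0⟩ ↦ √(1 - ν) |0⟩ + √ν |1⟩`. -/
def rotation (ν : ℝ) : Matrix Bool Bool ℂ := fun r s =>
  match r, s with
  | false, false => (√(1 - ν) : ℝ)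
  | true, false => (√ν : ℝ)
  | false, true => -(√ν : ℝ)
  | true, true => (√(1 - ν) : ℝ)

/-- The `(a, b)`-Bernoulli sampler `R_{a,b}` on a qubit and the `Ω` register: a rotation of the qubit
controlled by `x`, with `|x⟩|0⟩ ↦ |x⟩(√(1 - x/b) |0⟩ + √(x/b) |1⟩)` if `a ≤ x < b`, and the identity
on the other `x`. -/
def bernoulliMatrix (G : Type u) [DecidableEq G] (Ω : Finset ℝ≥0) (a b : ℝ) :
    Matrix (Bool × (G × Ω)) (Bool × (G × Ω)) ℂ := fun r s =>
  if r.2 = s.2 then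
    rotation (if a ≤ ((s.2.2 : ℝ≥0) : ℝ) ∧ ((s.2.2 : ℝ≥0) : ℝ) < b
      then ((s.2.2 : ℝ≥0) : ℝ) / b else 0) r.1 s.1
  else 0

/-- The unitary that flips a qubit exactly when the register `C` is in the state `|c₀⟩`. -/
def startMatrix {C : Type u} [DecidableEq C] (c₀ : C) : Matrix (Bool × C) (Bool × C) ℂ := fun r s =>
  if r.2 = s.2 ∧ (if s.2 = c₀ then r.1 = !s.1 else r.1 = s.1) then 1 else 0

/-- The gates of a circuit on the `m` flag qubits, `w` work qubits and the register `H_C` of a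
variable-time sampler. The circuit refers to the sampler by name only: it is the same for all
samplers with `m` steps. -/
inductive Gate (m w : ℕ) : Type
  /-- An arbitrary two-qubit gate on two distinct flag or work qubits. -/
  | qubits (p q : Fin m ⊕ Fin w) (hpq : p ≠ q) (M : Matrix.unitaryGroup (Bool × Bool) ℂ)
  /-- A use of `U_i` or of its inverse, possibly controlled by a work qubit. -/
  | step (i : Fin m) (inv : Bool) (ctrl : Option (Fin w))
  /-- A Bernoulli sampler or its inverse, acting on the `Ω` register and a work qubit. -/
  | bernoulli (a b : ℝ) (hab : 0 ≤ a ∧ a < b) (inv : Bool) (target : Fin w)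
  /-- Flip a work qubit if `H_C` is in its initial state. -/
  | start (target : Fin w)

/-- The time of a gate: `U_i` and its inverse take time `t_i - t_{i-1}`, any other gate one unit. -/
def Gate.cost {m w : ℕ} (τ : Schedule m) : Gate m w → ℕ
  | .qubits _ _ _ _ => 1
  | .step i _ _ => τ.duration i
  | .bernoulli _ _ _ _ _ => 1
  | .start _ => 1

/-- A quantum algorithm with classical control, for samplers with `m` steps: it either outputs a real
number, or it runs a circuit on fresh registers (all flags `cont`, all work qubits `0`, `H_C` in its
initial state), measures all the work qubits, and continues according to the outcome. -/
inductive QAlgorithm (m : ℕ) : Type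
  | output (y : ℝ)
  | run (w : ℕ) (circuit : List (Gate m w)) (next : (Fin w → Bool) → QAlgorithm m)

/-- The worst-case time complexity: the largest total time of the gates on an execution path. -/
def QAlgorithm.time {m : ℕ} (τ : Schedule m) : QAlgorithm m → ℕ
  | .output _ => 0
  | .run _ circuit next =>
      (circuit.map (Gate.cost τ)).sum + Finset.univ.sup (fun o => (next o).time τ)

section Semantics

variable {m : ℕ} {G : Type u} [Fintype G] [DecidableEq G] {Ω : Finset ℝ≥0}

/-- The action of a gate when the sampler is `S`. -/
def Gate.apply {w : ℕ} (S : VarTimeSampler m G Ω) :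
    Gate m w → ((Fin m ⊕ Fin w → Bool) × (G × Ω) → ℂ) → ((Fin m ⊕ Fin w → Bool) × (G × Ω) → ℂ)
  | .qubits p q _ M, ψ => applyTwo p q M.1 ψ
  | .step i inv ctrl, ψ =>
      S.applyStep Sum.inl (fun z => ∀ c ∈ ctrl, z (Sum.inr c) = true) i inv ψ
  | .bernoulli a b _ inv target, ψ =>
      applyCtrl (fun _ => True) (Sum.inr target)
        (if inv then (bernoulliMatrix G Ω a b).conjTranspose else bernoulliMatrix G Ω a b) ψ
  | .start target, ψ =>
      applyCtrl (fun _ => True) (Sum.inr target) (startMatrix S.start) ψ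

/-- The final state of a circuit (whose first gate is the head of the list). -/
def finalState {w : ℕ} (S : VarTimeSampler m G Ω) (circuit : List (Gate m w)) :
    (Fin m ⊕ Fin w → Bool) × (G × Ω) → ℂ :=
  circuit.foldl (fun ψ g => g.apply S ψ) (initState S.start)

/-- The probability of the outcome `o` when the work qubits are measured after a circuit. -/
def outcomeProb {w : ℕ} (S : VarTimeSampler m G Ω) (circuit : List (Gate m w))
    (o : Fin w → Bool) : ℝ :=
  weight (fun s : (Fin m ⊕ Fin w → Bool) × (G × Ω) => ∀ k, s.1 (Sum.inr k) = o k)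
    (finalState S circuit)

/-- The probability that the output of the algorithm lies in `E` when the sampler is `S`. -/
def QAlgorithm.prob (S : VarTimeSampler m G Ω) (E : Set ℝ) : QAlgorithm m → ℝ
  | .output y => E.indicator 1 y
  | .run _ circuit next => ∑ o, outcomeProb S circuit o * (next o).prob S E

end Semantics

/-- The complexity parameter `Δ (ε⁻² + log (H/L)) · T · log⁴ T_max · log (1/δ)`, where the last two
logarithms are increased by one so that they are bounded away from zero. -/
def complexity (Δ : ℕ) (L H T ε δ : ℝ) (Tmax : ℕ) : ℝ :=
  Δ * (ε⁻¹ ^ 2 + Real.log (H / L)) * T * (1 + Real.log Tmax) ^ 4 * (1 + Real.log (1 / δ))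

end QMean

end

noncomputable section

set_option linter.unusedSectionVars false

namespace QMean

/-! ## Operators on one component of the basis -/

/-! Suppose that a number v comparable to the mean μ is known. The mean splits into pieces: piece
(l, i) collects the runs that stop in the l-th bracket of times, with ends 3^l·cT, and have an
output in the i-th bracket, with ends 3^i·x for x = c²Δ²v. Outputs of size at least a contribute at
most φ²/a, and runs longer than τ contribute at most φ·T_ℓ₂/τ, by Cauchy–Schwarz. So O(log(Δ/ε))
brackets of each kind suffice, whatever T_max is, and the pieces decay geometrically
(`Valid.pieceMean_le`).

Each piece is estimated by variable-time amplitude amplification. One amplification step uses a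
circuit three times and multiplies the amplitude of its good part, of weight p, by 3 − 4p
(`run_amplify`), which is nearly 3 when p is small. Level j runs the j-th bracket of steps and
amplifies the branches that have not stopped. After level l the good part consists of the runs that
stopped in the bracket and passed the Bernoulli test, and it is amplified further, up to N = max(l,
i + d) times, where 3^d is about Δ. As the probability to run past time t is at most T_ℓ₂²/t², the
good weights stay small (`Valid.levelWeight_le`), the total gain is at least 3^N/2 (`gain_bounds`),
and the cost is about 3^N·N·cT (`cost_ampCirc`).

The exact gain depends on unknown probabilities. Therefore a work qubit splits off a reference
branch of known small probability, which skips the sampler and always counts as good. Both branches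
receive the same gain (`sum_sampleCirc`), so the ratio of their observed frequencies gives the piece
(`ratio_bounds`). If the reference is observed too rarely, the estimate is set to zero; hence an
upper bound holds even if the promised bounds on the sampler fail, which yields the second claim.

Pieces of high level need long circuits, but they are small and tolerate a frequency accuracy
coarser by 3^(N−d). Hence a piece costs ΔT/ε² up to logarithms (`holds_bracketProg`,
`time_estProg`).

Finally v is found by halving, starting from H, with estimates of constant accuracy, until an
estimate exceeds v/2 (`holds_searchProg_le`, `holds_searchProg`). This takes O(log(H/L)) rounds,
whose cost does not involve the final ε. -/

/-- A component with values in `D` of the elements of `B`. -/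
structure Component (B D : Type*) where
  get : B → D
  set : B → D → B
  get_set : ∀ s d, get (set s d) = d
  set_get : ∀ s, set s (get s) = s
  set_set : ∀ s d d', set (set s d) d' = set s d'

/-- Apply a matrix to a component, in the branches that satisfy `P`. -/
def applyAt {B D : Type*} [Fintype D] (L : Component B D) (P : B → Prop) [DecidablePred P]
    (M : Matrix D D ℂ) (ψ : B → ℂ) : B → ℂ :=
  fun s => if P s then ∑ r : D, M (L.get s) r * ψ (L.set s r) else ψ s

/-- The inner product of two states. -/
def ip {B : Type*} [Fintype B] (φ ψ : B → ℂ) : ℂ := ∑ s, star (φ s) * ψ s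

section ApplyAt

variable {B D : Type*} [Fintype B] [Fintype D] [DecidableEq D] (L : Component B D) (P : B → Prop)
  [DecidablePred P]

theorem applyAt_add (M : Matrix D D ℂ) (φ ψ : B → ℂ) :
    applyAt L P M (φ + ψ) = applyAt L P M φ + applyAt L P M ψ := by
  funext s
  by_cases h : P s <;> simp [applyAt, h, mul_add, Finset.sum_add_distrib]

theorem applyAt_smul (M : Matrix D D ℂ) (a : ℂ) (ψ : B → ℂ) :
    applyAt L P M (a • ψ) = a • applyAt L P M ψ := by
  funext s
  by_cases h : P s <;> simp [applyAt, h, mul_left_comm, Finset.mul_sum]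

theorem applyAt_applyAt (hP : ∀ s d, P (L.set s d) ↔ P s) (M N : Matrix D D ℂ) (ψ : B → ℂ) :
    applyAt L P M (applyAt L P N ψ) = applyAt L P (M * N) ψ := by
  funext s
  by_cases h : P s
  · simp only [applyAt, h, if_true, hP, L.get_set, L.set_set, Matrix.mul_apply, Finset.mul_sum,
      Finset.sum_mul]
    rw [Finset.sum_comm]
    simp only [mul_assoc]
  · simp [applyAt, h]

theorem applyAt_one (ψ : B → ℂ) : applyAt L P 1 ψ = ψ := by
  funext s
  by_cases h : P s <;> simp [applyAt, h, Matrix.one_apply, L.set_get]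

/-- Exchange the component of a basis element with a given value. -/
def Component.swap {B D : Type*} (L : Component B D) : B × D ≃ B × D where
  toFun x := (L.set x.1 x.2, L.get x.1)
  invFun x := (L.set x.1 x.2, L.get x.1)
  left_inv x := by simp [L.set_set, L.set_get, L.get_set]
  right_inv x := by simp [L.set_set, L.set_get, L.get_set]

/-- The involution `Component.swap` exchanges the row and column indices of `M` inside the double
sum. It preserves the controlled branches because the control does not depend on the component. -/
theorem ip_applyAt (hP : ∀ s d, P (L.set s d) ↔ P s) (M : Matrix D D ℂ) (φ ψ : B → ℂ) :
    ip φ (applyAt L P M ψ) = ip (applyAt L P M.conjTranspose φ) ψ := by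
  have split : ∀ (f : B → ℂ) (g : B → D → ℂ),
      ∑ s, (if P s then ∑ r, g s r else f s) =
        (∑ x : B × D, if P x.1 then g x.1 x.2 else 0) + ∑ s, if P s then 0 else f s := by
    intro f g
    rw [Fintype.sum_prod_type, ← Finset.sum_add_distrib]
    refine Finset.sum_congr rfl fun s _ => ?_
    by_cases h : P s <;> simp [h]
  have h1 : ip φ (applyAt L P M ψ) = ∑ s, (if P s then
      ∑ r, star (φ s) * (M (L.get s) r * ψ (L.set s r)) else star (φ s) * ψ s) := by
    refine Finset.sum_congr rfl fun s _ => ?_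
    by_cases h : P s <;> simp [applyAt, h, Finset.mul_sum]
  have h2 : ip (applyAt L P M.conjTranspose φ) ψ = ∑ s, (if P s then
      ∑ r, (M r (L.get s) * star (φ (L.set s r))) * ψ s else star (φ s) * ψ s) := by
    refine Finset.sum_congr rfl fun s _ => ?_
    by_cases h : P s <;> simp [applyAt, h, Finset.sum_mul, Matrix.conjTranspose_apply]
  rw [h1, h2, split, split]
  congr 1
  rw [← Equiv.sum_comp L.swap]
  refine Finset.sum_congr rfl fun x _ => ?_
  simp only [Component.swap, Equiv.coe_fn_mk, hP, L.get_set, L.set_set, L.set_get]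
  split_ifs <;> ring

end ApplyAt

/-! ## Gates as linear isometries -/

/-- The component of a qubit and the register. -/
def qubitReg {Q C : Type*} [DecidableEq Q] (q : Q) : Component ((Q → Bool) × C) (Bool × C) where
  get s := (s.1 q, s.2)
  set s r := (Function.update s.1 q r.1, r.2)
  get_set s d := by simp
  set_get s := by simp
  set_set s d d' := by simp

/-- The component of two distinct qubits. -/
def twoQubits {Q C : Type*} [DecidableEq Q] (p q : Q) (h : p ≠ q) :
    Component ((Q → Bool) × C) (Bool × Bool) where
  get s := (s.1 p, s.1 q)
  set s r := (Function.update (Function.update s.1 p r.1) q r.2, s.2)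
  get_set s d := by simp [h]
  set_get s := by simp
  set_set s d d' := by
    ext1
    · simp only
      funext x
      by_cases hq : x = q
      · simp [hq]
      · by_cases hp : x = p <;> simp [hq, hp, Function.update_apply]
    · rfl

section Qubits

variable {Q C : Type*} [DecidableEq Q] [Fintype C]

theorem applyCtrl_eq (P : (Q → Bool) → Prop) [DecidablePred P] (q : Q)
    (M : Matrix (Bool × C) (Bool × C) ℂ) (ψ : (Q → Bool) × C → ℂ) :
    applyCtrl P q M ψ = applyAt (qubitReg q) (fun s => P s.1) M ψ := rfl

theorem applyTwo_eq (p q : Q) (h : p ≠ q) (M : Matrix (Bool × Bool) (Bool × Bool) ℂ)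
    (ψ : (Q → Bool) × C → ℂ) :
    applyTwo p q M ψ = applyAt (twoQubits p q h) (fun _ => True) M ψ := by
  funext s
  simp [applyTwo, applyAt, twoQubits]

end Qubits

/-- The inverse of a gate. -/
def Gate.inv {m w : ℕ} : Gate m w → Gate m w
  | .qubits p q h M => .qubits p q h M⁻¹
  | .step i inv c => .step i (!inv) c
  | .bernoulli a b h inv t => .bernoulli a b h (!inv) t
  | .start t => .start t

/-- The inverse of a circuit. -/
def invCirc {m w : ℕ} (c : List (Gate m w)) : List (Gate m w) := (c.map Gate.inv).reverse

theorem Gate.inv_inv {m w : ℕ} (g : Gate m w) : g.inv.inv = g := by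
  cases g <;> simp [Gate.inv]

theorem Gate.cost_inv {m w : ℕ} (τ : Schedule m) (g : Gate m w) : g.inv.cost τ = g.cost τ := by
  cases g <;> simp [Gate.inv, Gate.cost]

theorem invCirc_invCirc {m w : ℕ} (c : List (Gate m w)) : invCirc (invCirc c) = c := by
  simp [invCirc, List.map_reverse, Function.comp_def, Gate.inv_inv]

theorem invCirc_append {m w : ℕ} (c d : List (Gate m w)) :
    invCirc (c ++ d) = invCirc d ++ invCirc c := by
  simp [invCirc]

/-- The total time of a circuit. -/
def circCost {m w : ℕ} (τ : Schedule m) (c : List (Gate m w)) : ℕ := (c.map (Gate.cost τ)).sum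

theorem circCost_append {m w : ℕ} (τ : Schedule m) (c d : List (Gate m w)) :
    circCost τ (c ++ d) = circCost τ c + circCost τ d := by
  simp [circCost]

theorem circCost_inv {m w : ℕ} (τ : Schedule m) (c : List (Gate m w)) :
    circCost τ (invCirc c) = circCost τ c := by
  simp [circCost, invCirc, Function.comp_def, Gate.cost_inv]

theorem rotation_conjTranspose_mul (ν : ℝ) (h0 : 0 ≤ ν) (h1 : ν ≤ 1) :
    (rotation ν).conjTranspose * rotation ν = 1 := by
  have e : (√(1 - ν) : ℝ) * √(1 - ν) + √ν * √ν = 1 := by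
    rw [Real.mul_self_sqrt (by linarith), Real.mul_self_sqrt h0]; ring
  have e' : ((√(1 - ν) : ℝ) : ℂ) * (√(1 - ν) : ℝ) + (√ν : ℝ) * (√ν : ℝ) = 1 := by
    exact_mod_cast e
  ext i j
  cases i <;> cases j <;>
    simp only [Matrix.mul_apply, Fintype.sum_bool, Matrix.conjTranspose_apply, rotation,
      Matrix.one_apply, Complex.star_def, map_neg, Complex.conj_ofReal] <;> simp
  · linear_combination e'
  · ring
  · ring
  · linear_combination e'

theorem rotation_mul_conjTranspose (ν : ℝ) (h0 : 0 ≤ ν) (h1 : ν ≤ 1) :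
    rotation ν * (rotation ν).conjTranspose = 1 :=
  mul_eq_one_comm.mp (rotation_conjTranspose_mul ν h0 h1)

theorem mem_unitary_rotation (ν : ℝ) (h0 : 0 ≤ ν) (h1 : ν ≤ 1) :
    rotation ν ∈ Matrix.unitaryGroup Bool ℂ := by
  rw [Matrix.mem_unitaryGroup_iff, Matrix.star_eq_conjTranspose]
  exact rotation_mul_conjTranspose ν h0 h1

/-- The matrix on a qubit and a register that applies `N c` to the qubit if the register is in
state `c`. -/
def regCtrl {C : Type*} [DecidableEq C] (N : C → Matrix Bool Bool ℂ) :
    Matrix (Bool × C) (Bool × C) ℂ :=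
  fun r s => if r.2 = s.2 then N s.2 r.1 s.1 else 0

theorem regCtrl_mem {C : Type*} [DecidableEq C] [Fintype C] (N : C → Matrix Bool Bool ℂ)
    (h : ∀ c, N c ∈ Matrix.unitaryGroup Bool ℂ) :
    regCtrl N ∈ Matrix.unitaryGroup (Bool × C) ℂ := by
  rw [Matrix.mem_unitaryGroup_iff']
  ext ⟨x, c⟩ ⟨y, d⟩
  have hc := h c
  rw [Matrix.mem_unitaryGroup_iff'] at hc
  have := congrFun (congrFun hc x) y
  simp only [Matrix.mul_apply, Matrix.star_apply, regCtrl, Fintype.sum_prod_type, Matrix.one_apply,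
    Prod.mk.injEq] at this ⊢
  by_cases hcd : c = d
  · subst hcd
    simp only [Fintype.sum_bool] at this
    simpa [apply_ite star] using this
  · simp only [hcd, and_false, if_false, Fintype.sum_bool]
    have : ∀ z : Bool, ∑ e : C, star (if e = c then N c z x else 0) *
        (if e = d then N d z y else 0) = 0 := by
      intro z
      refine Finset.sum_eq_zero fun e _ => ?_
      by_cases he : e = c
      · subst he; simp [hcd]
      · simp [he]
    rw [this, this, add_zero]

section Semantics

variable {m : ℕ} {G : Type u} [Fintype G] [DecidableEq G] {Ω : Finset ℝ≥0}

/-- The rotation angle of a Bernoulli sampler. -/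
def bernParam {Ω : Finset ℝ≥0} (a b : ℝ) (x : Ω) : ℝ :=
  if a ≤ ((x : ℝ≥0) : ℝ) ∧ ((x : ℝ≥0) : ℝ) < b then ((x : ℝ≥0) : ℝ) / b else 0

theorem bernParam_nonneg {Ω : Finset ℝ≥0} {a b : ℝ} (hab : 0 ≤ a ∧ a < b) (x : Ω) :
    0 ≤ bernParam a b x := by
  unfold bernParam
  have := hab.1.trans_lt hab.2
  split_ifs <;> positivity

theorem bernParam_le_one {Ω : Finset ℝ≥0} {a b : ℝ} (hab : 0 ≤ a ∧ a < b) (x : Ω) :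
    bernParam a b x ≤ 1 := by
  unfold bernParam
  have := hab.1.trans_lt hab.2
  split_ifs with h
  · rw [div_le_one this]; exact h.2.le
  · exact zero_le_one

theorem bernoulliMatrix_eq (a b : ℝ) :
    bernoulliMatrix G Ω a b = regCtrl (fun c : G × Ω => rotation (bernParam a b c.2)) := rfl

theorem bernoulliMatrix_mem {a b : ℝ} (hab : 0 ≤ a ∧ a < b) :
    bernoulliMatrix G Ω a b ∈ Matrix.unitaryGroup (Bool × (G × Ω)) ℂ := by
  rw [bernoulliMatrix_eq]
  exact regCtrl_mem _ fun c =>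
    mem_unitary_rotation _ (bernParam_nonneg hab c.2) (bernParam_le_one hab c.2)

theorem startMatrix_conjTranspose {C : Type u} [DecidableEq C] (c₀ : C) :
    (startMatrix c₀).conjTranspose = startMatrix c₀ := by
  ext ⟨x, c⟩ ⟨y, d⟩
  simp only [Matrix.conjTranspose_apply, startMatrix]
  by_cases h : c = d
  · subst h
    by_cases h' : c = c₀ <;> cases x <;> cases y <;> simp [h']
  · simp [h, Ne.symm h, eq_comm]

theorem startMatrix_mul_self {C : Type u} [DecidableEq C] [Fintype C] (c₀ : C) :
    startMatrix c₀ * startMatrix c₀ = 1 := by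
  ext ⟨x, c⟩ ⟨y, d⟩
  simp only [Matrix.mul_apply, startMatrix, Fintype.sum_prod_type, Matrix.one_apply, Fintype.sum_bool]
  by_cases h : c = d
  · subst h
    by_cases h' : c = c₀ <;> cases x <;> cases y <;> simp [h', ite_and]
  · by_cases h' : c = c₀ <;> by_cases h'' : d = c₀ <;>
    cases x <;> cases y <;> simp [h, h', h'', ite_and]

/-- Every gate acts as a unitary matrix on a component. -/
theorem Gate.exists_applyAt {w : ℕ} (S : VarTimeSampler m G Ω) (g : Gate m w) :
    ∃ (D : Type u) (_ : Fintype D) (_ : DecidableEq D)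
      (L : Component ((Fin m ⊕ Fin w → Bool) × (G × Ω)) D)
      (P : (Fin m ⊕ Fin w → Bool) × (G × Ω) → Prop) (_ : DecidablePred P) (M : Matrix D D ℂ),
      (∀ s d, P (L.set s d) ↔ P s) ∧ M.conjTranspose * M = 1 ∧ g.apply S = applyAt L P M ∧
      g.inv.apply S = applyAt L P M.conjTranspose := by
  cases g with
  | qubits p q h M =>
    -- The index type of the matrix is quantified over universe `u`, hence the lift.
    let e : ULift.{u} (Bool × Bool) ≃ Bool × Bool := Equiv.ulift
    let L : Component ((Fin m ⊕ Fin w → Bool) × (G × Ω)) (ULift.{u} (Bool × Bool)) :=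
      { get := fun s => ULift.up ((twoQubits p q h).get s)
        set := fun s d => (twoQubits p q h).set s d.down
        get_set := fun s d => by rw [(twoQubits p q h).get_set]
        set_get := fun s => (twoQubits p q h).set_get s
        set_set := fun s d d' => (twoQubits p q h).set_set s _ _ }
    have key : ∀ (N : Matrix (Bool × Bool) (Bool × Bool) ℂ)
        (ψ : (Fin m ⊕ Fin w → Bool) × (G × Ω) → ℂ),
        applyTwo p q N ψ = applyAt L (fun _ => True) (N.submatrix e e) ψ := by
      intro N ψ
      rw [applyTwo_eq p q h]
      funext s
      simp only [applyAt, if_true]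
      rw [← Equiv.sum_comp e]
      rfl
    refine ⟨ULift.{u} (Bool × Bool), inferInstance, inferInstance, L, fun _ => True, inferInstance,
      (M : Matrix (Bool × Bool) (Bool × Bool) ℂ).submatrix e e, fun _ _ => Iff.rfl, ?_, ?_, ?_⟩
    · have hM := (Matrix.mem_unitaryGroup_iff').mp M.2
      rw [Matrix.star_eq_conjTranspose] at hM
      rw [Matrix.conjTranspose_submatrix, Matrix.submatrix_mul_equiv, hM]
      exact Matrix.submatrix_one_equiv e
    · funext ψ
      exact key _ ψ
    · funext ψ
      rw [Matrix.conjTranspose_submatrix]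
      exact key _ ψ
  | step i inv c =>
    refine ⟨Bool × (G × Ω), inferInstance, inferInstance, qubitReg (Sum.inl i),
      fun z => (∀ j, j < i → z.1 (Sum.inl j) = false) ∧ ∀ c' ∈ c, z.1 (Sum.inr c') = true,
      inferInstance, ((if inv then (S.core i)⁻¹ else S.core i :
        Matrix.unitaryGroup (Bool × (G × Ω)) ℂ) : Matrix _ _ ℂ), ?_, ?_, ?_, ?_⟩
    · intro s d
      have : ∀ j, j < i → (Sum.inl j : Fin m ⊕ Fin w) ≠ Sum.inl i := fun j hj h =>
        hj.ne (Sum.inl.inj h)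
      simp only [qubitReg]
      refine and_congr (forall_congr' fun j => forall_congr' fun hj => ?_)
        (forall_congr' fun j => forall_congr' fun _ => ?_)
      · rw [Function.update_of_ne (this j hj)]
      · rw [Function.update_of_ne (by simp)]
    · have hM := (Matrix.mem_unitaryGroup_iff').mp
        (if inv then (S.core i)⁻¹ else S.core i : Matrix.unitaryGroup (Bool × (G × Ω)) ℂ).2
      rwa [Matrix.star_eq_conjTranspose] at hM
    · rfl
    · funext ψ
      cases inv
      · rfl
      · simp only [Gate.inv, Gate.apply, VarTimeAlgorithm.applyStep, applyCtrl_eq, if_true,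
          Bool.not_true, Bool.false_eq_true, if_false]
        congr 1
        change _ = (star (star ((S.core i : Matrix.unitaryGroup (Bool × (G × Ω)) ℂ) :
          Matrix (Bool × (G × Ω)) (Bool × (G × Ω)) ℂ)))
        rw [star_star]
  | bernoulli a b h inv t =>
    refine ⟨Bool × (G × Ω), inferInstance, inferInstance, qubitReg (Sum.inr t), fun _ => True,
      inferInstance, (if inv then (bernoulliMatrix G Ω a b).conjTranspose
        else bernoulliMatrix G Ω a b), fun _ _ => Iff.rfl, ?_, ?_, ?_⟩
    · have hM := (Matrix.mem_unitaryGroup_iff').mp (bernoulliMatrix_mem (G := G) (Ω := Ω) h)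
      have hM' := (Matrix.mem_unitaryGroup_iff).mp (bernoulliMatrix_mem (G := G) (Ω := Ω) h)
      rw [Matrix.star_eq_conjTranspose] at hM hM'
      cases inv <;> simp [hM, hM']
    · rfl
    · funext ψ
      cases inv <;> simp [Gate.inv, Gate.apply, applyCtrl_eq]
  | start t =>
    refine ⟨Bool × (G × Ω), inferInstance, inferInstance, qubitReg (Sum.inr t), fun _ => True,
      inferInstance, startMatrix S.start, fun _ _ => Iff.rfl, ?_, ?_, ?_⟩
    · rw [startMatrix_conjTranspose, startMatrix_mul_self]
    · rfl
    · rw [startMatrix_conjTranspose]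
      rfl

/-- Run a circuit on a state. -/
def run {w : ℕ} (S : VarTimeSampler m G Ω) (c : List (Gate m w))
    (ψ : (Fin m ⊕ Fin w → Bool) × (G × Ω) → ℂ) : (Fin m ⊕ Fin w → Bool) × (G × Ω) → ℂ :=
  c.foldl (fun ψ g => g.apply S ψ) ψ

variable {w : ℕ} (S : VarTimeSampler m G Ω)

theorem run_nil (ψ : (Fin m ⊕ Fin w → Bool) × (G × Ω) → ℂ) : run S [] ψ = ψ := rfl

theorem run_cons (g : Gate m w) (c : List (Gate m w)) (ψ : (Fin m ⊕ Fin w → Bool) × (G × Ω) → ℂ) :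
    run S (g :: c) ψ = run S c (g.apply S ψ) := rfl

theorem run_append (c d : List (Gate m w)) (ψ : (Fin m ⊕ Fin w → Bool) × (G × Ω) → ℂ) :
    run S (c ++ d) ψ = run S d (run S c ψ) := by
  simp [run, List.foldl_append]

theorem finalState_eq (c : List (Gate m w)) : finalState S c = run S c (initState S.start) := rfl

theorem Gate.apply_add (g : Gate m w) (φ ψ : (Fin m ⊕ Fin w → Bool) × (G × Ω) → ℂ) :
    g.apply S (φ + ψ) = g.apply S φ + g.apply S ψ := by
  obtain ⟨D, _, _, L, P, _, M, -, -, h, -⟩ := g.exists_applyAt S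
  rw [h, applyAt_add]

theorem Gate.apply_smul (g : Gate m w) (a : ℂ) (ψ : (Fin m ⊕ Fin w → Bool) × (G × Ω) → ℂ) :
    g.apply S (a • ψ) = a • g.apply S ψ := by
  obtain ⟨D, _, _, L, P, _, M, -, -, h, -⟩ := g.exists_applyAt S
  rw [h, applyAt_smul]

theorem Gate.inv_apply_apply (g : Gate m w) (ψ : (Fin m ⊕ Fin w → Bool) × (G × Ω) → ℂ) :
    g.inv.apply S (g.apply S ψ) = ψ := by
  obtain ⟨D, _, _, L, P, _, M, hP, hM, h, h'⟩ := g.exists_applyAt S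
  rw [h, h', applyAt_applyAt L P hP, hM, applyAt_one]

theorem Gate.ip_apply (g : Gate m w) (φ ψ : (Fin m ⊕ Fin w → Bool) × (G × Ω) → ℂ) :
    ip φ (g.apply S ψ) = ip (g.inv.apply S φ) ψ := by
  obtain ⟨D, _, _, L, P, _, M, hP, hM, h, h'⟩ := g.exists_applyAt S
  rw [h, h', ip_applyAt L P hP]

theorem run_add (c : List (Gate m w)) (φ ψ : (Fin m ⊕ Fin w → Bool) × (G × Ω) → ℂ) :
    run S c (φ + ψ) = run S c φ + run S c ψ := by
  induction c generalizing φ ψ with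
  | nil => rfl
  | cons g c ih => rw [run_cons, run_cons, run_cons, Gate.apply_add, ih]

theorem run_smul (c : List (Gate m w)) (a : ℂ) (ψ : (Fin m ⊕ Fin w → Bool) × (G × Ω) → ℂ) :
    run S c (a • ψ) = a • run S c ψ := by
  induction c generalizing ψ with
  | nil => rfl
  | cons g c ih => rw [run_cons, run_cons, Gate.apply_smul, ih]

theorem run_inv_run (c : List (Gate m w)) (ψ : (Fin m ⊕ Fin w → Bool) × (G × Ω) → ℂ) :
    run S (invCirc c) (run S c ψ) = ψ := by
  induction c generalizing ψ with
  | nil => rfl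
  | cons g c ih =>
    have : invCirc (g :: c) = invCirc c ++ [g.inv] := by simp [invCirc]
    rw [this, run_cons, run_append, ih, run_cons, run_nil, Gate.inv_apply_apply]

theorem run_run_inv (c : List (Gate m w)) (ψ : (Fin m ⊕ Fin w → Bool) × (G × Ω) → ℂ) :
    run S c (run S (invCirc c) ψ) = ψ := by
  have := run_inv_run S (invCirc c) ψ
  rwa [invCirc_invCirc] at this

theorem ip_run (c : List (Gate m w)) (φ ψ : (Fin m ⊕ Fin w → Bool) × (G × Ω) → ℂ) :
    ip φ (run S c ψ) = ip (run S (invCirc c) φ) ψ := by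
  induction c generalizing φ ψ with
  | nil => rfl
  | cons g c ih =>
    have : invCirc (g :: c) = invCirc c ++ [g.inv] := by simp [invCirc]
    rw [this, run_cons, run_append, ih, run_cons, run_nil, Gate.ip_apply]

theorem ip_run_run (c : List (Gate m w)) (φ ψ : (Fin m ⊕ Fin w → Bool) × (G × Ω) → ℂ) :
    ip (run S c φ) (run S c ψ) = ip φ ψ := by
  rw [ip_run, run_inv_run]

theorem ip_self {B : Type*} [Fintype B] (ψ : B → ℂ) : ip ψ ψ = ((∑ s, ‖ψ s‖ ^ 2 : ℝ) : ℂ) := by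
  unfold ip
  push_cast
  refine Finset.sum_congr rfl fun s _ => ?_
  rw [Complex.star_def, mul_comm, Complex.mul_conj, Complex.normSq_eq_norm_sq]
  push_cast; rfl

theorem ip_initState {Q C : Type*} [Fintype Q] [DecidableEq Q] [Fintype C] [DecidableEq C] (c₀ : C)
    (ψ : (Q → Bool) × C → ℂ) : ip (initState c₀) ψ = ψ (fun _ => false, c₀) := by
  unfold ip
  rw [Finset.sum_eq_single (fun _ => false, c₀)]
  · simp [initState]
  · rintro ⟨z, c⟩ - h
    have : ¬ ((∀ q, z q = false) ∧ c = c₀) := fun h' => h (Prod.ext (funext h'.1) h'.2)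
    simp only [initState, this, if_false, star_zero, zero_mul]
  · simp

theorem sum_norm_run_init (c : List (Gate m w)) :
    ∑ s, ‖run S c (initState S.start) s‖ ^ 2 = 1 := by
  have h := ip_run_run S c (initState S.start) (initState S.start)
  rw [ip_self, ip_initState] at h
  simp only [initState, implies_true, and_self, if_true] at h
  exact_mod_cast h

end Semantics

/-! ## Circuits that leave qubits untouched -/

/-- The state `ψ` is supported on the basis elements that satisfy `K`. -/
def SuppOn {B : Type*} (K : B → Prop) (ψ : B → ℂ) : Prop := ∀ s, ψ s ≠ 0 → K s

/-- The qubits that a gate may change. -/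
def Gate.Touches {m w : ℕ} : Gate m w → Fin m ⊕ Fin w → Prop
  | .qubits p q _ _, x => x = p ∨ x = q
  | .step i _ _, x => x = Sum.inl i
  | .bernoulli _ _ _ _ t, x => x = Sum.inr t
  | .start t, x => x = Sum.inr t

theorem Gate.touches_inv {m w : ℕ} (g : Gate m w) (x : Fin m ⊕ Fin w) :
    g.inv.Touches x ↔ g.Touches x := by
  cases g <;> rfl

section Semantics

variable {m : ℕ} {G : Type u} [Fintype G] [DecidableEq G] {Ω : Finset ℝ≥0} {w : ℕ}
  (S : VarTimeSampler m G Ω)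

/-- A circuit and its inverse preserve the states supported on `K`. -/
def Pres (K : (Fin m ⊕ Fin w → Bool) × (G × Ω) → Prop) (c : List (Gate m w)) : Prop :=
  ∀ ψ, SuppOn K ψ → SuppOn K (run S c ψ) ∧ SuppOn K (run S (invCirc c) ψ)

variable {S} {K : (Fin m ⊕ Fin w → Bool) × (G × Ω) → Prop}

theorem Pres.nil : Pres S K [] := fun _ h => ⟨h, h⟩

theorem Pres.append {c d : List (Gate m w)} (hc : Pres S K c) (hd : Pres S K d) :
    Pres S K (c ++ d) := by
  intro ψ h
  rw [invCirc_append, run_append, run_append]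
  exact ⟨(hd _ (hc _ h).1).1, (hc _ (hd _ h).2).2⟩

theorem Pres.inv {c : List (Gate m w)} (hc : Pres S K c) : Pres S K (invCirc c) := by
  intro ψ h
  rw [invCirc_invCirc]
  exact (hc ψ h).symm

/-- Each new amplitude is a combination of old amplitudes at basis states that agree off the touched
qubits. If an untouched qubit violates the condition, every term vanishes. -/
theorem Gate.suppOn_apply (Z : Fin m ⊕ Fin w → Prop) (g : Gate m w) (hg : ∀ q, Z q → ¬ g.Touches q)
    (ψ : (Fin m ⊕ Fin w → Bool) × (G × Ω) → ℂ) (h : SuppOn (fun s => ∀ q, Z q → s.1 q = false) ψ) :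
    SuppOn (fun s => ∀ q, Z q → s.1 q = false) (g.apply S ψ) := by
  intro s hs q hq
  by_contra hne
  apply hs
  have hz : ∀ s' : (Fin m ⊕ Fin w → Bool) × (G × Ω), s'.1 q = s.1 q → ψ s' = 0 := by
    intro s' h'
    by_contra h0
    exact hne (h' ▸ h s' h0 q hq)
  have hgq := hg q hq
  have ctrl : ∀ (P : (Fin m ⊕ Fin w → Bool) → Prop) [DecidablePred P] (t : Fin m ⊕ Fin w)
      (M : Matrix (Bool × (G × Ω)) (Bool × (G × Ω)) ℂ), q ≠ t → applyCtrl P t M ψ s = 0 := by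
    intro P _ t M hqt
    unfold applyCtrl
    split_ifs
    · refine Finset.sum_eq_zero fun r _ => ?_
      rw [hz _ (Function.update_of_ne hqt _ _), mul_zero]
    · exact hz s rfl
  cases g with
  | qubits p p' hp M =>
    simp only [Gate.Touches, not_or] at hgq
    simp only [Gate.apply, applyTwo]
    refine Finset.sum_eq_zero fun r _ => ?_
    rw [hz, mul_zero]
    simp only
    rw [Function.update_of_ne hgq.2, Function.update_of_ne hgq.1]
  | step i inv c =>
    simp only [Gate.apply, VarTimeAlgorithm.applyStep]
    exact ctrl _ _ _ hgq
  | bernoulli a b hab inv t =>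
    simp only [Gate.apply]
    exact ctrl _ _ _ hgq
  | start t =>
    simp only [Gate.apply]
    exact ctrl _ _ _ hgq

theorem run_suppOn (Z : Fin m ⊕ Fin w → Prop) (c : List (Gate m w))
    (hc : ∀ g ∈ c, ∀ q, Z q → ¬ g.Touches q)
    (ψ : (Fin m ⊕ Fin w → Bool) × (G × Ω) → ℂ) (h : SuppOn (fun s => ∀ q, Z q → s.1 q = false) ψ) :
    SuppOn (fun s => ∀ q, Z q → s.1 q = false) (run S c ψ) := by
  induction c generalizing ψ with
  | nil => exact h
  | cons g c ih =>
    rw [run_cons]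
    exact ih (fun g' hg' => hc g' (List.mem_cons_of_mem _ hg')) _
      (g.suppOn_apply Z (hc g List.mem_cons_self) ψ h)

theorem pres_of_not_touches (Z : Fin m ⊕ Fin w → Prop) (c : List (Gate m w))
    (hc : ∀ g ∈ c, ∀ q, Z q → ¬ g.Touches q) :
    Pres S (fun s => ∀ q, Z q → s.1 q = false) c := by
  intro ψ h
  refine ⟨run_suppOn Z c hc ψ h, run_suppOn Z _ ?_ ψ h⟩
  intro g hg q hq
  simp only [invCirc, List.mem_reverse, List.mem_map] at hg
  obtain ⟨g', hg', rfl⟩ := hg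
  rw [Gate.touches_inv]
  exact hc g' hg' q hq

/-- Some circuits use ancillas and restore them, so that counting touched qubits is not enough. If
the net effect is a diagonal sign, the circuit is its own inverse on the given support, and this
settles the inverse circuit as well. -/
theorem pres_of_diagonal (c : List (Gate m w)) (f : (Fin m ⊕ Fin w → Bool) × (G × Ω) → ℂ)
    (K' : (Fin m ⊕ Fin w → Bool) × (G × Ω) → Prop) (hK : ∀ s, K s → K' s)
    (hf : ∀ s, f s * f s = 1) (h : ∀ ψ, SuppOn K' ψ → run S c ψ = fun s => f s * ψ s) :
    Pres S K c := by
  intro ψ hψ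
  have h1 : SuppOn K' ψ := fun s hs => hK s (hψ s hs)
  have h2 : SuppOn K (run S c ψ) := by
    rw [h ψ h1]
    exact fun s hs => hψ s (right_ne_zero_of_mul hs)
  refine ⟨h2, ?_⟩
  have h3 : run S c (run S c ψ) = ψ := by
    rw [h _ (fun s hs => hK s (h2 s hs)), h ψ h1]
    funext s
    rw [← mul_assoc, hf, one_mul]
  rw [← h3, run_inv_run]
  exact h2

/-- One step of amplitude amplification. -/
theorem run_amplify (A Sg S0 : List (Gate m w)) (hA : Pres S K A)
    (hK : K (fun _ => false, S.start))
    (hS0 : ∀ ψ, SuppOn K ψ → run S S0 ψ = ψ + (-2 * ψ (fun _ => false, S.start)) • initState S.start)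
    (good : (Fin m ⊕ Fin w → Bool) × (G × Ω) → Prop) [DecidablePred good]
    (Ψ : (Fin m ⊕ Fin w → Bool) × (G × Ω) → ℂ) (hΨ : run S A (initState S.start) = Ψ)
    (hSg : run S Sg Ψ = fun s => if good s then Ψ s else -Ψ s) :
    run S (A ++ Sg ++ invCirc A ++ S0 ++ A) (initState S.start) =
      fun s => if good s then ((3 - 4 * weight good Ψ : ℝ) : ℂ) * Ψ s
        else ((1 - 4 * weight good Ψ : ℝ) : ℂ) * Ψ s := by
  have hinit : SuppOn K (initState S.start : (Fin m ⊕ Fin w → Bool) × (G × Ω) → ℂ) := by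
    rintro ⟨z, c⟩ hs
    have : (∀ q, z q = false) ∧ c = S.start := by
      by_contra h0
      exact hs (by simp only [initState, h0, if_false])
    obtain ⟨h1, h2⟩ := this
    have hz : z = fun _ => false := funext h1
    rw [hz, h2]
    exact hK
  have hΨK : SuppOn K Ψ := hΨ ▸ (hA _ hinit).1
  set Φ : (Fin m ⊕ Fin w → Bool) × (G × Ω) → ℂ := fun s => if good s then Ψ s else -Ψ s with hΦ
  have hΦK : SuppOn K Φ := by
    intro s hs
    apply hΨK s
    intro h0
    apply hs
    simp [hΦ, h0]
  have hnorm : ∑ s, ‖Ψ s‖ ^ 2 = 1 := hΨ ▸ sum_norm_run_init S A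
  -- By unitarity this amplitude is the inner product ⟨Ψ, Φ⟩, which is p − (1 − p) for the good
  -- weight p.
  have hip : run S (invCirc A) Φ (fun _ => false, S.start) =
      ((2 * weight good Ψ - 1 : ℝ) : ℂ) := by
    rw [← ip_initState S.start (run S (invCirc A) Φ), ← invCirc_invCirc A, ip_run, invCirc_invCirc,
      invCirc_invCirc, hΨ]
    unfold ip weight
    rw [← hnorm, Finset.mul_sum, ← Finset.sum_sub_distrib]
    push_cast
    refine Finset.sum_congr rfl fun s _ => ?_
    have e : star (Ψ s) * Ψ s = (‖Ψ s‖ : ℂ) ^ 2 := by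
      rw [Complex.star_def, mul_comm, Complex.mul_conj, Complex.normSq_eq_norm_sq]
      push_cast; rfl
    by_cases hg : good s
    · simp only [hΦ, hg, if_true, e]; push_cast; ring
    · simp only [hΦ, hg, if_false, mul_neg, e]; push_cast; ring
  -- Conjugated by `A`, the reflection sends Φ to Φ − 2(2p − 1)Ψ. The coefficient of Ψ is 1 − 2(2p −
  -- 1) = 3 − 4p on the good part and −1 − 2(2p − 1) = 1 − 4p on the rest.
  rw [run_append, run_append, run_append, run_append, hΨ, hSg, hS0 _ (hA _ hΦK).2, run_add,
    run_run_inv, run_smul, hΨ, hip]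
  funext s
  by_cases hg : good s
  · simp only [Pi.add_apply, Pi.smul_apply, hΦ, hg, if_true, smul_eq_mul]; push_cast; ring
  · simp only [Pi.add_apply, Pi.smul_apply, hΦ, hg, if_false, smul_eq_mul]; push_cast; ring

/-! ## Elementary gates -/

/-- Set a qubit of a basis state. -/
def upd {Q C : Type*} [DecidableEq Q] (s : (Q → Bool) × C) (q : Q) (y : Bool) : (Q → Bool) × C :=
  (Function.update s.1 q y, s.2)

/-- The two-qubit matrix that applies `N x` to the second qubit if the first one is `x`. -/
def ctrlMatrix (N : Bool → Matrix Bool Bool ℂ) : Matrix (Bool × Bool) (Bool × Bool) ℂ :=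
  fun r s => if r.1 = s.1 then N r.1 r.2 s.2 else 0

theorem ctrlMatrix_mem (N : Bool → Matrix.unitaryGroup Bool ℂ) :
    ctrlMatrix (fun x => (N x : Matrix Bool Bool ℂ)) ∈ Matrix.unitaryGroup (Bool × Bool) ℂ := by
  rw [Matrix.mem_unitaryGroup_iff]
  ext ⟨x, x'⟩ ⟨y, y'⟩
  have hc := (Matrix.mem_unitaryGroup_iff).mp (N x).2
  have := congrFun (congrFun hc x') y'
  simp only [Matrix.mul_apply, Matrix.star_apply, ctrlMatrix, Fintype.sum_prod_type,
    Fintype.sum_bool, Matrix.one_apply, Prod.mk.injEq] at this ⊢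
  cases x <;> cases y <;> simp at this ⊢ <;> exact this

/-- The gate that applies `N x` to qubit `q` if qubit `p` is `x`. -/
def cg (p q : Fin m ⊕ Fin w) (N : Bool → Matrix.unitaryGroup Bool ℂ) : List (Gate m w) :=
  if h : p ≠ q then [.qubits p q h ⟨_, ctrlMatrix_mem N⟩] else []

theorem cost_cg (τ : Schedule m) (p q : Fin m ⊕ Fin w) (N : Bool → Matrix.unitaryGroup Bool ℂ) :
    circCost τ (cg p q N) ≤ 1 := by
  unfold cg circCost
  split_ifs <;> simp [Gate.cost]

theorem touches_cg {p q : Fin m ⊕ Fin w} {N : Bool → Matrix.unitaryGroup Bool ℂ}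
    {g : Gate m w} (hg : g ∈ cg p q N) {x : Fin m ⊕ Fin w} (hx : g.Touches x) : x = p ∨ x = q := by
  unfold cg at hg
  split_ifs at hg
  · rw [List.mem_singleton] at hg
    subst hg
    exact hx
  · simp at hg

variable (S)

theorem run_cg {p q : Fin m ⊕ Fin w} (h : p ≠ q) (N : Bool → Matrix.unitaryGroup Bool ℂ)
    (ψ : (Fin m ⊕ Fin w → Bool) × (G × Ω) → ℂ) (s : (Fin m ⊕ Fin w → Bool) × (G × Ω)) :
    run S (cg p q N) ψ s =
      (N (s.1 p) : Matrix Bool Bool ℂ) (s.1 q) true * ψ (upd s q true) +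
      (N (s.1 p) : Matrix Bool Bool ℂ) (s.1 q) false * ψ (upd s q false) := by
  rw [cg, dif_pos h, run_cons, run_nil]
  simp only [Gate.apply, applyTwo, Fintype.sum_prod_type, Fintype.sum_bool, ctrlMatrix, upd]
  have e : ∀ b, s.1 p = b → Function.update s.1 p b = s.1 := fun b hb => hb ▸ by simp
  cases hp : s.1 p <;> simp [e _ hp]

/-- The `NOT` matrix. -/
def notU : Matrix.unitaryGroup Bool ℂ :=
  ⟨Matrix.of fun x y => if x = y then 0 else 1, by
    rw [Matrix.mem_unitaryGroup_iff]
    ext x y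
    cases x <;> cases y <;> simp [Matrix.mul_apply, Matrix.star_apply]⟩

/-- The sign change of the basis state `v` of a qubit. -/
def signU (v : Bool) : Matrix.unitaryGroup Bool ℂ :=
  ⟨Matrix.of fun x y => if x = y then (if x = v then -1 else 1) else 0, by
    rw [Matrix.mem_unitaryGroup_iff]
    ext x y
    cases x <;> cases y <;> cases v <;>
      simp [Matrix.mul_apply, Matrix.star_apply]⟩

/-- The two square roots of the `NOT` matrix, which are inverse to each other. -/
def sqrtNotU (inv : Bool) : Matrix.unitaryGroup Bool ℂ :=
  ⟨Matrix.of fun x y => if (x = y ↔ inv = false) then (1 + Complex.I) / 2 else (1 - Complex.I) / 2,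
    by
    rw [Matrix.mem_unitaryGroup_iff]
    ext x y
    cases x <;> cases y <;> cases inv <;>
      simp [Matrix.mul_apply, Matrix.star_apply] <;> ring_nf <;>
      simp [Complex.I_sq, show (starRingEnd ℂ) 2 = 2 from Complex.conj_ofNat 2] <;> norm_num⟩

/-- Flip `q` if `p` has the value `v`. -/
def cnot (p : Fin m ⊕ Fin w) (v : Bool) (q : Fin m ⊕ Fin w) : List (Gate m w) :=
  cg p q (fun x => if x = v then notU else 1)

/-- Change the sign if `q` has the value `v` (the qubit `p` plays no role). -/
def signGate (p q : Fin m ⊕ Fin w) (v : Bool) : List (Gate m w) := cg p q (fun _ => signU v)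

/-- Flip `t` if `a` is true and `b` has the value `v`. -/
def toffoli (a b : Fin m ⊕ Fin w) (v : Bool) (t : Fin m ⊕ Fin w) : List (Gate m w) :=
  cg b t (fun x => if x = v then sqrtNotU false else 1) ++ cg a b (fun x => if x = true then notU else 1) ++
  cg b t (fun x => if x = v then sqrtNotU true else 1) ++
  cg a b (fun x => if x = true then notU else 1) ++ cg a t (fun x => if x = true then sqrtNotU false else 1)

theorem cost_toffoli (τ : Schedule m) (a b : Fin m ⊕ Fin w) (v : Bool) (t : Fin m ⊕ Fin w) :
    circCost τ (toffoli a b v t) ≤ 5 := by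
  simp only [toffoli, circCost_append]
  linarith [cost_cg τ b t (fun x => if x = v then sqrtNotU false else 1),
    cost_cg τ a b (fun x => if x = true then notU else 1),
    cost_cg τ b t (fun x => if x = v then sqrtNotU true else 1),
    cost_cg τ a t (fun x => if x = true then sqrtNotU false else 1)]

theorem touches_toffoli {a b t : Fin m ⊕ Fin w} {v : Bool} {g : Gate m w}
    (hg : g ∈ toffoli a b v t) {x : Fin m ⊕ Fin w} (hx : g.Touches x) : x = a ∨ x = b ∨ x = t := by
  simp only [toffoli, List.mem_append] at hg
  rcases hg with (((hg | hg) | hg) | hg) | hg <;> rcases touches_cg hg hx with h | h <;> simp [h]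

theorem run_cnot {p q : Fin m ⊕ Fin w} (h : p ≠ q) (v : Bool)
    (ψ : (Fin m ⊕ Fin w → Bool) × (G × Ω) → ℂ) (s : (Fin m ⊕ Fin w → Bool) × (G × Ω)) :
    run S (cnot p v q) ψ s = ψ (upd s q (s.1 q ^^ (s.1 p == v))) := by
  rw [cnot, run_cg S h]
  by_cases hp : s.1 p = v
  · simp only [hp, if_true, notU]
    cases hq : s.1 q <;> simp
  · simp only [hp, if_false, Matrix.one_apply, OneMemClass.coe_one]
    have : (s.1 p == v) = false := by simpa using hp
    rw [this]
    cases hq : s.1 q <;> simp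

theorem run_signGate {p q : Fin m ⊕ Fin w} (h : p ≠ q) (v : Bool)
    (ψ : (Fin m ⊕ Fin w → Bool) × (G × Ω) → ℂ) (s : (Fin m ⊕ Fin w → Bool) × (G × Ω)) :
    run S (signGate p q v) ψ s = if s.1 q = v then - ψ s else ψ s := by
  rw [signGate, run_cg S h]
  have e : ∀ b, s.1 q = b → upd s q b = s := fun b hb => by subst hb; simp [upd]
  cases hq : s.1 q <;> cases v <;> simp [signU, e _ hq]

/-- With α the value of `a` and β the truth value of b = v, the five gates apply the square root of
`NOT` to `t` with total exponent β − (α ⊕ β) + α = 2αβ. The two `NOT`s on `b` cancel. -/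
theorem run_toffoli {a b t : Fin m ⊕ Fin w} (hab : a ≠ b) (hat : a ≠ t) (hbt : b ≠ t) (v : Bool)
    (ψ : (Fin m ⊕ Fin w → Bool) × (G × Ω) → ℂ) (s : (Fin m ⊕ Fin w → Bool) × (G × Ω)) :
    run S (toffoli a b v t) ψ s = ψ (upd s t (s.1 t ^^ (s.1 a && (s.1 b == v)))) := by
  have hI : Complex.I ^ 2 = -1 := Complex.I_sq
  have e1 : ∀ x, (upd s t x).1 a = s.1 a := fun x => Function.update_of_ne hat _ _
  have e2 : ∀ x, (upd s t x).1 b = s.1 b := fun x => Function.update_of_ne hbt _ _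
  have e3 : ∀ x, (upd s t x).1 t = x := fun x => Function.update_self _ _ _
  have e4 : ∀ x y, (upd (upd s t x) b y).1 a = s.1 a := fun x y => by
    rw [← e1 x]; exact Function.update_of_ne hab _ _
  have e5 : ∀ x y, (upd (upd s t x) b y).1 t = x := fun x y =>
    (Function.update_of_ne hbt.symm _ _).trans (e3 x)
  have e6 : ∀ x y, (upd (upd s t x) b y).1 b = y := fun x y => Function.update_self _ _ _
  have e7 : ∀ x y z, upd (upd (upd s t x) b y) t z = upd (upd s t z) b y := fun x y z => by
    simp only [upd]
    rw [Function.update_comm hbt, Function.update_idem]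
  have e8 : ∀ x y z, upd (upd (upd s t x) b y) b z = upd (upd s t x) b z := fun x y z => by
    simp [upd]
  have e9 : ∀ x y, s.1 b = y → upd (upd s t x) b y = upd s t x := fun x y h => by
    simp only [upd, Prod.mk.injEq, and_true]
    rw [Function.update_eq_iff]
    exact ⟨by rw [Function.update_of_ne hbt, h], fun _ _ => rfl⟩
  unfold toffoli
  rw [run_append, run_append, run_append, run_append]
  have c := fun φ s' => run_cnot S hab true φ s'
  simp only [cnot] at c
  simp only [run_cg S hat, c, run_cg S hbt, e1, e2, e4, e5, e6, e7, e8]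
  cases ha : s.1 a <;> cases hb : s.1 b <;> cases ht : s.1 t <;> cases v <;>
    simp [sqrtNotU, e9 _ _ hb] <;> ring_nf
  all_goals simp only [hI]
  all_goals ring_nf

end Semantics

/-! ## The reflection about the initial state -/

/-- The `k`-th work qubit. -/
def wk {m : ℕ} (k : ℕ) : Fin m ⊕ Fin (m + 9) := Sum.inr (Fin.ofNat (m + 9) k)

theorem wk_inj {m i j : ℕ} (hi : i < m + 9) (hj : j < m + 9) (h : (wk i : Fin m ⊕ Fin (m + 9)) = wk j) :
    i = j := by
  have := Fin.val_eq_of_eq (Sum.inr.inj h)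
  simpa [Fin.ofNat, Nat.mod_eq_of_lt hi, Nat.mod_eq_of_lt hj] using this

theorem wk_ne {m i j : ℕ} (hi : i < m + 9) (hj : j < m + 9) (h : i ≠ j) :
    (wk i : Fin m ⊕ Fin (m + 9)) ≠ wk j := fun h' => h (wk_inj hi hj h')

theorem inl_ne_wk {m : ℕ} (k : Fin m) (i : ℕ) : (Sum.inl k : Fin m ⊕ Fin (m + 9)) ≠ wk i := by
  simp [wk]

/-- The first `J` flags. -/
def flagList (m : ℕ) : ℕ → List (Fin m ⊕ Fin (m + 9))
  | 0 => []
  | J + 1 => flagList m J ++ if h : J < m then [Sum.inl ⟨J, h⟩] else []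

theorem mem_flagList {m J : ℕ} {q : Fin m ⊕ Fin (m + 9)} :
    q ∈ flagList m J ↔ ∃ k : Fin m, k.val < J ∧ q = Sum.inl k := by
  induction J with
  | zero => simp [flagList]
  | succ J ih =>
    rw [flagList, List.mem_append, ih]
    constructor
    · rintro (⟨k, hk, rfl⟩ | h)
      · exact ⟨k, by omega, rfl⟩
      · split_ifs at h with hJ
        · rw [List.mem_singleton] at h
          exact ⟨⟨J, hJ⟩, by simp, h⟩
        · simp at h
    · rintro ⟨k, hk, rfl⟩
      by_cases h : k.val = J
      · right
        have hJ : J < m := h ▸ k.2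
        rw [dif_pos hJ, List.mem_singleton]
        congr 1
        exact Fin.ext h
      · exact Or.inl ⟨k, by omega, rfl⟩

theorem length_flagList (m J : ℕ) : (flagList m J).length ≤ J := by
  induction J with
  | zero => simp [flagList]
  | succ J ih =>
    rw [flagList, List.length_append]
    split_ifs <;> simp <;> omega

/-- Change the sign if the work qubit `a` is true and the qubits of the list are false, using the
work qubits after `a`. -/
def multiSign {m : ℕ} : List (Fin m ⊕ Fin (m + 9)) → ℕ → List (Gate m (m + 9))
  | [], a => signGate (wk 0) (wk a) true
  | q :: L, a => toffoli (wk a) q false (wk (a + 1)) ++ multiSign L (a + 1) ++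
      toffoli (wk a) q false (wk (a + 1))

theorem cost_multiSign {m : ℕ} (τ : Schedule m) (L : List (Fin m ⊕ Fin (m + 9))) (a : ℕ) :
    circCost τ (multiSign L a) ≤ 10 * L.length + 1 := by
  induction L generalizing a with
  | nil => exact cost_cg τ _ _ _
  | cons q L ih =>
    simp only [multiSign, circCost_append, List.length_cons]
    have := ih (a + 1)
    have := cost_toffoli τ (wk a) q false (wk (a + 1))
    omega

/-- The qubits that are tested by the reflection. -/
def tested (m J : ℕ) : List (Fin m ⊕ Fin (m + 9)) := [wk 0, wk 1, wk 2, wk 3] ++ flagList m J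

/-- Reflection about the initial state, on the states in which the flags from `J` on and the
ancillas are in their initial states. -/
def reflect (m J : ℕ) : List (Gate m (m + 9)) :=
  [.start (Fin.ofNat (m + 9) 4)] ++ multiSign (tested m J) 4 ++ [.start (Fin.ofNat (m + 9) 4)]

theorem cost_reflect {m : ℕ} (τ : Schedule m) (J : ℕ) : circCost τ (reflect m J) ≤ 10 * J + 43 := by
  simp only [reflect, circCost_append]
  have := cost_multiSign τ (tested m J) 4
  have h := length_flagList m J
  have h' : (tested m J).length = 4 + (flagList m J).length := by
    simp [tested]; omega
  have e : circCost τ [.start (Fin.ofNat (m + 9) 4)] = 1 := by simp [circCost, Gate.cost]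
  rw [e]
  omega

section Semantics

variable {m : ℕ} {G : Type u} [Fintype G] [DecidableEq G] {Ω : Finset ℝ≥0}
  (S : VarTimeSampler m G Ω)

/-- Basis states of the flags, the work qubits and the register. -/
abbrev Basis (m : ℕ) (C : Type*) := (Fin m ⊕ Fin (m + 9) → Bool) × C

theorem upd_self {Q C : Type*} [DecidableEq Q] (s : (Q → Bool) × C) (q : Q) (y : Bool) :
    (upd s q y).1 q = y := Function.update_self _ _ _

theorem upd_of_ne {Q C : Type*} [DecidableEq Q] (s : (Q → Bool) × C) {q q' : Q} (h : q' ≠ q)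
    (y : Bool) : (upd s q y).1 q' = s.1 q' := Function.update_of_ne h _ _

theorem upd_upd {Q C : Type*} [DecidableEq Q] (s : (Q → Bool) × C) (q : Q) (y y' : Bool) :
    upd (upd s q y) q y' = upd s q y' := by simp [upd]

theorem upd_eq_self {Q C : Type*} [DecidableEq Q] (s : (Q → Bool) × C) (q : Q) {y : Bool}
    (h : s.1 q = y) : upd s q y = s := by subst h; simp [upd]

/-- A ladder of Toffoli gates stores the running conjunction in successive ancillas; after the sign
change it is erased by the same gates. The final sign gate has `wk 0` as a dummy partner, which is
why `a` must be positive. -/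
theorem run_multiSign (L : List (Fin m ⊕ Fin (m + 9))) (a : ℕ) (ha : 1 ≤ a)
    (hL : a + L.length < m + 9) (hq : ∀ q ∈ L, ∀ i, a ≤ i → i < m + 9 → q ≠ wk i)
    (ψ : Basis m (G × Ω) → ℂ)
    (hψ : SuppOn (fun s => ∀ i, a < i → i < m + 9 → s.1 (wk i) = false) ψ) :
    run S (multiSign L a) ψ =
      fun s => (if s.1 (wk a) = true ∧ ∀ q ∈ L, s.1 q = false then -1 else 1) * ψ s := by
  induction L generalizing a ψ with
  | nil =>
    funext s
    rw [multiSign, run_signGate S (wk_ne (by omega) (by simpa using hL) (by omega))]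
    by_cases h : s.1 (wk a) = true <;> simp [h]
  | cons q L ih =>
    simp only [List.length_cons] at hL
    have n1 : (wk a : Fin m ⊕ Fin (m + 9)) ≠ q :=
      (hq q List.mem_cons_self a le_rfl (by omega)).symm
    have n2 : (wk a : Fin m ⊕ Fin (m + 9)) ≠ wk (a + 1) := wk_ne (by omega) (by omega) (by omega)
    have n3 : q ≠ wk (a + 1) := hq q List.mem_cons_self (a + 1) (by omega) (by omega)
    have hLq : ∀ q' ∈ L, q' ≠ wk (a + 1) := fun q' hq' =>
      hq q' (List.mem_cons_of_mem _ hq') (a + 1) (by omega) (by omega)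
    rw [multiSign, run_append, run_append, ih (a + 1) (by omega) (by omega)
      (fun q' hq' i hi hi' => hq q' (List.mem_cons_of_mem _ hq') i (by omega) hi')]
    · funext s
      simp only [run_toffoli S n1 n2 n3, upd_self, upd_of_ne _ n2, upd_of_ne _ n3,
        upd_upd]
      have e : (((s.1 (wk (a + 1)) ^^ (s.1 (wk a) && s.1 q == false)) ^^
        (s.1 (wk a) && s.1 q == false))) = s.1 (wk (a + 1)) := by simp
      rw [e, upd_eq_self s _ rfl]
      by_cases h0 : ψ s = 0
      · simp [h0]
      · have h1 := hψ s h0 (a + 1) (by omega) (by omega)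
        congr 1
        have e2 : (∀ q' ∈ L, (upd s (wk (a + 1))
            (s.1 (wk (a + 1)) ^^ (s.1 (wk a) && s.1 q == false))).1 q' = false) ↔
            ∀ q' ∈ L, s.1 q' = false :=
          forall_congr' fun q' => forall_congr' fun hq' => by rw [upd_of_ne _ (hLq q' hq')]
        rw [h1] at e2
        simp only [h1, e2, List.forall_mem_cons]
        congr 1
        simp [and_assoc]
    · intro s hs i hi hi'
      rw [run_toffoli S n1 n2 n3] at hs
      have := hψ _ hs i (by omega) hi'
      rwa [upd_of_ne _ (wk_ne hi' (by omega) (by omega))] at this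

theorem run_start {w : ℕ} (t : Fin w) (ψ : (Fin m ⊕ Fin w → Bool) × (G × Ω) → ℂ)
    (s : (Fin m ⊕ Fin w → Bool) × (G × Ω)) :
    run S [.start t] ψ s = ψ (upd s (Sum.inr t) (s.1 (Sum.inr t) ^^ decide (s.2 = S.start))) := by
  rw [run_cons, run_nil]
  simp only [Gate.apply, applyCtrl, if_true, startMatrix, Fintype.sum_prod_type, Fintype.sum_bool,
    upd]
  have hs : ∀ (b : Bool) (f : G × Ω → ℂ), (∑ c, (if s.2 = c ∧
      (if c = S.start then s.1 (Sum.inr t) = !b else s.1 (Sum.inr t) = b) then 1 else 0) * f c) =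
      if (if s.2 = S.start then s.1 (Sum.inr t) = !b else s.1 (Sum.inr t) = b) then f s.2 else 0 := by
    intro b f
    rw [Finset.sum_eq_single s.2]
    · simp
    · intro c _ hc
      rw [if_neg (fun h => hc h.1.symm), zero_mul]
    · simp
  have := fun b => hs b (fun c => ψ (Function.update s.1 (Sum.inr t) b, c))
  rw [← Fintype.sum_prod_type', ← Fintype.sum_prod_type', Fintype.sum_prod_type,
    Fintype.sum_prod_type, ← Fintype.sum_prod_type', ← Fintype.sum_prod_type', this, this]
  by_cases h : s.2 = S.start <;> cases hb : s.1 (Sum.inr t) <;> simp [h]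

/-- The qubits that are not used by the circuits on the first `J` flags, and the ancillas. -/
def Unused (m J : ℕ) (q : Fin m ⊕ Fin (m + 9)) : Prop :=
  (∃ k : Fin m, J ≤ k.val ∧ q = Sum.inl k) ∨ ∃ i, 4 ≤ i ∧ i < m + 9 ∧ q = wk i

theorem tested_ne {J : ℕ} {q : Fin m ⊕ Fin (m + 9)} (hq : q ∈ tested m J) (i : ℕ) (h4 : 4 ≤ i)
    (hi : i < m + 9) : q ≠ wk i := by
  simp only [tested, List.mem_append, List.mem_cons, List.not_mem_nil, or_false, mem_flagList] at hq
  rcases hq with (rfl | rfl | rfl | rfl) | ⟨k, -, rfl⟩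
  · exact wk_ne (by omega) hi (by omega)
  · exact wk_ne (by omega) hi (by omega)
  · exact wk_ne (by omega) hi (by omega)
  · exact wk_ne (by omega) hi (by omega)
  · exact inl_ne_wk k i

/-- The first start gate writes into ancilla 4 whether the register is in its initial state, the
ladder continues the conjunction from there, and the second start gate erases it. -/
theorem run_reflect_diagonal (J : ℕ) (hJ : J ≤ m) (ψ : Basis m (G × Ω) → ℂ)
    (hψ : SuppOn (fun s => ∀ i, 4 ≤ i → i < m + 9 → s.1 (wk i) = false) ψ) :
    run S (reflect m J) ψ = fun s =>
      (if s.2 = S.start ∧ ∀ q ∈ tested m J, s.1 q = false then -1 else 1) * ψ s := by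
  have hst : ∀ (φ : Basis m (G × Ω) → ℂ) s, run S [.start (Fin.ofNat (m + 9) 4)] φ s =
      φ (upd s (wk 4) (s.1 (wk 4) ^^ decide (s.2 = S.start))) := fun φ s => run_start S _ φ s
  rw [reflect, run_append, run_append, run_multiSign S _ 4 (by omega)
    -- The ladder starts at ancilla 4 and has at most m + 4 rungs, so its last ancilla is m + 8.
    -- This fixes the number m + 9 of work qubits.
    (by have := length_flagList m J; simp only [tested, List.length_append, List.length_cons,
          List.length_nil]; omega)
    (fun q hq i h4 hi => tested_ne hq i h4 hi)]
  · funext s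
    rw [hst]
    simp only [hst, upd_self, upd_upd]
    have h2 : (upd s (wk 4) (s.1 (wk 4) ^^ decide (s.2 = S.start))).2 = s.2 := rfl
    have e2 : (∀ q ∈ tested m J, (upd s (wk 4) (s.1 (wk 4) ^^ decide (s.2 = S.start))).1 q = false) ↔
        ∀ q ∈ tested m J, s.1 q = false :=
      forall_congr' fun q' => forall_congr' fun hq' => by
        rw [upd_of_ne _ (tested_ne hq' 4 le_rfl (by omega))]
    have e : ((s.1 (wk 4) ^^ decide (s.2 = S.start)) ^^ decide (s.2 = S.start)) = s.1 (wk 4) := by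
      simp
    simp only [e2, h2, e, upd_eq_self s _ rfl]
    by_cases h0 : ψ s = 0
    · simp [h0]
    · have h1 : s.1 (wk 4) = false := hψ s h0 4 le_rfl (by omega)
      simp only [h1, Bool.false_xor, decide_eq_true_eq]
  · intro s hs i hi hi'
    rw [hst] at hs
    have := hψ _ hs i (by omega) hi'
    rwa [upd_of_ne _ (wk_ne hi' (by omega) (by omega))] at this

theorem pres_reflect (J J' : ℕ) (hJ : J ≤ m) :
    Pres S (fun s => ∀ q, Unused m J' q → s.1 q = false) (reflect m J) := by
  refine pres_of_diagonal _ (fun s => if s.2 = S.start ∧ ∀ q ∈ tested m J, s.1 q = false then -1 else 1)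
    (fun s => ∀ i, 4 ≤ i → i < m + 9 → s.1 (wk i) = false) ?_ ?_ ?_
  · exact fun s hs i h4 hi => hs _ (Or.inr ⟨i, h4, hi, rfl⟩)
  · intro s
    split_ifs <;> norm_num
  · exact fun ψ hψ => run_reflect_diagonal S J hJ ψ hψ

theorem wk_cases (q : Fin m ⊕ Fin (m + 9)) :
    (∃ k : Fin m, q = Sum.inl k) ∨ ∃ i, i < m + 9 ∧ q = wk i := by
  rcases q with k | i
  · exact Or.inl ⟨k, rfl⟩
  · refine Or.inr ⟨i.val, i.2, ?_⟩
    simp [wk]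

/-- On states whose remaining qubits are unset, testing the first `J` flags is as good as testing
all qubits. Testing no more keeps the cost proportional to `J`, which the running time bounds, while
m may be far larger. -/
theorem run_reflect (J : ℕ) (hJ : J ≤ m) (ψ : Basis m (G × Ω) → ℂ)
    (hψ : SuppOn (fun s => ∀ q, Unused m J q → s.1 q = false) ψ) :
    run S (reflect m J) ψ = ψ + (-2 * ψ (fun _ => false, S.start)) • initState S.start := by
  rw [run_reflect_diagonal S J hJ ψ (fun s hs i h4 hi => hψ s hs _ (Or.inr ⟨i, h4, hi, rfl⟩))]
  funext s
  obtain ⟨z, c⟩ := s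
  simp only [Pi.add_apply, Pi.smul_apply, smul_eq_mul, initState]
  by_cases h0 : ψ (z, c) = 0
  · by_cases h : (∀ q, z q = false) ∧ c = S.start
    · have hz : z = fun _ => false := funext h.1
      obtain ⟨-, rfl⟩ := h
      rw [hz] at h0 ⊢
      simp only [h0, mul_zero, zero_mul, add_zero]
    · rw [if_neg h, h0]; simp
  · have hz := hψ _ h0
    have hall : (∀ q ∈ tested m J, z q = false) ↔ ∀ q, z q = false := by
      refine ⟨fun h q => ?_, fun h q _ => h q⟩
      rcases wk_cases q with ⟨k, rfl⟩ | ⟨i, hi, rfl⟩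
      · by_cases hk : k.val < J
        · exact h _ (List.mem_append_right _ (mem_flagList.mpr ⟨k, hk, rfl⟩))
        · exact hz _ (Or.inl ⟨k, not_lt.mp hk, rfl⟩)
      · by_cases hi4 : 4 ≤ i
        · exact hz _ (Or.inr ⟨i, hi4, hi, rfl⟩)
        · apply h
          apply List.mem_append_left
          have : i = 0 ∨ i = 1 ∨ i = 2 ∨ i = 3 := by omega
          rcases this with rfl | rfl | rfl | rfl <;> simp
    simp only [hall]
    by_cases h : (∀ q, z q = false) ∧ c = S.start
    · have hz : z = fun _ => false := funext h.1
      rw [if_pos h.symm, if_pos h, hz, h.2]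
      ring
    · rw [if_neg (fun h' => h h'.symm), if_neg h]
      ring

end Semantics

/-! ## The states of a variable-time algorithm -/

/-- At most one flag is set. -/
def AtMostOne {m : ℕ} (z : Fin m → Bool) : Prop := ∀ i j, z i = true → z j = true → i = j

section States

variable {m : ℕ} {C : Type u} [Fintype C] [DecidableEq C] (A : VarTimeAlgorithm m C)

/-- The state after `k` steps. -/
def stN : ℕ → ((Fin m → Bool) × C → ℂ)
  | 0 => initState A.start
  | k + 1 => if h : k < m then A.applyStep id (fun _ => True) ⟨k, h⟩ false (stN k) else stN k

theorem stateAfter_eq (j : Fin (m + 1)) : A.stateAfter j = stN A j.val := by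
  induction j using Fin.induction with
  | zero => rfl
  | succ i ih =>
    have h1 : A.stateAfter i.succ = A.applyStep id (fun _ => True) i false (A.stateAfter i.castSucc) := by
      simp only [VarTimeAlgorithm.stateAfter, Fin.induction_succ]
    rw [h1, ih, Fin.val_succ, stN, dif_pos i.2]
    rfl

theorem stN_succ {k : ℕ} (h : k < m) (z : Fin m → Bool) (c : C) :
    stN A (k + 1) (z, c) = if ∀ j : Fin m, j.val < k → z j = false then
      ∑ r : Bool × C, (A.core ⟨k, h⟩ : Matrix (Bool × C) (Bool × C) ℂ) (z ⟨k, h⟩, c) r *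
        stN A k (Function.update z ⟨k, h⟩ r.1, r.2) else stN A k (z, c) := by
  rw [stN, dif_pos h]
  simp only [VarTimeAlgorithm.applyStep, applyCtrl, id, Fin.lt_def]
  simp

/-- A step acts only where all earlier flags are unset, and later flags have not been reached yet.
So the flag of the current step is the only one that can be set in a branch on which the step acts.
-/
theorem suppOn_stN (k : ℕ) :
    SuppOn (fun s => AtMostOne s.1 ∧ ∀ i : Fin m, k ≤ i.val → s.1 i = false) (stN A k) := by
  induction k with
  | zero =>
    rintro ⟨z, c⟩ hs
    have h : ∀ q, z q = false := by
      by_contra h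
      exact hs (by simp only [stN, initState, h, false_and, if_false])
    exact ⟨fun i j hi => by simp [h i] at hi, fun i _ => h i⟩
  | succ k ih =>
    rintro ⟨z, c⟩ hs
    by_cases hk : k < m
    · rw [stN_succ A hk] at hs
      split_ifs at hs with hz
      · obtain ⟨r, -, hr⟩ := Finset.exists_ne_zero_of_sum_ne_zero hs
        have h1 := ih _ (right_ne_zero_of_mul hr)
        simp only at h1
        have h2 : ∀ i : Fin m, i.val ≠ k → z i = false := by
          intro i hi
          rcases lt_or_gt_of_ne hi with h | h
          · exact hz i h
          · have := h1.2 i h.le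
            rwa [Function.update_of_ne (fun h' => hi (by rw [h']))] at this
        refine ⟨fun i j hi hj => ?_, fun i hi => h2 i (by omega)⟩
        have e1 : i.val = k := by
          by_contra h; simp [h2 i h] at hi
        have e2 : j.val = k := by
          by_contra h; simp [h2 j h] at hj
        exact Fin.ext (e1.trans e2.symm)
      · exact ⟨(ih _ hs).1, fun i hi => (ih _ hs).2 i (by omega)⟩
    · rw [stN, dif_neg hk] at hs
      exact ⟨(ih _ hs).1, fun i hi => (ih _ hs).2 i (by omega)⟩

/-- A stopped branch fails the control of every later step, so its amplitude is frozen. Hence events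
at intermediate times can be read off from the final state. -/
theorem stN_stopped {k l : ℕ} (hkl : k ≤ l) (z : Fin m → Bool) (c : C) (j : Fin m) (hj : j.val < k)
    (hz : z j = true) : stN A l (z, c) = stN A k (z, c) := by
  induction l, hkl using Nat.le_induction with
  | base => rfl
  | succ l hkl ih =>
    by_cases h : l < m
    · rw [stN_succ A h, if_neg, ih]
      intro h'
      have := h' j (by omega)
      simp [hz] at this
    · rw [stN, dif_neg h, ih]

theorem norm_stN (k : ℕ) : ∑ s, ‖stN A k s‖ ^ 2 = 1 := by
  have key : ip (stN A k) (stN A k) = 1 := by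
    induction k with
    | zero =>
      rw [stN, ip_initState]
      simp [initState]
    | succ k ih =>
      by_cases h : k < m
      · have hP : ∀ (s : (Fin m → Bool) × C) (d : Bool × C),
            ((∀ j, j < (⟨k, h⟩ : Fin m) → ((qubitReg (⟨k, h⟩ : Fin m)).set s d).1 j = false) ∧ True) ↔
            ((∀ j, j < (⟨k, h⟩ : Fin m) → s.1 j = false) ∧ True) := by
          intro s d
          refine and_congr_left fun _ => forall_congr' fun j => forall_congr' fun hj => ?_
          simp only [qubitReg]
          rw [Function.update_of_ne hj.ne]
        rw [stN, dif_pos h, VarTimeAlgorithm.applyStep, applyCtrl_eq, ip_applyAt _ _ hP,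
          applyAt_applyAt _ _ hP]
        have hM := (Matrix.mem_unitaryGroup_iff').mp (A.core ⟨k, h⟩).2
        rw [Matrix.star_eq_conjTranspose] at hM
        simp only [Bool.false_eq_true, if_false]
        rw [hM, applyAt_one, ih]
      · rw [stN, dif_neg h, ih]
  rw [ip_self] at key
  exact_mod_cast key

end States

/-! ## The circuits -/

section Circuits

variable (m : ℕ)

/-- The steps from `J` to `J + n - 1`, controlled by the work qubit `0`. -/
def stepGates (J : ℕ) : ℕ → List (Gate m (m + 9))
  | 0 => []
  | n + 1 => stepGates J n ++
      if h : J + n < m then [.step ⟨J + n, h⟩ false (some (Fin.ofNat (m + 9) 0))] else []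

/-- Add the parity of the flags from `J` to `J + n - 1` to the work qubit `1`. -/
def parityGates (J : ℕ) : ℕ → List (Gate m (m + 9))
  | 0 => []
  | n + 1 => parityGates J n ++
      if h : J + n < m then cnot (Sum.inl ⟨J + n, h⟩) true (wk 1) else []

/-- Change the sign for each of the first `J` flags that is set. -/
def signGates : ℕ → List (Gate m (m + 9))
  | 0 => []
  | J + 1 => signGates J ++ if h : J < m then signGate (wk 0) (Sum.inl ⟨J, h⟩) true else []

/-- Record in the work qubit `3` whether the reference branch was taken, or the algorithm has stopped
in one of the steps from `J` to `J + n - 1` with success of the Bernoulli sampler. -/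
def extractGates (J n : ℕ) (a b : ℝ) (hab : 0 ≤ a ∧ a < b) : List (Gate m (m + 9)) :=
  parityGates m J n ++ [.bernoulli a b hab false (Fin.ofNat (m + 9) 2)] ++
    toffoli (wk 2) (wk 1) true (wk 3) ++ cnot (wk 0) false (wk 3)

/-- The gates of the `j`-th level, before the amplification. The times are cut into brackets
`[J j, J (j + 1))`, and the last bracket is the one with number `l`. -/
def levelGates (J : ℕ → ℕ) (l : ℕ) (a b : ℝ) (hab : 0 ≤ a ∧ a < b) (j : ℕ) :
    List (Gate m (m + 9)) :=
  if j < l then stepGates m (J j) (J (j + 1) - J j)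
  else if j = l then stepGates m (J l) (J (l + 1) - J l) ++
    extractGates m (J l) (J (l + 1) - J l) a b hab
  else []

/-- The reflection about the good subspace in the `j`-th level. -/
def levelSign (J : ℕ → ℕ) (l j : ℕ) : List (Gate m (m + 9)) :=
  if j < l then signGates m (J (j + 1)) else signGate (wk 0) (wk 3) false

/-- The initial rotation of the work qubit `0`. -/
def prepGates (ν : ℝ) (hν : 0 ≤ ν ∧ ν ≤ 1) : List (Gate m (m + 9)) :=
  cg (wk 1) (wk 0) (fun _ => ⟨rotation ν, mem_unitary_rotation ν hν.1 hν.2⟩)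

/-- The circuit after `j` amplified levels. -/
def ampCirc (ν : ℝ) (hν : 0 ≤ ν ∧ ν ≤ 1) (J : ℕ → ℕ) (l : ℕ) (a b : ℝ) (hab : 0 ≤ a ∧ a < b) :
    ℕ → List (Gate m (m + 9))
  | 0 => prepGates m ν hν
  | j + 1 =>
    (ampCirc ν hν J l a b hab j ++ levelGates m J l a b hab j) ++ levelSign m J l j ++
      invCirc (ampCirc ν hν J l a b hab j ++ levelGates m J l a b hab j) ++
      -- Levels beyond `l` run no further steps, so the flags from `J (l + 1)` on are still unset
      -- there.
      reflect m (J (min j l + 1)) ++ (ampCirc ν hν J l a b hab j ++ levelGates m J l a b hab j)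

/-- The sampling circuit. -/
def sampleCirc (ν : ℝ) (hν : 0 ≤ ν ∧ ν ≤ 1) (J : ℕ → ℕ) (l : ℕ) (a b : ℝ) (hab : 0 ≤ a ∧ a < b)
    (N : ℕ) : List (Gate m (m + 9)) :=
  ampCirc m ν hν J l a b hab N ++ levelGates m J l a b hab N

end Circuits

/-! ## Unused qubits -/

section Touches

variable {m : ℕ}

theorem unused_wk {J i : ℕ} (hi : i < m + 9) : Unused m J (wk i) ↔ 4 ≤ i := by
  constructor
  · rintro (⟨k, -, h⟩ | ⟨i', h4, hi', h⟩)
    · exact absurd h.symm (inl_ne_wk k i)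
    · rwa [wk_inj hi hi' h]
  · exact fun h => Or.inr ⟨i, h, hi, rfl⟩

theorem unused_inl {J : ℕ} {k : Fin m} : Unused m J (Sum.inl k) ↔ J ≤ k.val := by
  constructor
  · rintro (⟨k', h, e⟩ | ⟨i', -, -, h⟩)
    · rwa [Sum.inl.inj e]
    · exact absurd h (inl_ne_wk k i')
  · exact fun h => Or.inl ⟨k, h, rfl⟩

theorem not_touches_stepGates {J n J' : ℕ} (h : J + n ≤ J') :
    ∀ g ∈ stepGates m J n, ∀ q, Unused m J' q → ¬ g.Touches q := by
  induction n with
  | zero => simp [stepGates]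
  | succ n ih =>
    intro g hg q hq ht
    rw [stepGates, List.mem_append] at hg
    rcases hg with hg | hg
    · exact ih (by omega) g hg q hq ht
    · split_ifs at hg
      · rw [List.mem_singleton] at hg
        subst hg
        simp only [Gate.Touches] at ht
        subst ht
        rw [unused_inl] at hq
        simp only at hq
        omega
      · simp at hg

theorem not_touches_parityGates {J n J' : ℕ} (h : J + n ≤ J') :
    ∀ g ∈ parityGates m J n, ∀ q, Unused m J' q → ¬ g.Touches q := by
  induction n with
  | zero => simp [parityGates]
  | succ n ih =>
    intro g hg q hq ht
    rw [parityGates, List.mem_append] at hg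
    rcases hg with hg | hg
    · exact ih (by omega) g hg q hq ht
    · split_ifs at hg
      · rcases touches_cg hg ht with rfl | rfl
        · rw [unused_inl] at hq
          simp only at hq
          omega
        · rw [unused_wk (by omega)] at hq
          omega
      · simp at hg

theorem not_touches_extractGates {J n J' : ℕ} {a b : ℝ} {hab : 0 ≤ a ∧ a < b} (h : J + n ≤ J') :
    ∀ g ∈ extractGates m J n a b hab, ∀ q, Unused m J' q → ¬ g.Touches q := by
  intro g hg q hq ht
  have hwk : ∀ i, i < 4 → q ≠ wk i := by
    rintro i hi rfl
    rw [unused_wk (by omega)] at hq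
    omega
  simp only [extractGates, List.mem_append] at hg
  rcases hg with ((hg | hg) | hg) | hg
  · exact not_touches_parityGates h g hg q hq ht
  · rw [List.mem_singleton] at hg
    subst hg
    exact hwk 2 (by omega) ht
  · rcases touches_toffoli hg ht with h | h | h
    · exact hwk 2 (by omega) h
    · exact hwk 1 (by omega) h
    · exact hwk 3 (by omega) h
  · rcases touches_cg hg ht with h | h
    · exact hwk 0 (by omega) h
    · exact hwk 3 (by omega) h

theorem not_touches_levelGates {J : ℕ → ℕ} (hJ : Monotone J) {l : ℕ} {a b : ℝ} {hab : 0 ≤ a ∧ a < b}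
    {j J' : ℕ} (h : J (min j l + 1) ≤ J') :
    ∀ g ∈ levelGates m J l a b hab j, ∀ q, Unused m J' q → ¬ g.Touches q := by
  intro g hg
  unfold levelGates at hg
  split_ifs at hg with h1 h2
  · rw [min_eq_left h1.le] at h
    have := hJ (Nat.le_succ j)
    exact not_touches_stepGates (by simp only [Nat.succ_eq_add_one] at this; omega) g hg
  · subst h2
    rw [min_self] at h
    have := hJ (Nat.le_succ j)
    simp only [Nat.succ_eq_add_one] at this
    rcases List.mem_append.mp hg with hg | hg
    · exact not_touches_stepGates (by omega) g hg
    · exact not_touches_extractGates (by omega) g hg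
  · simp at hg

variable {G : Type u} [Fintype G] [DecidableEq G] {Ω : Finset ℝ≥0} (S : VarTimeSampler m G Ω)

theorem pres_signGates (J J' : ℕ) : Pres S (fun s => ∀ q, Unused m J' q → s.1 q = false)
    (signGates m J) := by
  induction J with
  | zero => exact Pres.nil
  | succ J ih =>
    refine ih.append ?_
    split_ifs with h
    · refine pres_of_diagonal _ (fun s => if s.1 (Sum.inl ⟨J, h⟩) = true then -1 else 1)
        (fun _ => True) (fun _ _ => trivial) (fun s => by split_ifs <;> norm_num) ?_
      intro ψ _
      funext s
      rw [run_signGate S (inl_ne_wk _ _).symm]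
      split_ifs <;> simp
    · exact Pres.nil

theorem pres_levelSign (J : ℕ → ℕ) (l j J' : ℕ) :
    Pres S (fun s => ∀ q, Unused m J' q → s.1 q = false) (levelSign m J l j) := by
  unfold levelSign
  split_ifs
  · exact pres_signGates S _ _
  · refine pres_of_diagonal _ (fun s => if s.1 (wk 3) = false then -1 else 1)
      (fun _ => True) (fun _ _ => trivial) (fun s => by split_ifs <;> norm_num) ?_
    intro ψ _
    funext s
    rw [run_signGate S (wk_ne (by omega) (by omega) (by omega))]
    split_ifs <;> simp

theorem pres_ampCirc (ν : ℝ) (hν : 0 ≤ ν ∧ ν ≤ 1) {J : ℕ → ℕ} (hJ : Monotone J) (hJm : ∀ j, J j ≤ m)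
    (l : ℕ) (a b : ℝ) (hab : 0 ≤ a ∧ a < b) (j J' : ℕ) (hJ' : ∀ i < j, J (min i l + 1) ≤ J') :
    Pres S (fun s => ∀ q, Unused m J' q → s.1 q = false) (ampCirc m ν hν J l a b hab j) := by
  induction j with
  | zero =>
    refine pres_of_not_touches _ _ ?_
    intro g hg q hq ht
    rw [ampCirc, prepGates] at hg
    rcases touches_cg hg ht with rfl | rfl
    · rw [unused_wk (by omega)] at hq; omega
    · rw [unused_wk (by omega)] at hq; omega
  | succ j ih =>
    have h1 := ih fun i hi => hJ' i (by omega)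
    have h2 : Pres S (fun s => ∀ q, Unused m J' q → s.1 q = false) (levelGates m J l a b hab j) :=
      pres_of_not_touches _ _ (not_touches_levelGates hJ (hJ' j (by omega)))
    have h3 := h1.append h2
    exact (((h3.append (pres_levelSign S J l j J')).append h3.inv).append
      (pres_reflect S _ _ (hJm _))).append h3

/-- The `j`-th level amplifies the good part of the state. -/
theorem run_ampCirc_succ (ν : ℝ) (hν : 0 ≤ ν ∧ ν ≤ 1) {J : ℕ → ℕ} (hJ : Monotone J)
    (hJm : ∀ j, J j ≤ m) (l : ℕ) (a b : ℝ) (hab : 0 ≤ a ∧ a < b) (j : ℕ)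
    (good : Basis m (G × Ω) → Prop) [DecidablePred good] (Ψ : Basis m (G × Ω) → ℂ)
    (hΨ : run S (sampleCirc m ν hν J l a b hab j) (initState S.start) = Ψ)
    (hSg : run S (levelSign m J l j) Ψ = fun s => if good s then Ψ s else -Ψ s) :
    run S (ampCirc m ν hν J l a b hab (j + 1)) (initState S.start) =
      fun s => if good s then ((3 - 4 * weight good Ψ : ℝ) : ℂ) * Ψ s
        else ((1 - 4 * weight good Ψ : ℝ) : ℂ) * Ψ s := by
  refine run_amplify (K := fun s => ∀ q, Unused m (J (min j l + 1)) q → s.1 q = false) _ _ _ ?_ ?_ ?_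
    good Ψ hΨ hSg
  · refine (pres_ampCirc S ν hν hJ hJm l a b hab j _ ?_).append
      (pres_of_not_touches _ _ (not_touches_levelGates hJ le_rfl))
    intro i hi
    exact hJ (Nat.succ_le_succ (min_le_min_right l hi.le))
  · exact fun _ _ => rfl
  · exact fun ψ hψ => run_reflect S _ (hJm _) ψ hψ

end Touches

/-! ## The states of the sampling circuits -/

/-- The flags of a basis state. -/
def flags {m : ℕ} {C : Type*} (s : Basis m C) : Fin m → Bool := fun k => s.1 (Sum.inl k)

/-- All work qubits but the first one are in their initial states. -/
def Clean {m : ℕ} {C : Type*} (s : Basis m C) : Prop :=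
  ∀ i, 1 ≤ i → i < m + 9 → s.1 (wk i) = false

section Semantics

variable {m : ℕ} {G : Type u} [Fintype G] [DecidableEq G] {Ω : Finset ℝ≥0}
  (S : VarTimeSampler m G Ω)

/-- The state `Ψ` consists of a run branch of amplitude `g * γ`, which agrees with the state of the
sampler after `J` steps if the first `J₀` flags are not set, and of a reference branch of amplitude
`g * β`. -/
structure LevelState (γ β : ℝ) (J₀ J : ℕ) (g : ℝ) (Ψ : Basis m (G × Ω) → ℂ) : Prop where
  supp : SuppOn (fun s => Clean s ∧ (∀ k : Fin m, J ≤ k.val → flags s k = false) ∧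
    AtMostOne (flags s) ∧ (s.1 (wk 0) = false → ∀ k, flags s k = false)) Ψ
  run : ∀ s, Clean s → (∀ k : Fin m, k.val < J₀ → flags s k = false) → s.1 (wk 0) = true →
    Ψ s = (g * γ : ℝ) * stN S.toVarTimeAlgorithm J (flags s, s.2)
  ref : ∀ s, Clean s → (∀ k, flags s k = false) → s.1 (wk 0) = false →
    Ψ s = if s.2 = S.start then ((g * β : ℝ) : ℂ) else 0

variable {S}

theorem levelState_prep (ν : ℝ) (hν : 0 ≤ ν ∧ ν ≤ 1) :
    LevelState S (√ν) (√(1 - ν)) 0 0 1 (run S (prepGates m ν hν) (initState S.start)) := by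
  classical
  have e : ∀ s, run S (prepGates m ν hν) (initState S.start) s =
      rotation ν (s.1 (wk 0)) false * initState S.start (upd s (wk 0) false) := by
    intro s
    rw [prepGates, run_cg S (wk_ne (by omega) (by omega) (by omega))]
    have : (initState S.start : Basis m (G × Ω) → ℂ) (upd s (wk 0) true) = 0 := by
      have h : ¬ ((∀ q, (upd s (wk 0) true).1 q = false) ∧ (upd s (wk 0) true).2 = S.start) := by
        intro h
        have := h.1 (wk 0)
        rw [upd_self] at this
        exact absurd this (by simp)
      simp only [initState, h, if_false]
    rw [this, mul_zero, zero_add]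
  have e2 : ∀ s : Basis m (G × Ω), (initState S.start : Basis m (G × Ω) → ℂ) (upd s (wk 0) false) =
      if Clean s ∧ (∀ k, flags s k = false) ∧ s.2 = S.start then 1 else 0 := by
    intro s
    have : ((∀ q, (upd s (wk 0) false).1 q = false) ∧ (upd s (wk 0) false).2 = S.start) ↔
        (Clean s ∧ (∀ k, flags s k = false) ∧ s.2 = S.start) := by
      rw [← and_assoc]
      refine and_congr_left fun _ => ⟨fun h => ⟨fun i h1 hi => ?_, fun k => ?_⟩, fun h q => ?_⟩
      · have := h (wk i)
        rwa [upd_of_ne _ (wk_ne hi (by omega) (by omega))] at this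
      · have := h (Sum.inl k)
        rwa [upd_of_ne _ (inl_ne_wk k 0)] at this
      · rcases wk_cases q with ⟨k, rfl⟩ | ⟨i, hi, rfl⟩
        · rw [upd_of_ne _ (inl_ne_wk k 0)]
          exact h.2 k
        · by_cases h0 : i = 0
          · rw [h0, upd_self]
          · rw [upd_of_ne _ (wk_ne hi (by omega) h0)]
            exact h.1 i (by omega) hi
    simp only [initState]
    exact if_congr this rfl rfl
  constructor
  · intro s hs
    rw [e, e2] at hs
    by_cases h : Clean s ∧ (∀ k, flags s k = false) ∧ s.2 = S.start
    · exact ⟨h.1, fun k _ => h.2.1 k, fun i j hi => by simp [h.2.1 i] at hi, fun _ => h.2.1⟩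
    · simp [h] at hs
  · intro s h1 _ h2
    rw [e, e2, h2]
    simp only [stN, initState, h1, true_and, rotation]
    split_ifs <;> simp
  · intro s h1 h2 h3
    rw [e, e2, h3]
    simp only [h1, h2, implies_true, true_and, rotation]
    split_ifs <;> simp

/-- The control on the work qubit 0 protects the reference branch, and the run branch follows the
sampler by linearity. Branches stopped before `J₀` carry other factors from earlier amplifications;
since the step changes only flag k ≥ J₀, they do not mix with the tracked ones. -/
theorem LevelState.step {γ β : ℝ} {J₀ k : ℕ} {g : ℝ} {Ψ : Basis m (G × Ω) → ℂ}
    (h : LevelState S γ β J₀ k g Ψ) (hJ : J₀ ≤ k) (hk : k < m) :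
    LevelState S γ β J₀ (k + 1) g
      (QMean.run S [.step ⟨k, hk⟩ false (some (Fin.ofNat (m + 9) 0))] Ψ) := by
  have e : ∀ s : Basis m (G × Ω), QMean.run S [.step ⟨k, hk⟩ false (some (Fin.ofNat (m + 9) 0))] Ψ s =
      if (∀ j : Fin m, j.val < k → flags s j = false) ∧ s.1 (wk 0) = true then
        ∑ r : Bool × (G × Ω), (S.core ⟨k, hk⟩ : Matrix (Bool × (G × Ω)) (Bool × (G × Ω)) ℂ) (flags s ⟨k, hk⟩, s.2) r *
          Ψ (Function.update s.1 (Sum.inl ⟨k, hk⟩) r.1, r.2)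
      else Ψ s := by
    intro s
    rw [run_cons, run_nil]
    simp only [Gate.apply, VarTimeAlgorithm.applyStep, applyCtrl, Option.mem_def, Option.some.injEq,
      Bool.false_eq_true, if_false, forall_eq', Fin.lt_def]
    exact if_congr Iff.rfl rfl rfl
  have fl : ∀ (s : Basis m (G × Ω)) (r : Bool × (G × Ω)),
      flags (Function.update s.1 (Sum.inl ⟨k, hk⟩) r.1, r.2) =
        Function.update (flags s) ⟨k, hk⟩ r.1 := by
    intro s r
    funext j
    simp only [flags, Function.update_apply, Sum.inl.injEq]
  have wkU : ∀ (s : Basis m (G × Ω)) (r : Bool × (G × Ω)) (i : ℕ),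
      (Function.update s.1 (Sum.inl ⟨k, hk⟩) r.1) (wk i) = s.1 (wk i) := fun s r i =>
    Function.update_of_ne (inl_ne_wk _ i).symm _ _
  constructor
  · intro s hs
    rw [e] at hs
    split_ifs at hs with hz
    · obtain ⟨r, -, hr⟩ := Finset.exists_ne_zero_of_sum_ne_zero hs
      obtain ⟨h1, h2, h3, h4⟩ := h.supp _ (right_ne_zero_of_mul hr)
      rw [fl] at h2 h3
      have hne : ∀ i : Fin m, i.val ≠ k → flags s i = false := by
        intro i hi
        rcases lt_or_gt_of_ne hi with h' | h'
        · exact hz.1 i h'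
        · have := h2 i h'.le
          rwa [Function.update_of_ne (fun h' => hi (by rw [h']))] at this
      refine ⟨fun i h1i hi => ?_, fun i hi => hne i (by omega), fun i j hi hj => ?_,
        fun h0 => absurd (hz.2.symm.trans h0) (by simp)⟩
      · rw [← wkU s r i]
        exact h1 i h1i hi
      · have e1 : i.val = k := by
          by_contra h; simp [hne i h] at hi
        have e2 : j.val = k := by
          by_contra h; simp [hne j h] at hj
        exact Fin.ext (e1.trans e2.symm)
    · obtain ⟨h1, h2, h3, h4⟩ := h.supp _ hs
      exact ⟨h1, fun i hi => h2 i (by omega), h3, h4⟩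
  · intro s h1 h2 h3
    rw [e, stN_succ _ hk]
    simp only [h3, and_true]
    split_ifs with hz
    · rw [Finset.mul_sum]
      refine Finset.sum_congr rfl fun r _ => ?_
      rw [h.run (Function.update s.1 (Sum.inl ⟨k, hk⟩) r.1, r.2)
        (fun i h1i hi => (wkU s r i).trans (h1 i h1i hi)) _ ((wkU s r 0).trans h3), fl]
      · ring
      · intro j hj
        rw [fl, Function.update_of_ne (fun h' => by rw [h'] at hj; simp only at hj; omega)]
        exact h2 j hj
    · exact h.run s h1 h2 h3
  · intro s h1 h2 h3
    rw [e, if_neg (fun h' => by rw [h3] at h'; exact absurd h'.2 (by simp))]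
    exact h.ref s h1 h2 h3

theorem LevelState.steps {γ β : ℝ} {J₀ : ℕ} {g : ℝ} {Ψ : Basis m (G × Ω) → ℂ}
    (h : LevelState S γ β J₀ J₀ g Ψ) (n : ℕ) (hn : J₀ + n ≤ m) :
    LevelState S γ β J₀ (J₀ + n) g (QMean.run S (stepGates m J₀ n) Ψ) := by
  induction n with
  | zero => exact h
  | succ n ih =>
    rw [stepGates, dif_pos (by omega : J₀ + n < m), run_append]
    exact (ih (by omega)).step (by omega) (by omega)

/-- With at most one flag set, the product of the individual signs is −1 exactly if some flag is
set. No multiply controlled gate is needed. -/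
theorem run_signGates {J : ℕ} (Ψ : Basis m (G × Ω) → ℂ)
    (hΨ : SuppOn (fun s => (∀ k : Fin m, J ≤ k.val → flags s k = false) ∧ AtMostOne (flags s)) Ψ) :
    QMean.run S (signGates m J) Ψ = fun s => if ∀ k, flags s k = false then Ψ s else -Ψ s := by
  have key : ∀ J, ∃ c : Basis m (G × Ω) → ℂ, (∀ s, QMean.run S (signGates m J) Ψ s = c s * Ψ s) ∧
      ∀ s, AtMostOne (flags s) → c s = if ∀ k : Fin m, k.val < J → flags s k = false then 1 else -1 := by
    intro J
    induction J with
    | zero => exact ⟨fun _ => 1, fun s => by rw [signGates, run_nil, one_mul], fun s _ => by simp⟩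
    | succ J ih =>
      obtain ⟨c, hc, hc'⟩ := ih
      rw [signGates]
      split_ifs with hJ
      · refine ⟨fun s => if flags s ⟨J, hJ⟩ = true then -c s else c s, fun s => ?_, fun s hs => ?_⟩
        · rw [run_append, run_signGate S (inl_ne_wk _ _).symm, hc]
          change _ = (if s.1 (Sum.inl ⟨J, hJ⟩) = true then -c s else c s) * Ψ s
          by_cases hb : s.1 (Sum.inl ⟨J, hJ⟩) = true
          · rw [if_pos hb, if_pos hb]; ring
          · rw [if_neg hb, if_neg hb]
        · beta_reduce
          rw [hc' s hs]
          by_cases hb : flags s ⟨J, hJ⟩ = true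
          · have h1 : ∀ k : Fin m, k.val < J → flags s k = false := by
              intro k hk
              by_contra hne
              have := hs k ⟨J, hJ⟩ (by simpa using hne) hb
              rw [this] at hk
              exact absurd hk (lt_irrefl _)
            have h2 : ¬ ∀ k : Fin m, k.val < J + 1 → flags s k = false := by
              intro h'
              have := h' ⟨J, hJ⟩ (by simp)
              rw [hb] at this
              exact absurd this (by simp)
            rw [if_pos hb, if_pos h1, if_neg h2]
          · have h2 : (∀ k : Fin m, k.val < J + 1 → flags s k = false) ↔
                ∀ k : Fin m, k.val < J → flags s k = false := by
              refine ⟨fun h k hk => h k (by omega), fun h k hk => ?_⟩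
              rcases Nat.lt_succ_iff_lt_or_eq.mp hk with h' | h'
              · exact h k h'
              · have : k = ⟨J, hJ⟩ := Fin.ext h'
                rw [this]
                simpa using hb
            rw [if_neg hb]
            simp only [h2]
      · refine ⟨c, fun s => by rw [List.append_nil]; exact hc s, fun s hs => ?_⟩
        rw [hc' s hs]
        have h2 : (∀ k : Fin m, k.val < J + 1 → flags s k = false) ↔
            ∀ k : Fin m, k.val < J → flags s k = false :=
          ⟨fun h k hk => h k (by omega), fun h k _ => h k (by have := k.2; omega)⟩
        simp only [h2]
  obtain ⟨c, hc, hc'⟩ := key J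
  funext s
  rw [hc]
  by_cases h0 : Ψ s = 0
  · simp [h0]
  · obtain ⟨h1, h2⟩ := hΨ s h0
    have h3 : (∀ k : Fin m, k.val < J → flags s k = false) ↔ ∀ k, flags s k = false :=
      ⟨fun h k => (lt_or_ge k.val J).elim (h k) (h1 k), fun h k _ => h k⟩
    rw [hc' s h2]
    simp only [h3]
    split_ifs <;> simp

/-- The reference branch never sets a flag, so it is scaled by `x` like the running part. The
stopped branches are scaled by `y` and given up: the threshold moves from `J₀` to `J`. -/
theorem LevelState.amplify {γ β : ℝ} {J₀ J : ℕ} {g : ℝ} {Ψ : Basis m (G × Ω) → ℂ}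
    (h : LevelState S γ β J₀ J g Ψ) (x y : ℝ) :
    LevelState S γ β J J (g * x)
      (fun s => if ∀ k, flags s k = false then (x : ℂ) * Ψ s else (y : ℂ) * Ψ s) := by
  constructor
  · intro s hs
    apply h.supp s
    intro h0
    simp [h0] at hs
  · intro s h1 h2 h3
    by_cases hz : ∀ k, flags s k = false
    · rw [if_pos hz, h.run s h1 (fun k _ => hz k) h3]
      push_cast; ring
    · rw [if_neg hz]
      have hJz : ¬ ∀ k : Fin m, J ≤ k.val → flags s k = false := fun h' =>
        hz fun k => (lt_or_ge k.val J).elim (h2 k) (h' k)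
      have e1 : Ψ s = 0 := by
        by_contra h0
        exact hJz (h.supp s h0).2.1
      have e2 : stN S.toVarTimeAlgorithm J (flags s, s.2) = 0 := by
        by_contra h0
        exact hJz (suppOn_stN _ J _ h0).2
      rw [e1, e2]
      simp
  · intro s h1 h2 h3
    rw [if_pos h2, h.ref s h1 h2 h3]
    split_ifs
    · push_cast; ring
    · simp

/-- Sums over the basis states whose work qubits, but the first one, are not set. -/
theorem sum_clean {C : Type*} [Fintype C] (f : Basis m C → ℝ) (hf : ∀ s, ¬ Clean s → f s = 0) :
    ∑ s, f s = ∑ x : Bool × ((Fin m → Bool) × C),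
      f (Sum.elim x.2.1 (fun i => if i = Fin.ofNat (m + 9) 0 then x.1 else false), x.2.2) := by
  symm
  refine Fintype.sum_of_injective
    (fun x : Bool × ((Fin m → Bool) × C) => ((Sum.elim x.2.1
      (fun i => if i = Fin.ofNat (m + 9) 0 then x.1 else false), x.2.2) : Basis m C))
    ?_ _ _ ?_ (fun _ => rfl)
  · rintro ⟨b, z, c⟩ ⟨b', z', c'⟩ h
    have h1 := (Prod.ext_iff.mp h).1
    have h2 := (Prod.ext_iff.mp h).2
    have h3 : z = z' := funext fun k => congrFun h1 (Sum.inl k)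
    have h4 := congrFun h1 (Sum.inr (Fin.ofNat (m + 9) 0))
    simp only [Sum.elim_inr, if_true] at h4
    simp only at h2
    rw [h2, h3, h4]
  · intro s hs
    apply hf
    intro hc
    apply hs
    refine ⟨(s.1 (wk 0), flags s, s.2), Prod.ext (funext fun q => ?_) rfl⟩
    rcases wk_cases q with ⟨k, rfl⟩ | ⟨i, hi, rfl⟩
    · rfl
    · by_cases h0 : i = 0
      · subst h0
        simp [wk]
      · have : (Fin.ofNat (m + 9) i) ≠ Fin.ofNat (m + 9) 0 := fun h =>
          wk_ne (m := m) hi (by omega) h0 (congrArg Sum.inr h)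
        rw [hc i (by omega) hi]
        simp only [wk, Sum.elim_inr, if_neg this]

/-- Weighted sums of the squared amplitudes in a run branch and a reference branch. -/
theorem LevelState.sum_eq {γ β : ℝ} {J₀ J : ℕ} {g : ℝ} {Ψ : Basis m (G × Ω) → ℂ}
    (h : LevelState S γ β J₀ J g Ψ) (F : (Fin m → Bool) × (G × Ω) → ℝ) (y : ℝ)
    (hF : ∀ x, (∃ k : Fin m, k.val < J₀ ∧ x.1 k = true) → AtMostOne x.1 → F x = 0) :
    ∑ s, (if s.1 (wk 0) = true then F (flags s, s.2) else y) * ‖Ψ s‖ ^ 2 =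
      (g * γ) ^ 2 * ∑ x, F x * ‖stN S.toVarTimeAlgorithm J x‖ ^ 2 + (g * β) ^ 2 * y := by
  have hnc : ∀ s, ¬ Clean s → Ψ s = 0 := fun s hs => by
    by_contra h0
    exact hs (h.supp s h0).1
  rw [sum_clean _ (fun s hs => by rw [hnc s hs]; simp), Fintype.sum_prod_type, Fintype.sum_bool]
  have hcl : ∀ (b : Bool) (x : (Fin m → Bool) × (G × Ω)),
      Clean (Sum.elim x.1 (fun i => if i = Fin.ofNat (m + 9) 0 then b else false), x.2) := by
    intro b x i h1 hi
    have : (Fin.ofNat (m + 9) i) ≠ Fin.ofNat (m + 9) 0 := fun h =>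
      wk_ne (m := m) hi (by omega) (by omega) (congrArg Sum.inr h)
    simp only [wk, Sum.elim_inr, if_neg this]
  have hfl : ∀ (b : Bool) (x : (Fin m → Bool) × (G × Ω)),
      flags (Sum.elim x.1 (fun i => if i = Fin.ofNat (m + 9) 0 then b else false), x.2) = x.1 :=
    fun _ _ => rfl
  have hwk : ∀ (b : Bool) (x : (Fin m → Bool) × (G × Ω)),
      (Sum.elim x.1 (fun i => if i = Fin.ofNat (m + 9) 0 then b else false) :
        Fin m ⊕ Fin (m + 9) → Bool) (wk 0) = b := fun b x => by simp [wk]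
  simp only [hwk, hfl, Bool.false_eq_true, if_true, if_false]
  congr 1
  · rw [Finset.mul_sum]
    refine Finset.sum_congr rfl fun x _ => ?_
    -- Nothing is known about the amplitudes of the branches that stopped before `J₀`. There `F`
    -- vanishes, unless two flags are set, and then both amplitudes are zero.
    by_cases h2 : ∀ k : Fin m, k.val < J₀ → x.1 k = false
    · rw [h.run _ (hcl true x) h2 (hwk true x), hfl, norm_mul, Complex.norm_real, Real.norm_eq_abs,
        mul_pow, sq_abs]
      ring
    · have h3 : ∃ k : Fin m, k.val < J₀ ∧ x.1 k = true := by
        push Not at h2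
        obtain ⟨k, hk, hk'⟩ := h2
        exact ⟨k, hk, by simpa using hk'⟩
      by_cases ha : AtMostOne x.1
      · rw [hF x h3 ha]; ring
      · have e1 : Ψ (Sum.elim x.1 (fun i => if i = Fin.ofNat (m + 9) 0 then true else false), x.2) = 0 := by
          by_contra h0
          exact ha (h.supp _ h0).2.2.1
        have e2 : stN S.toVarTimeAlgorithm J x = 0 := by
          by_contra h0
          exact ha (suppOn_stN _ J _ h0).1
        rw [e1, e2]; simp
  · rw [← Finset.mul_sum, mul_comm]
    congr 1
    rw [Finset.sum_eq_single ((fun _ => false, S.start) : (Fin m → Bool) × (G × Ω))]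
    · rw [h.ref _ (hcl false (fun _ => false, S.start)) (fun _ => rfl)
        (hwk false (fun _ => false, S.start)), if_pos rfl, Complex.norm_real,
        Real.norm_eq_abs, sq_abs]
    · intro x _ hx
      have : Ψ (Sum.elim x.1 (fun i => if i = Fin.ofNat (m + 9) 0 then false else false), x.2) = 0 := by
        by_cases hz : ∀ k, x.1 k = false
        · rw [h.ref _ (hcl false x) hz (hwk false x), if_neg]
          exact fun hc => hx (Prod.ext (funext hz) hc)
        · by_contra h0
          exact hz ((h.supp _ h0).2.2.2 (hwk false x))
      rw [this]; simp
    · simp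

/-- The weight of the states in which no flag is set. -/
def contWeight (S : VarTimeSampler m G Ω) (J : ℕ) : ℝ :=
  ∑ x, (if ∀ k, x.1 k = false then 1 else 0) * ‖stN S.toVarTimeAlgorithm J x‖ ^ 2

theorem LevelState.weight_cont {γ β : ℝ} {J₀ J : ℕ} {g : ℝ} {Ψ : Basis m (G × Ω) → ℂ}
    (h : LevelState S γ β J₀ J g Ψ) :
    weight (fun s => ∀ k, flags s k = false) Ψ = g ^ 2 * (γ ^ 2 * contWeight S J + β ^ 2) := by
  have := h.sum_eq (fun x => if ∀ k, x.1 k = false then 1 else 0) 1 (by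
    rintro x ⟨k, -, hk⟩ -
    exact if_neg fun h' => by rw [h' k] at hk; exact absurd hk (by simp))
  rw [← contWeight] at this
  rw [show g ^ 2 * (γ ^ 2 * contWeight S J + β ^ 2) = (g * γ) ^ 2 * contWeight S J + (g * β) ^ 2 * 1 by
    ring, ← this]
  refine Finset.sum_congr rfl fun s _ => ?_
  by_cases h0 : Ψ s = 0
  · simp [h0]
  · by_cases h1 : s.1 (wk 0) = true
    · simp only [h1, if_true]
      split_ifs <;> simp
    · have := (h.supp s h0).2.2.2 (by simpa using h1)
      simp [h1, this]

end Semantics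

/-! ## The outcome probabilities of the sampling circuits -/

/-- The parity of the flags from `J` to `J + n - 1`. -/
def parityOf {m : ℕ} (J : ℕ) : ℕ → (Fin m → Bool) → Bool
  | 0, _ => false
  | n + 1, z => parityOf J n z ^^ (if h : J + n < m then z ⟨J + n, h⟩ else false)

theorem parityOf_false {m : ℕ} (J n : ℕ) (z : Fin m → Bool)
    (hz : ∀ k : Fin m, J ≤ k.val → k.val < J + n → z k = false) : parityOf J n z = false := by
  induction n with
  | zero => rfl
  | succ n ih =>
    rw [parityOf, ih fun k h1 h2 => hz k h1 (by omega)]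
    split_ifs with h
    · rw [hz ⟨J + n, h⟩ (Nat.le_add_right _ _) (by simp)]
      rfl
    · rfl

/-- As at most one flag is set, parity agrees with disjunction, and parity can be accumulated in one
qubit by `cnot` gates. -/
theorem parityOf_true {m : ℕ} (J n : ℕ) (z : Fin m → Bool) (hz : AtMostOne z) (k : Fin m)
    (h1 : J ≤ k.val) (h2 : k.val < J + n) (hk : z k = true) : parityOf J n z = true := by
  induction n with
  | zero => omega
  | succ n ih =>
    rw [parityOf]
    by_cases h : k.val = J + n
    · have hlt : J + n < m := h ▸ k.2
      have e : (⟨J + n, hlt⟩ : Fin m) = k := Fin.ext h.symm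
      rw [dif_pos hlt, e, hk, parityOf_false]
      · rfl
      · intro k' _ hk'
        by_contra hne
        have := hz k' k (by simpa using hne) hk
        rw [this] at hk'
        omega
    · rw [ih (by omega)]
      split_ifs with hlt
      · have : z ⟨J + n, hlt⟩ = false := by
          by_contra hne
          have := hz k ⟨J + n, hlt⟩ hk (by simpa using hne)
          exact h (by rw [this])
        rw [this]; rfl
      · rfl

theorem flags_upd_wk {m : ℕ} {C : Type*} (s : Basis m C) (i : ℕ) (y : Bool) :
    flags (upd s (wk i) y) = flags s :=
  funext fun k => upd_of_ne s (inl_ne_wk k i) y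

/-- A classical reversible gate permutes the basis, so it can be moved from the state to the
function that is averaged. -/
theorem sum_flip {Q C : Type*} [Fintype Q] [DecidableEq Q] [Fintype C] (q : Q)
    (x : (Q → Bool) × C → Bool) (hx : ∀ s y, x (upd s q y) = x s) (F : (Q → Bool) × C → ℝ)
    (f : (Q → Bool) × C → ℝ) :
    ∑ s, F s * f (upd s q (s.1 q ^^ x s)) = ∑ s, F (upd s q (s.1 q ^^ x s)) * f s := by
  have hinv : ∀ s : (Q → Bool) × C,
      upd (upd s q (s.1 q ^^ x s)) q ((upd s q (s.1 q ^^ x s)).1 q ^^ x (upd s q (s.1 q ^^ x s))) = s := by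
    intro s
    rw [upd_upd, hx, upd_self]
    apply upd_eq_self
    simp
  let e : (Q → Bool) × C ≃ (Q → Bool) × C :=
    ⟨fun s => upd s q (s.1 q ^^ x s), fun s => upd s q (s.1 q ^^ x s), hinv, hinv⟩
  rw [← Equiv.sum_comp e (fun s => F s * f (upd s q (s.1 q ^^ x s)))]
  refine Finset.sum_congr rfl fun s _ => ?_
  change F (upd s q (s.1 q ^^ x s)) * f _ = _
  congr 2
  exact hinv s

theorem sum_pair {Q C : Type*} [Fintype Q] [DecidableEq Q] [Fintype C] (q : Q)
    (f : (Q → Bool) × C → ℝ) :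
    ∑ s, f s = ∑ s, if s.1 q = false then f s + f (upd s q true) else 0 := by
  have h1 : ∑ s, f s = ∑ s : (Q → Bool) × C, (if s.1 q = false then 1 else 0) * f s +
      ∑ s : (Q → Bool) × C, (if s.1 q = true then 1 else 0) * f s := by
    rw [← Finset.sum_add_distrib]
    refine Finset.sum_congr rfl fun s _ => ?_
    cases s.1 q <;> simp
  have h2 := sum_flip q (fun _ : (Q → Bool) × C => true) (fun _ _ => rfl)
    (fun s => if s.1 q = false then 1 else 0) f
  have h3 : ∑ s : (Q → Bool) × C, (if s.1 q = true then 1 else 0) * f s =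
      ∑ s : (Q → Bool) × C, (if s.1 q = false then 1 else 0) * f (upd s q (s.1 q ^^ true)) := by
    rw [h2]
    refine Finset.sum_congr rfl fun s _ => ?_
    rw [upd_self]
    cases s.1 q <;> simp
  rw [h1, h3, ← Finset.sum_add_distrib]
  refine Finset.sum_congr rfl fun s _ => ?_
  cases h : s.1 q <;> simp

section Semantics

variable {m : ℕ} {G : Type u} [Fintype G] [DecidableEq G] {Ω : Finset ℝ≥0}
  (S : VarTimeSampler m G Ω)

theorem run_parityGates (J n : ℕ) (ψ : Basis m (G × Ω) → ℂ) (s : Basis m (G × Ω)) :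
    run S (parityGates m J n) ψ s = ψ (upd s (wk 1) (s.1 (wk 1) ^^ parityOf J n (flags s))) := by
  induction n generalizing s with
  | zero => simp [parityGates, run_nil, parityOf, upd_eq_self]
  | succ n ih =>
    rw [parityGates, run_append]
    split_ifs with h
    · rw [run_cnot S (inl_ne_wk _ _), ih, upd_upd, upd_self, flags_upd_wk, parityOf, dif_pos h]
      congr 2
      simp only [flags]
      cases s.1 (wk 1) <;> cases s.1 (Sum.inl ⟨J + n, h⟩) <;> simp
    · rw [run_nil, ih, parityOf, dif_neg h, Bool.xor_false]

theorem run_bernoulli {w : ℕ} (a b : ℝ) (hab : 0 ≤ a ∧ a < b) (t : Fin w)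
    (ψ : (Fin m ⊕ Fin w → Bool) × (G × Ω) → ℂ) (s : (Fin m ⊕ Fin w → Bool) × (G × Ω)) :
    run S [.bernoulli a b hab false t] ψ s =
      rotation (bernParam a b s.2.2) (s.1 (Sum.inr t)) true * ψ (upd s (Sum.inr t) true) +
      rotation (bernParam a b s.2.2) (s.1 (Sum.inr t)) false * ψ (upd s (Sum.inr t) false) := by
  rw [run_cons, run_nil]
  simp only [Gate.apply, Bool.false_eq_true, if_false, bernoulliMatrix_eq, applyCtrl, if_true, regCtrl,
    upd]
  rw [Fintype.sum_prod_type, Fintype.sum_bool]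
  congr 1
  · rw [Finset.sum_eq_single s.2]
    · simp
    · intro c _ hc
      simp [hc.symm]
    · simp
  · rw [Finset.sum_eq_single s.2]
    · simp
    · intro c _ hc
      simp [hc.symm]
    · simp

theorem sum_bernoulli (a b : ℝ) (hab : 0 ≤ a ∧ a < b) (ψ : Basis m (G × Ω) → ℂ)
    (hψ : SuppOn (fun s => s.1 (wk 2) = false) ψ) (F : Basis m (G × Ω) → ℝ) :
    ∑ s, F s * ‖run S [.bernoulli a b hab false (Fin.ofNat (m + 9) 2)] ψ s‖ ^ 2 =
      ∑ s, (bernParam a b s.2.2 * F (upd s (wk 2) true) + (1 - bernParam a b s.2.2) * F s) *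
        ‖ψ s‖ ^ 2 := by
  have hb0 := fun x => bernParam_nonneg (Ω := Ω) hab x
  have hb1 := fun x => bernParam_le_one (Ω := Ω) hab x
  have e : ∀ s : Basis m (G × Ω), ‖run S [.bernoulli a b hab false (Fin.ofNat (m + 9) 2)] ψ s‖ ^ 2 =
      (if s.1 (wk 2) = true then bernParam a b s.2.2 else 1 - bernParam a b s.2.2) *
        ‖ψ (upd s (wk 2) false)‖ ^ 2 := by
    intro s
    rw [run_bernoulli]
    have : ψ (upd s (Sum.inr (Fin.ofNat (m + 9) 2)) true) = 0 := by
      by_contra h0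
      have := hψ _ h0
      simp only [wk, upd_self] at this
      exact absurd this (by simp)
    rw [this, mul_zero, zero_add, norm_mul, mul_pow]
    congr 1
    change ‖rotation _ (s.1 (wk 2)) false‖ ^ 2 = _
    cases s.1 (wk 2)
    · simp only [rotation, Complex.norm_real, Real.norm_eq_abs, sq_abs, Bool.false_eq_true, if_false]
      exact Real.sq_sqrt (by linarith [hb1 s.2.2])
    · simp only [rotation, Complex.norm_real, Real.norm_eq_abs, sq_abs, if_true]
      exact Real.sq_sqrt (hb0 s.2.2)
  simp only [e]
  rw [sum_pair (wk 2)]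
  refine Finset.sum_congr rfl fun s _ => ?_
  by_cases h : s.1 (wk 2) = false
  · rw [if_pos h]
    simp only [upd_self, upd_upd, h, Bool.false_eq_true, if_false, if_true]
    rw [upd_eq_self s _ h]
    change _ + F (upd s (wk 2) true) * (bernParam a b s.2.2 * _) = _
    ring
  · have : ψ s = 0 := by
      by_contra h0
      exact h (hψ s h0)
    rw [if_neg h, this]
    simp

/-- The probability that the sampler stops in a step from `J` to `J + n - 1`, and then the Bernoulli
sampler is successful. -/
def pieceProb (J n : ℕ) (a b : ℝ) : ℝ :=
  ∑ x, (if parityOf J n x.1 = true then bernParam a b x.2.2 else 0) *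
    ‖stN S.toVarTimeAlgorithm (J + n) x‖ ^ 2

/-- A function of the outcome that is zero unless the work qubit `3` is set, and otherwise is `u` in
the run branch and `y` in the reference branch. -/
def outcomeWeight (u y : ℝ) (p₃ p₀ : Bool) : ℝ := if p₃ = true then (if p₀ = true then u else y) else 0

variable {S}

/-- The extraction gates are moved one by one, in reverse order, from the state onto the outcome
function. On clean states the resulting function has the shape required by `LevelState.sum_eq`. -/
theorem LevelState.sum_extract {γ β : ℝ} {J₀ n : ℕ} {g : ℝ} {Ψ : Basis m (G × Ω) → ℂ}
    (h : LevelState S γ β J₀ (J₀ + n) g Ψ) (a b : ℝ) (hab : 0 ≤ a ∧ a < b) (u y : ℝ) :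
    ∑ s, outcomeWeight u y (s.1 (wk 3)) (s.1 (wk 0)) *
        ‖QMean.run S (extractGates m J₀ n a b hab) Ψ s‖ ^ 2 =
      (g * γ) ^ 2 * (u * pieceProb S J₀ n a b) + (g * β) ^ 2 * y := by
  have n03 : (wk 0 : Fin m ⊕ Fin (m + 9)) ≠ wk 3 := wk_ne (by omega) (by omega) (by omega)
  have n01 : (wk 0 : Fin m ⊕ Fin (m + 9)) ≠ wk 1 := wk_ne (by omega) (by omega) (by omega)
  have n02 : (wk 0 : Fin m ⊕ Fin (m + 9)) ≠ wk 2 := wk_ne (by omega) (by omega) (by omega)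
  have n12 : (wk 1 : Fin m ⊕ Fin (m + 9)) ≠ wk 2 := wk_ne (by omega) (by omega) (by omega)
  have n13 : (wk 1 : Fin m ⊕ Fin (m + 9)) ≠ wk 3 := wk_ne (by omega) (by omega) (by omega)
  have n23 : (wk 2 : Fin m ⊕ Fin (m + 9)) ≠ wk 3 := wk_ne (by omega) (by omega) (by omega)
  rw [extractGates]
  simp only [run_append, run_cnot S n03]
  rw [sum_flip (wk 3) (fun s : Basis m (G × Ω) => s.1 (wk 0) == false)
    (fun s y => by simp only [upd_of_ne s n03]) _ (fun s => ‖QMean.run S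
      (toffoli (wk 2) (wk 1) true (wk 3)) _ s‖ ^ 2)]
  simp only [run_toffoli S n12.symm n23 n13]
  rw [sum_flip (wk 3) (fun s : Basis m (G × Ω) => s.1 (wk 2) && s.1 (wk 1) == true)
    (fun s y => by simp only [upd_of_ne s n23, upd_of_ne s n13]) _
    (fun s => ‖QMean.run S [Gate.bernoulli a b hab false (Fin.ofNat (m + 9) 2)] _ s‖ ^ 2)]
  rw [sum_bernoulli]
  · simp only [run_parityGates]
    rw [sum_flip (wk 1) (fun s : Basis m (G × Ω) => parityOf J₀ n (flags s))
      (fun s y => by simp only [flags_upd_wk]) _ (fun s => ‖Ψ s‖ ^ 2)]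
    have hF : ∀ x : (Fin m → Bool) × (G × Ω), (∃ k : Fin m, k.val < J₀ ∧ x.1 k = true) →
        AtMostOne x.1 → u * (if parityOf J₀ n x.1 = true then bernParam a b x.2.2 else 0) = 0 := by
      rintro x ⟨k, hk, hk'⟩ hx
      rw [parityOf_false, if_neg (by simp), mul_zero]
      intro k' h1 _
      by_contra hne
      have := hx k' k (by simpa using hne) hk'
      rw [this] at h1
      omega
    have := h.sum_eq (fun x => u * (if parityOf J₀ n x.1 = true then bernParam a b x.2.2 else 0)) y hF
    simp only [mul_assoc] at this
    rw [← Finset.mul_sum] at this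
    rw [pieceProb, ← this]
    refine Finset.sum_congr rfl fun s _ => ?_
    by_cases h0 : Ψ s = 0
    · simp [h0]
    · obtain ⟨h1, -, -, h4⟩ := h.supp s h0
      have s1 := h1 1 le_rfl (by omega)
      have s2 := h1 2 (by omega) (by omega)
      have s3 := h1 3 (by omega) (by omega)
      have hx : ∀ (x : Bool), (upd s (wk 1) x).2 = s.2 := fun _ => rfl
      simp only [upd_self, upd_of_ne _ n03, upd_of_ne _ n01, upd_of_ne _ n02, upd_of_ne _ n12,
        upd_of_ne _ n12.symm, upd_of_ne _ n13.symm,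
        upd_of_ne _ n23.symm, s1, s2, s3, hx]
      by_cases hr : s.1 (wk 0) = true
      · cases hp : parityOf J₀ n (flags s) <;>
          simp [outcomeWeight, hr, -mul_eq_mul_right_iff]
        ring
      · have hr' : s.1 (wk 0) = false := by simpa using hr
        have hp : parityOf J₀ n (flags s) = false := parityOf_false _ _ _ fun k _ _ => h4 hr' k
        simp [outcomeWeight, hr', hp, -mul_eq_mul_right_iff]
        ring
  · intro s hs
    rw [run_parityGates] at hs
    have := (h.supp _ hs).1 2 (by omega) (by omega)
    rwa [upd_of_ne _ n12.symm] at this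

/-- The gain of repeated amplification, if the `j`-th amplification is applied to good subspaces of
original weight `w j`. -/
def gain (w : ℕ → ℝ) : ℕ → ℝ
  | 0 => 1
  | j + 1 => gain w j * (3 - 4 * (gain w j ^ 2 * w j))

/-- The original weights of the good subspaces of the levels. -/
def levelWeight (S : VarTimeSampler m G Ω) (ν : ℝ) (J : ℕ → ℕ) (l : ℕ) (a b : ℝ) (j : ℕ) : ℝ :=
  if j < l then ν * contWeight S (J (j + 1)) + (1 - ν)
  else ν * pieceProb S (J l) (J (l + 1) - J l) a b + (1 - ν)

/-- By `LevelState.weight_cont` the good weight before an amplification is the square of the current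
gain times the original weight `levelWeight`. This is the factor in the recursion of `gain`, and it
is common to both branches. -/
theorem levelState_sampleCirc (ν : ℝ) (hν : 0 ≤ ν ∧ ν ≤ 1) {J : ℕ → ℕ} (hJ : Monotone J)
    (hJ0 : J 0 = 0) (hJm : ∀ j, J j ≤ m) (l : ℕ) (a b : ℝ) (hab : 0 ≤ a ∧ a < b) (j : ℕ) (hj : j ≤ l) :
    LevelState S (√ν) (√(1 - ν)) (J j) (J (j + 1)) (gain (levelWeight S ν J l a b) j)
      (QMean.run S (ampCirc m ν hν J l a b hab j ++ stepGates m (J j) (J (j + 1) - J j))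
        (initState S.start)) := by
  have hstep : ∀ {j g} {Ψ : Basis m (G × Ω) → ℂ}, LevelState S (√ν) (√(1 - ν)) (J j) (J j) g Ψ →
      LevelState S (√ν) (√(1 - ν)) (J j) (J (j + 1)) g
        (QMean.run S (stepGates m (J j) (J (j + 1) - J j)) Ψ) := by
    intro j g Ψ h
    have h1 : J j ≤ J (j + 1) := hJ (Nat.le_succ j)
    have h2 := hJm (j + 1)
    have h3 := h.steps (J (j + 1) - J j) (by omega)
    rwa [Nat.add_sub_of_le h1] at h3
  induction j with
  | zero =>
    rw [run_append]
    refine hstep ?_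
    rw [hJ0]
    exact levelState_prep ν hν
  | succ j ih =>
    have hΨ := ih (by omega)
    have hlt : j < l := by omega
    have e1 : sampleCirc m ν hν J l a b hab j =
        ampCirc m ν hν J l a b hab j ++ stepGates m (J j) (J (j + 1) - J j) := by
      rw [sampleCirc, levelGates, if_pos hlt]
    rw [run_append]
    refine hstep ?_
    rw [run_ampCirc_succ S ν hν hJ hJm l a b hab j (fun s => ∀ k, flags s k = false) _ (by rw [e1]) ?_]
    · have := hΨ.amplify (3 - 4 * weight (fun s => ∀ k, flags s k = false) (QMean.run S
        (ampCirc m ν hν J l a b hab j ++ stepGates m (J j) (J (j + 1) - J j)) (initState S.start)))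
        (1 - 4 * weight (fun s => ∀ k, flags s k = false) (QMean.run S
        (ampCirc m ν hν J l a b hab j ++ stepGates m (J j) (J (j + 1) - J j)) (initState S.start)))
      convert this using 1
      rw [gain, hΨ.weight_cont, levelWeight, if_pos hlt, Real.sq_sqrt hν.1,
        Real.sq_sqrt (by linarith [hν.2])]
    · rw [levelSign, if_pos hlt]
      exact run_signGates _ fun s hs => ⟨(hΨ.supp s hs).2.1, (hΨ.supp s hs).2.2.1⟩

/-- The unknown gain is a common factor of the run term and the reference term. Keeping `u` and `y`
free gives both frequencies, and also the good weight that the induction needs. -/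
theorem sum_sampleCirc (ν : ℝ) (hν : 0 ≤ ν ∧ ν ≤ 1) {J : ℕ → ℕ} (hJ : Monotone J)
    (hJ0 : J 0 = 0) (hJm : ∀ j, J j ≤ m) (l : ℕ) (a b : ℝ) (hab : 0 ≤ a ∧ a < b) (N : ℕ) (hN : l ≤ N)
    (u y : ℝ) :
    ∑ s, outcomeWeight u y (s.1 (wk 3)) (s.1 (wk 0)) *
        ‖finalState S (sampleCirc m ν hν J l a b hab N) s‖ ^ 2 =
      gain (levelWeight S ν J l a b) N ^ 2 *
        (u * (ν * pieceProb S (J l) (J (l + 1) - J l) a b) + (1 - ν) * y) := by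
  simp only [finalState_eq]
  induction N, hN using Nat.le_induction generalizing u y with
  | base =>
    have h := levelState_sampleCirc (S := S) ν hν hJ hJ0 hJm l a b hab l le_rfl
    have e : J (l + 1) = J l + (J (l + 1) - J l) := by
      have : J l ≤ J (l + 1) := hJ (Nat.le_succ l)
      omega
    rw [e, Nat.add_sub_cancel_left] at h
    have h2 := h.sum_extract a b hab u y
    rw [← run_append, List.append_assoc] at h2
    rw [sampleCirc, levelGates, if_neg (lt_irrefl l), if_pos rfl, h2, mul_pow, mul_pow,
      Real.sq_sqrt hν.1, Real.sq_sqrt (by linarith [hν.2])]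
    ring
  | succ N hN ih =>
    have e1 : sampleCirc m ν hν J l a b hab (N + 1) = ampCirc m ν hν J l a b hab (N + 1) := by
      rw [sampleCirc, levelGates, if_neg (by omega), if_neg (by omega), List.append_nil]
    set Ψ := QMean.run S (sampleCirc m ν hν J l a b hab N) (initState S.start) with hΨ
    have hw : weight (fun s : Basis m (G × Ω) => s.1 (wk 3) = true) Ψ =
        gain (levelWeight S ν J l a b) N ^ 2 * levelWeight S ν J l a b N := by
      rw [levelWeight, if_neg (by omega)]
      -- For u = y = 1 the outcome function is the indicator of the good subspace.
      have := ih 1 1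
      rw [one_mul, mul_one] at this
      rw [← this]
      refine Finset.sum_congr rfl fun s _ => ?_
      by_cases h3 : s.1 (wk 3) = true <;> simp [outcomeWeight, h3]
    have hrun := run_ampCirc_succ S ν hν hJ hJm l a b hab N (fun s => s.1 (wk 3) = true) Ψ rfl (by
      rw [levelSign, if_neg (by omega)]
      funext s
      rw [run_signGate S (wk_ne (by omega) (by omega) (by omega))]
      cases h3 : s.1 (wk 3) <;> simp)
    rw [e1, hrun, hw]
    have key : ∀ s : Basis m (G × Ω), outcomeWeight u y (s.1 (wk 3)) (s.1 (wk 0)) *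
        ‖(if s.1 (wk 3) = true then ((3 - 4 * (gain (levelWeight S ν J l a b) N ^ 2 *
          levelWeight S ν J l a b N) : ℝ) : ℂ) * Ψ s else ((1 - 4 * (gain (levelWeight S ν J l a b) N ^ 2 *
          levelWeight S ν J l a b N) : ℝ) : ℂ) * Ψ s)‖ ^ 2 =
        (3 - 4 * (gain (levelWeight S ν J l a b) N ^ 2 * levelWeight S ν J l a b N)) ^ 2 *
          (outcomeWeight u y (s.1 (wk 3)) (s.1 (wk 0)) * ‖Ψ s‖ ^ 2) := by
      intro s
      by_cases h3 : s.1 (wk 3) = true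
      · rw [if_pos h3, norm_mul, Complex.norm_real, Real.norm_eq_abs, mul_pow, sq_abs]
        ring
      · simp [outcomeWeight, h3]
    simp only [key]
    rw [← Finset.mul_sum, ih, gain]
    ring

/-- The expectation of a function of the outcome. -/
theorem sum_outcomeProb {w : ℕ} (S : VarTimeSampler m G Ω) (c : List (Gate m w))
    (f : (Fin w → Bool) → ℝ) :
    ∑ o, outcomeProb S c o * f o = ∑ s, f (fun k => s.1 (Sum.inr k)) * ‖finalState S c s‖ ^ 2 := by
  simp only [outcomeProb, weight, Finset.sum_mul]
  rw [Finset.sum_comm]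
  refine Finset.sum_congr rfl fun s _ => ?_
  rw [Finset.sum_eq_single (fun k => s.1 (Sum.inr k))]
  · simp [mul_comm]
  · intro o _ ho
    rw [if_neg, zero_mul]
    exact fun h => ho (funext fun k => (h k).symm)
  · simp

theorem sum_outcomeProb_one {w : ℕ} (S : VarTimeSampler m G Ω) (c : List (Gate m w)) :
    ∑ o, outcomeProb S c o = 1 := by
  have := sum_outcomeProb S c (fun _ => 1)
  simp only [mul_one, one_mul] at this
  rw [this, finalState_eq, sum_norm_run_init]

theorem outcomeProb_nonneg {w : ℕ} (S : VarTimeSampler m G Ω) (c : List (Gate m w))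
    (o : Fin w → Bool) : 0 ≤ outcomeProb S c o := by
  refine Finset.sum_nonneg fun s _ => ?_
  split_ifs <;> positivity

/-- The expectation of a function of the work qubits `3` and `0` after the sampling circuit. -/
theorem expect_sampleCirc (ν : ℝ) (hν : 0 ≤ ν ∧ ν ≤ 1) {J : ℕ → ℕ} (hJ : Monotone J)
    (hJ0 : J 0 = 0) (hJm : ∀ j, J j ≤ m) (l : ℕ) (a b : ℝ) (hab : 0 ≤ a ∧ a < b) (N : ℕ) (hN : l ≤ N)
    (u y : ℝ) :
    ∑ o, outcomeProb S (sampleCirc m ν hν J l a b hab N) o *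
      outcomeWeight u y (o (Fin.ofNat (m + 9) 3)) (o (Fin.ofNat (m + 9) 0)) =
      gain (levelWeight S ν J l a b) N ^ 2 *
        (u * (ν * pieceProb S (J l) (J (l + 1) - J l) a b) + (1 - ν) * y) := by
  rw [sum_outcomeProb, ← sum_sampleCirc ν hν hJ hJ0 hJm l a b hab N hN u y]
  rfl

end Semantics

/-! ## The joint distribution of the stopping step and the output -/

section Joint

variable {m : ℕ} {G : Type u} [Fintype G] [DecidableEq G] {Ω : Finset ℝ≥0}
  (S : VarTimeSampler m G Ω)

/-- The probability that the sampler stops in step `k` and outputs `x`. -/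
def jointProb (y : Fin m × Ω) : ℝ :=
  ∑ s : (Fin m → Bool) × (G × Ω), (if s.1 y.1 = true ∧ s.2.2 = y.2 then 1 else 0) *
    ‖stN S.toVarTimeAlgorithm m s‖ ^ 2

theorem jointProb_nonneg (y : Fin m × Ω) : 0 ≤ jointProb S y := by
  refine Finset.sum_nonneg fun s _ => ?_
  split_ifs <;> simp

theorem sum_mul_jointProb (f : Fin m × Ω → ℝ) :
    ∑ y, f y * jointProb S y = ∑ s : (Fin m → Bool) × (G × Ω),
      (∑ k, if s.1 k = true then f (k, s.2.2) else 0) * ‖stN S.toVarTimeAlgorithm m s‖ ^ 2 := by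
  simp only [jointProb, Finset.mul_sum]
  rw [Finset.sum_comm]
  refine Finset.sum_congr rfl fun s _ => ?_
  rw [Finset.sum_mul, Fintype.sum_prod_type]
  refine Finset.sum_congr rfl fun k _ => ?_
  rw [Finset.sum_eq_single s.2.2]
  · split_ifs with h1 h2 <;> simp_all
  · intro x _ hx
    rw [if_neg (fun h => hx h.2.symm)]
    simp
  · simp

theorem sum_set_flags {z : Fin m → Bool} (hz : AtMostOne z) {k : Fin m} (hk : z k = true)
    (f : Fin m → ℝ) : (∑ k, if z k = true then f k else 0) = f k := by
  rw [Finset.sum_eq_single k]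
  · simp [hk]
  · intro j _ hj
    rw [if_neg]
    exact fun h => hj (hz j k h hk)
  · simp

theorem stN_eq_zero_of_halts (s : (Fin m → Bool) × (G × Ω)) (hs : ∀ k, s.1 k = false) :
    stN S.toVarTimeAlgorithm m s = 0 := by
  have h1 := S.halts
  have h2 := norm_stN S.toVarTimeAlgorithm m
  simp only [VarTimeAlgorithm.stopWeight, weight, stateAfter_eq, Fin.val_last] at h1
  have h3 : ∑ s, (‖stN S.toVarTimeAlgorithm m s‖ ^ 2 -
      if ∃ j, s.1 j = true then ‖stN S.toVarTimeAlgorithm m s‖ ^ 2 else 0) = 0 := by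
    rw [Finset.sum_sub_distrib, h1, h2, sub_self]
  have h4 := (Finset.sum_eq_zero_iff_of_nonneg (fun s _ => by
    split_ifs <;> simp)).mp h3 s (Finset.mem_univ s)
  rw [if_neg (by simp [hs]), sub_zero] at h4
  simpa using h4

theorem sum_stN_eq (f : Ω → ℝ) :
    ∑ s : (Fin m → Bool) × (G × Ω), f s.2.2 * ‖stN S.toVarTimeAlgorithm m s‖ ^ 2 =
      ∑ y : Fin m × Ω, f y.2 * jointProb S y := by
  rw [sum_mul_jointProb S (fun y => f y.2)]
  refine Finset.sum_congr rfl fun s _ => ?_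
  by_cases h0 : stN S.toVarTimeAlgorithm m s = 0
  · simp [h0]
  · have h1 : ∃ k, s.1 k = true := by
      by_contra h
      push Not at h
      exact h0 (stN_eq_zero_of_halts S s fun k => by simpa using h k)
    obtain ⟨k, hk⟩ := h1
    rw [sum_set_flags (suppOn_stN _ m s h0).1 hk (fun _ => f s.2.2)]

theorem sum_jointProb : ∑ y, jointProb S y = 1 := by
  have := sum_stN_eq S (fun _ => 1)
  simp only [one_mul] at this
  rw [← this, norm_stN]

/-- Amplitudes of stopped branches no longer change, so after `J` steps they equal those of the
final state. -/
theorem sum_stN_stopped (J : ℕ) (hJ : J ≤ m) (f : Fin m → Bool) (g : Ω → ℝ) :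
    ∑ s : (Fin m → Bool) × (G × Ω), (if ∃ k : Fin m, k.val < J ∧ f k = true ∧ s.1 k = true
        then g s.2.2 else 0) * ‖stN S.toVarTimeAlgorithm J s‖ ^ 2 =
      ∑ y : Fin m × Ω, (if y.1.val < J ∧ f y.1 = true then g y.2 else 0) * jointProb S y := by
  rw [sum_mul_jointProb S (fun y => if y.1.val < J ∧ f y.1 = true then g y.2 else 0)]
  refine Finset.sum_congr rfl fun s _ => ?_
  by_cases ha : AtMostOne s.1
  · by_cases h : ∃ k : Fin m, k.val < J ∧ f k = true ∧ s.1 k = true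
    · obtain ⟨k, hk, hf, hz⟩ := h
      rw [if_pos ⟨k, hk, hf, hz⟩, sum_set_flags ha hz
        (fun k => if k.val < J ∧ f k = true then g s.2.2 else 0), if_pos ⟨hk, hf⟩,
        stN_stopped _ hJ s.1 s.2 k hk hz]
    · rw [if_neg h, zero_mul, Finset.sum_eq_zero, zero_mul]
      intro k _
      split_ifs with h1 h2
      · exact absurd ⟨k, h2.1, h2.2, h1⟩ h
      · rfl
      · rfl
  · have e : ∀ J, stN S.toVarTimeAlgorithm J s = 0 := fun J => by
      by_contra h0
      exact ha (suppOn_stN _ J s h0).1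
    simp [e]

/-- The unstopped branches still evolve, so their weight is found as the complement of the stopped
weight, which is already final. -/
theorem contWeight_eq (J : ℕ) (hJ : J ≤ m) :
    contWeight S J = ∑ y : Fin m × Ω, (if J ≤ y.1.val then 1 else 0) * jointProb S y := by
  have h1 := sum_stN_stopped S J hJ (fun _ => true) (fun _ => 1)
  have h2 := norm_stN S.toVarTimeAlgorithm J
  have h3 := sum_jointProb S
  have h4 : contWeight S J + ∑ s : (Fin m → Bool) × (G × Ω), (if ∃ k : Fin m, k.val < J ∧
      true = true ∧ s.1 k = true then 1 else 0) * ‖stN S.toVarTimeAlgorithm J s‖ ^ 2 = 1 := by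
    refine Eq.trans ?_ h2
    rw [contWeight, ← Finset.sum_add_distrib]
    refine Finset.sum_congr rfl fun s _ => ?_
    by_cases h0 : stN S.toVarTimeAlgorithm J s = 0
    · simp [h0]
    · have hs := (suppOn_stN _ J s h0).2
      rw [← add_mul]
      by_cases hz : ∀ k, s.1 k = false
      · rw [if_pos hz, if_neg]
        · simp
        · rintro ⟨k, -, -, hk⟩
          rw [hz k] at hk
          exact absurd hk (by simp)
      · rw [if_neg hz, if_pos]
        · simp
        · push Not at hz
          obtain ⟨k, hk⟩ := hz
          refine ⟨k, ?_, rfl, by simpa using hk⟩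
          by_contra hlt
          exact hk (hs k (by omega))
  have h5 : ∑ y : Fin m × Ω, (if J ≤ y.1.val then 1 else 0) * jointProb S y +
      ∑ y : Fin m × Ω, (if y.1.val < J ∧ true = true then 1 else 0) * jointProb S y = 1 := by
    refine Eq.trans ?_ h3
    rw [← Finset.sum_add_distrib]
    refine Finset.sum_congr rfl fun y _ => ?_
    rw [← add_mul]
    by_cases h : J ≤ y.1.val
    · have : ¬ y.1.val < J := by omega
      simp [h, this]
    · have : y.1.val < J := by omega
      simp [h, this]
  linarith

theorem pieceProb_eq (J n : ℕ) (hJ : J + n ≤ m) (a b : ℝ) :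
    pieceProb S J n a b = ∑ y : Fin m × Ω,
      (if J ≤ y.1.val ∧ y.1.val < J + n then bernParam a b y.2 else 0) * jointProb S y := by
  have h1 := sum_stN_stopped S (J + n) hJ (fun k => decide (J ≤ k.val)) (bernParam a b)
  have h2 : ∑ y : Fin m × Ω, (if J ≤ y.1.val ∧ y.1.val < J + n then bernParam a b y.2 else 0) *
      jointProb S y = ∑ y : Fin m × Ω, (if y.1.val < J + n ∧ decide (J ≤ y.1.val) = true
        then bernParam a b y.2 else 0) * jointProb S y := by
    refine Finset.sum_congr rfl fun y _ => ?_
    congr 1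
    refine if_congr ?_ rfl rfl
    rw [decide_eq_true_eq, and_comm]
  rw [h2, ← h1, pieceProb]
  refine Finset.sum_congr rfl fun s _ => ?_
  by_cases h0 : stN S.toVarTimeAlgorithm (J + n) s = 0
  · simp [h0]
  · congr 1
    have ha := (suppOn_stN _ _ s h0).1
    by_cases h : ∃ k : Fin m, k.val < J + n ∧ decide (J ≤ k.val) = true ∧ s.1 k = true
    · obtain ⟨k, hk, hf, hz⟩ := h
      rw [parityOf_true J n s.1 ha k (by simpa using hf) hk hz, if_pos rfl, if_pos ⟨k, hk, hf, hz⟩]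
    · rw [parityOf_false, if_neg (by simp), if_neg h]
      intro k hk1 hk2
      by_contra hne
      exact h ⟨k, hk2, by simpa using hk1, by simpa using hne⟩

theorem dist_eq (x : Ω) : S.dist x = ∑ k, jointProb S (k, x) := by
  have h := sum_stN_eq S (fun x' => if x' = x then 1 else 0)
  have h1 : S.dist x = ∑ s : (Fin m → Bool) × (G × Ω), (if s.2.2 = x then 1 else 0) *
      ‖stN S.toVarTimeAlgorithm m s‖ ^ 2 := by
    rw [VarTimeSampler.dist, weight, stateAfter_eq, Fin.val_last]
    refine Finset.sum_congr rfl fun s _ => ?_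
    split_ifs <;> simp
  rw [h1, h, Fintype.sum_prod_type]
  refine Finset.sum_congr rfl fun k _ => ?_
  rw [Finset.sum_eq_single x]
  · simp
  · intro x' _ hx
    simp [hx]
  · simp

theorem mean_eq : S.mean = ∑ y : Fin m × Ω, ((y.2 : ℝ≥0) : ℝ) * jointProb S y := by
  simp only [VarTimeSampler.mean, dist_eq, Finset.sum_mul]
  rw [Fintype.sum_prod_type, Finset.sum_comm]
  simp only [mul_comm]

theorem phi_sq_eq : S.phi ^ 2 = ∑ y : Fin m × Ω, ((y.2 : ℝ≥0) : ℝ) ^ 2 * jointProb S y := by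
  have h : ∑ x : Ω, S.dist x * ((x : ℝ≥0) : ℝ) ^ 2 =
      ∑ y : Fin m × Ω, ((y.2 : ℝ≥0) : ℝ) ^ 2 * jointProb S y := by
    simp only [dist_eq, Finset.sum_mul]
    rw [Fintype.sum_prod_type, Finset.sum_comm]
    simp only [mul_comm]
  rw [VarTimeSampler.phi, Real.sq_sqrt, h]
  rw [h]
  exact Finset.sum_nonneg fun y _ => mul_nonneg (sq_nonneg _) (jointProb_nonneg S y)

theorem pStop_eq (k : Fin m) : S.pStop k = ∑ x, jointProb S (k, x) := by
  have h : ∀ j : Fin (m + 1), S.stopWeight j = ∑ y : Fin m × Ω,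
      (if y.1.val < j.val ∧ true = true then 1 else 0) * jointProb S y := by
    intro j
    rw [← sum_stN_stopped S j.val (by omega) (fun _ => true) (fun _ => 1)]
    rw [VarTimeAlgorithm.stopWeight, weight, stateAfter_eq]
    refine Finset.sum_congr rfl fun s _ => ?_
    by_cases h0 : stN S.toVarTimeAlgorithm j.val s = 0
    · simp [h0]
    · have hs := (suppOn_stN _ _ s h0).2
      have : (∃ k : Fin m, k.val < j.val ∧ true = true ∧ s.1 k = true) ↔ ∃ k, s.1 k = true := by
        refine ⟨fun ⟨k, _, _, h⟩ => ⟨k, h⟩, fun ⟨k, h⟩ => ⟨k, ?_, rfl, h⟩⟩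
        by_contra hlt
        have := hs k (by omega)
        rw [this] at h
        exact absurd h (by simp)
      by_cases hz : ∃ k, s.1 k = true
      · rw [if_pos hz, if_pos (this.mpr hz), one_mul]
      · rw [if_neg hz, if_neg (fun h => hz (this.mp h)), zero_mul]
  rw [VarTimeAlgorithm.pStop, h, h, ← Finset.sum_sub_distrib, Fintype.sum_prod_type,
    Finset.sum_eq_single k]
  · refine Finset.sum_congr rfl fun x _ => ?_
    simp
  · intro j _ hj
    refine Finset.sum_eq_zero fun x _ => ?_
    have hne : j.val ≠ k.val := fun h => hj (Fin.ext h)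
    have : j.val < k.val + 1 ↔ j.val < k.val := by omega
    simp [this]
  · simp

theorem Tl2_sq_eq : S.Tl2 ^ 2 =
    ∑ y : Fin m × Ω, (S.sched.time y.1.succ : ℝ) ^ 2 * jointProb S y := by
  have h : ∑ i : Fin m, S.pStop i * (S.sched.time i.succ : ℝ) ^ 2 =
      ∑ y : Fin m × Ω, (S.sched.time y.1.succ : ℝ) ^ 2 * jointProb S y := by
    simp only [pStop_eq, Finset.sum_mul]
    rw [Fintype.sum_prod_type]
    simp only [mul_comm]
  rw [VarTimeAlgorithm.Tl2, Real.sq_sqrt, h]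
  rw [h]
  exact Finset.sum_nonneg fun y _ => mul_nonneg (sq_nonneg _) (jointProb_nonneg S y)

/-- The contribution to the mean of the runs that stop in a step from `J` to `J' - 1` and have an
output in `[a, b)`. -/
def pieceMean (J J' : ℕ) (a b : ℝ) : ℝ :=
  ∑ y : Fin m × Ω, (if (J ≤ y.1.val ∧ y.1.val < J') ∧ a ≤ ((y.2 : ℝ≥0) : ℝ) ∧ ((y.2 : ℝ≥0) : ℝ) < b
    then ((y.2 : ℝ≥0) : ℝ) else 0) * jointProb S y

theorem pieceProb_eq_pieceMean {J J' : ℕ} (h : J ≤ J') (hJ : J' ≤ m) (a b : ℝ) :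
    pieceProb S J (J' - J) a b = pieceMean S J J' a b / b := by
  rw [pieceProb_eq S _ _ (by omega), pieceMean, Finset.sum_div, Nat.add_sub_of_le h]
  refine Finset.sum_congr rfl fun y _ => ?_
  unfold bernParam
  by_cases h1 : J ≤ y.1.val ∧ y.1.val < J' <;> by_cases h2 : a ≤ ((y.2 : ℝ≥0) : ℝ) ∧ ((y.2 : ℝ≥0) : ℝ) < b <;>
    simp [h1, h2]
  ring

theorem pieceMean_nonneg (J J' : ℕ) (a b : ℝ) : 0 ≤ pieceMean S J J' a b := by
  refine Finset.sum_nonneg fun y _ => mul_nonneg ?_ (jointProb_nonneg S y)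
  split_ifs
  · exact NNReal.coe_nonneg _
  · exact le_rfl

theorem mean_nonneg : 0 ≤ S.mean := by
  rw [mean_eq]
  exact Finset.sum_nonneg fun y _ => mul_nonneg (NNReal.coe_nonneg _) (jointProb_nonneg S y)

theorem phi_nonneg : 0 ≤ S.phi := Real.sqrt_nonneg _

theorem Tl2_nonneg : 0 ≤ S.Tl2 := Real.sqrt_nonneg _

theorem pieceMean_le_mean (J J' : ℕ) (a b : ℝ) : pieceMean S J J' a b ≤ S.mean := by
  rw [mean_eq]
  refine Finset.sum_le_sum fun y _ => mul_le_mul_of_nonneg_right ?_ (jointProb_nonneg S y)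
  split_ifs
  · exact le_rfl
  · exact NNReal.coe_nonneg _

/-- The part of the mean from large outputs is small. -/
theorem sum_large_le {a : ℝ} (ha : 0 < a) :
    ∑ y : Fin m × Ω, (if a ≤ ((y.2 : ℝ≥0) : ℝ) then ((y.2 : ℝ≥0) : ℝ) else 0) * jointProb S y ≤
      S.phi ^ 2 / a := by
  rw [phi_sq_eq, Finset.sum_div]
  refine Finset.sum_le_sum fun y _ => ?_
  rw [mul_div_right_comm]
  refine mul_le_mul_of_nonneg_right ?_ (jointProb_nonneg S y)
  rw [le_div_iff₀ ha]
  split_ifs with h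
  · nlinarith [NNReal.coe_nonneg (y.2 : ℝ≥0)]
  · rw [zero_mul]; positivity

/-- The part of the mean from long runs is small. -/
theorem sum_long_le {τ : ℝ} (hτ : 0 < τ) :
    ∑ y : Fin m × Ω, (if τ < (S.sched.time y.1.succ : ℝ) then ((y.2 : ℝ≥0) : ℝ) else 0) *
      jointProb S y ≤ S.phi * S.Tl2 / τ := by
  rw [le_div_iff₀ hτ, Finset.sum_mul]
  -- On long runs τ is less than the stopping time. Splitting each probability into two square roots
  -- prepares Cauchy–Schwarz, whose factors are φ and T_ℓ₂.
  have h1 : ∑ y : Fin m × Ω, (if τ < (S.sched.time y.1.succ : ℝ) then ((y.2 : ℝ≥0) : ℝ) else 0) *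
      jointProb S y * τ ≤ ∑ y : Fin m × Ω, (((y.2 : ℝ≥0) : ℝ) * √(jointProb S y)) *
        ((S.sched.time y.1.succ : ℝ) * √(jointProb S y)) := by
    refine Finset.sum_le_sum fun y _ => ?_
    have h2 := Real.mul_self_sqrt (jointProb_nonneg S y)
    have h3 : (((y.2 : ℝ≥0) : ℝ) * √(jointProb S y)) * ((S.sched.time y.1.succ : ℝ) *
        √(jointProb S y)) = ((y.2 : ℝ≥0) : ℝ) * (S.sched.time y.1.succ : ℝ) * jointProb S y := by
      rw [← h2]
      simp only [h2]
      linear_combination ((y.2 : ℝ≥0) : ℝ) * (S.sched.time y.1.succ : ℝ) * h2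
    rw [h3, mul_right_comm]
    refine mul_le_mul_of_nonneg_right ?_ (jointProb_nonneg S y)
    split_ifs with h
    · exact mul_le_mul_of_nonneg_left h.le (NNReal.coe_nonneg _)
    · rw [zero_mul]; positivity
  refine h1.trans ((Real.sum_mul_le_sqrt_mul_sqrt _ _ _).trans (le_of_eq ?_))
  congr 1
  · rw [← Real.sqrt_sq (phi_nonneg S), phi_sq_eq]
    congr 1
    refine Finset.sum_congr rfl fun y _ => ?_
    rw [mul_pow, Real.sq_sqrt (jointProb_nonneg S y)]
  · rw [← Real.sqrt_sq (Tl2_nonneg S), Tl2_sq_eq]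
    congr 1
    refine Finset.sum_congr rfl fun y _ => ?_
    rw [mul_pow, Real.sq_sqrt (jointProb_nonneg S y)]

/-- Long runs are unlikely. -/
theorem prob_long_le {τ : ℝ} (hτ : 0 < τ) :
    ∑ y : Fin m × Ω, (if τ < (S.sched.time y.1.succ : ℝ) then 1 else 0) *
      jointProb S y ≤ S.Tl2 ^ 2 / τ ^ 2 := by
  rw [Tl2_sq_eq, Finset.sum_div]
  refine Finset.sum_le_sum fun y _ => ?_
  rw [mul_div_right_comm]
  refine mul_le_mul_of_nonneg_right ?_ (jointProb_nonneg S y)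
  rw [le_div_iff₀ (by positivity)]
  split_ifs with h
  · rw [one_mul]; exact pow_le_pow_left₀ hτ.le h.le 2
  · rw [zero_mul]; positivity

end Joint

/-! ## Programs -/

/-- Quantum algorithms with classical control that output an element of `α`. -/
inductive Prog (m : ℕ) (α : Type) : Type
  | ret (a : α)
  | run (w : ℕ) (circuit : List (Gate m w)) (next : (Fin w → Bool) → Prog m α)

namespace Prog

variable {m : ℕ} {α β : Type}

/-- Continue with a program that depends on the output. -/
def bind : Prog m α → (α → Prog m β) → Prog m β
  | .ret a, f => f a
  | .run w c next, f => .run w c (fun o => (next o).bind f)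

/-- The program as an algorithm. -/
def toAlg : Prog m ℝ → QAlgorithm m
  | .ret a => .output a
  | .run w c next => .run w c (fun o => (next o).toAlg)

/-- The time complexity. -/
def time (τ : Schedule m) : Prog m α → ℕ
  | .ret _ => 0
  | .run _ c next => circCost τ c + Finset.univ.sup (fun o => (next o).time τ)

theorem time_toAlg (τ : Schedule m) (p : Prog m ℝ) : p.toAlg.time τ = p.time τ := by
  induction p with
  | ret a => rfl
  | run w c next ih =>
    simp only [toAlg, QAlgorithm.time, time, circCost, ih]

theorem time_bind_le (τ : Schedule m) (p : Prog m α) (f : α → Prog m β) (B : ℕ)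
    (h : ∀ a, (f a).time τ ≤ B) : (p.bind f).time τ ≤ p.time τ + B := by
  induction p with
  | ret a => simpa [bind, time] using h a
  | run w c next ih =>
    simp only [bind, time]
    rw [add_assoc]
    refine Nat.add_le_add_left (Finset.sup_le fun o _ => (ih o).trans ?_) _
    exact Nat.add_le_add_right (Finset.le_sup (f := fun o => (next o).time τ) (Finset.mem_univ o)) _

/-- Repeat a program. -/
def rep (p : Prog m α) : ℕ → Prog m (List α)
  | 0 => .ret []
  | n + 1 => p.bind fun a => (rep p n).bind fun L => .ret (a :: L)

theorem time_rep_le (τ : Schedule m) (p : Prog m α) (n : ℕ) : (p.rep n).time τ ≤ n * p.time τ := by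
  induction n with
  | zero => simp [rep, time]
  | succ n ih =>
    rw [rep]
    refine (time_bind_le τ p _ (n * p.time τ) fun a => ?_).trans (by rw [Nat.succ_mul, add_comm])
    refine (time_bind_le τ _ _ 0 fun L => ?_).trans (by simpa using ih)
    simp [time]

/-- Run programs one after the other, and add up their outputs. -/
def sum (p : ℕ → Prog m ℝ) : ℕ → Prog m ℝ
  | 0 => .ret 0
  | n + 1 => (sum p n).bind fun s => (p n).bind fun y => .ret (s + y)

theorem time_sum_le (τ : Schedule m) (p : ℕ → Prog m ℝ) (n : ℕ) :
    (sum p n).time τ ≤ ∑ i ∈ Finset.range n, (p i).time τ := by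
  induction n with
  | zero => simp [sum, time]
  | succ n ih =>
    rw [sum, Finset.sum_range_succ]
    refine (time_bind_le τ _ _ ((p n).time τ) fun s => ?_).trans (Nat.add_le_add_right ih _)
    refine (time_bind_le τ _ _ 0 fun L => ?_).trans (by simp)
    simp [time]

variable {G : Type u} [Fintype G] [DecidableEq G] {Ω : Finset ℝ≥0} (S : VarTimeSampler m G Ω)

/-- The expectation of a function of the output. -/
def ev : Prog m α → (α → ℝ) → ℝ
  | .ret a, f => f a
  | .run _ c next, f => ∑ o, outcomeProb S c o * (next o).ev f

theorem prob_toAlg (p : Prog m ℝ) (E : Set ℝ) : p.toAlg.prob S E = p.ev S (E.indicator 1) := by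
  induction p with
  | ret a => rfl
  | run w c next ih => simp only [toAlg, QAlgorithm.prob, ev, ih]

theorem ev_bind (p : Prog m α) (f : α → Prog m β) (g : β → ℝ) :
    (p.bind f).ev S g = p.ev S fun a => (f a).ev S g := by
  induction p with
  | ret a => rfl
  | run w c next ih => simp only [bind, ev, ih]

theorem ev_mono (p : Prog m α) {f g : α → ℝ} (h : ∀ a, f a ≤ g a) : p.ev S f ≤ p.ev S g := by
  induction p with
  | ret a => exact h a
  | run w c next ih =>
    exact Finset.sum_le_sum fun o _ => mul_le_mul_of_nonneg_left (ih o) (outcomeProb_nonneg S c o)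

theorem ev_const (p : Prog m α) (x : ℝ) : p.ev S (fun _ => x) = x := by
  induction p with
  | ret a => rfl
  | run w c next ih => simp only [ev, ih, ← Finset.sum_mul, sum_outcomeProb_one, one_mul]

theorem ev_add (p : Prog m α) (f g : α → ℝ) :
    p.ev S (fun a => f a + g a) = p.ev S f + p.ev S g := by
  induction p with
  | ret a => rfl
  | run w c next ih => simp only [ev, ih, mul_add, Finset.sum_add_distrib]

theorem ev_mul (p : Prog m α) (x : ℝ) (f : α → ℝ) :
    p.ev S (fun a => x * f a) = x * p.ev S f := by
  induction p with
  | ret a => rfl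
  | run w c next ih => simp only [ev, ih, Finset.mul_sum, mul_left_comm]

open Classical in
/-- The output satisfies `E` except with probability at most `δ`. -/
def Holds (p : Prog m α) (E : α → Prop) (δ : ℝ) : Prop :=
  p.ev S (fun a => if E a then 0 else 1) ≤ δ

variable {S}

theorem Holds.le_prob {p : Prog m ℝ} {E : Set ℝ} {δ : ℝ} (h : p.Holds S (· ∈ E) δ) :
    1 - δ ≤ p.toAlg.prob S E := by
  classical
  rw [prob_toAlg]
  have h1 : p.ev S (fun a => E.indicator 1 a + if a ∈ E then 0 else 1) = 1 := by
    refine Eq.trans ?_ (ev_const S p 1)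
    congr 1
    funext a
    by_cases ha : a ∈ E <;> simp [ha]
  rw [ev_add] at h1
  unfold Holds at h
  have h2 : p.ev S (fun a => if a ∈ E then (0 : ℝ) else 1) ≤ δ := by convert h
  have h3 : p.ev S (fun a => E.indicator 1 a) = p.ev S (E.indicator 1) := rfl
  rw [h3] at h1
  linarith

theorem Holds.mono {p : Prog m α} {E F : α → Prop} {δ δ' : ℝ} (h : p.Holds S E δ)
    (hEF : ∀ a, E a → F a) (hδ : δ ≤ δ') : p.Holds S F δ' := by
  refine (ev_mono S p fun a => ?_).trans (h.trans hδ)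
  by_cases h1 : E a
  · simp [h1, hEF a h1]
  · simp only [h1, if_false]; split_ifs <;> norm_num

theorem Holds.and {p : Prog m α} {E F : α → Prop} {δ δ' : ℝ} (h : p.Holds S E δ)
    (h' : p.Holds S F δ') : p.Holds S (fun a => E a ∧ F a) (δ + δ') := by
  classical
  refine le_trans ?_ (add_le_add h h')
  rw [← ev_add]
  refine ev_mono S p fun a => ?_
  by_cases h1 : E a <;> by_cases h2 : F a <;> simp [h1, h2]

theorem Holds.bind {p : Prog m α} {f : α → Prog m β} {E : α → Prop} {F : β → Prop} {δ δ' : ℝ}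
    (h : p.Holds S E δ) (hδ' : 0 ≤ δ') (h' : ∀ a, E a → (f a).Holds S F δ') :
    (p.bind f).Holds S F (δ + δ') := by
  classical
  unfold Holds
  rw [ev_bind]
  refine (ev_mono S p (g := fun a => (if E a then 0 else 1) + δ') fun a => ?_).trans ?_
  · by_cases ha : E a
    · simp only [ha, if_true, zero_add]
      exact h' a ha
    · simp only [ha, if_false]
      have : (f a).ev S (fun b => if F b then 0 else 1) ≤ 1 := by
        refine le_trans ?_ (ev_const S (f a) 1).le
        refine ev_mono S _ fun b => ?_
        split_ifs <;> norm_num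
      linarith
  · rw [ev_add, ev_const]
    have : p.ev S (fun a => if E a then (0 : ℝ) else 1) ≤ δ := by
      unfold Holds at h
      convert h
    linarith

theorem holds_ret {a : α} {E : α → Prop} {δ : ℝ} (h : E a) (hδ : 0 ≤ δ) :
    (Prog.ret a : Prog m α).Holds S E δ := by
  simp only [Holds, ev, h, if_true]
  exact hδ

theorem holds_sum {p : ℕ → Prog m ℝ} {n : ℕ} {lo up : ℕ → ℝ} {δ : ℝ} (hδ : 0 ≤ δ)
    (h : ∀ i < n, (p i).Holds S (fun y => lo i ≤ y ∧ y ≤ up i) δ) :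
    (sum p n).Holds S (fun y => ∑ i ∈ Finset.range n, lo i ≤ y ∧ y ≤ ∑ i ∈ Finset.range n, up i)
      (n * δ) := by
  induction n with
  | zero => exact holds_ret (by simp) (by simp)
  | succ n ih =>
    rw [sum]
    push_cast
    rw [add_mul, one_mul]
    refine (ih fun i hi => h i (by omega)).bind hδ fun s hs => ?_
    rw [← add_zero δ]
    refine (h n (by omega)).bind le_rfl fun y hy => holds_ret ?_ le_rfl
    rw [Finset.sum_range_succ, Finset.sum_range_succ]
    exact ⟨add_le_add hs.1 hy.1, add_le_add hs.2 hy.2⟩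

/-! ## Concentration of repeated measurements -/

theorem exp_le_one_add_add_sq {x : ℝ} (hx : |x| ≤ 1) : Real.exp x ≤ 1 + x + x ^ 2 := by
  have := Real.abs_exp_sub_one_sub_id_le hx
  have := (abs_le.mp this).2
  linarith

/-- After e^x ≤ 1 + x + x², the linear term has expectation zero and the quadratic one is at most
t², because the deviation is at most 1 in absolute value. -/
theorem ev_exp_le (p : Prog m α) (f : α → ℝ) (h0 : ∀ a, 0 ≤ f a) (h1 : ∀ a, f a ≤ 1) {t : ℝ}
    (ht : |t| ≤ 1) : p.ev S (fun a => Real.exp (t * (f a - p.ev S f))) ≤ Real.exp (t ^ 2) := by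
  have q0 : 0 ≤ p.ev S f := by
    rw [← ev_const S p 0]
    exact ev_mono S p h0
  have q1 : p.ev S f ≤ 1 := by
    rw [← ev_const S p 1]
    exact ev_mono S p h1
  have hb : ∀ a, |f a - p.ev S f| ≤ 1 := fun a =>
    abs_le.mpr ⟨by linarith [h0 a], by linarith [h1 a]⟩
  have hle : ∀ a, Real.exp (t * (f a - p.ev S f)) ≤ (1 + t ^ 2 - t * p.ev S f) + t * f a := by
    intro a
    have h2 : |t * (f a - p.ev S f)| ≤ 1 := by
      rw [abs_mul]
      exact mul_le_one₀ ht (abs_nonneg _) (hb a)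
    refine (exp_le_one_add_add_sq h2).trans ?_
    have h3 : (f a - p.ev S f) ^ 2 ≤ 1 := by
      rw [← sq_abs]
      exact pow_le_one₀ (abs_nonneg _) (hb a)
    nlinarith [mul_le_mul_of_nonneg_left h3 (sq_nonneg t)]
  refine (ev_mono S p hle).trans ?_
  rw [ev_add, ev_const, ev_mul]
  have := Real.add_one_le_exp (t ^ 2)
  linarith

theorem ev_rep_exp (p : Prog m α) (g : α → ℝ) (t : ℝ) (n : ℕ) :
    (p.rep n).ev S (fun L => Real.exp (t * (L.map g).sum)) =
      (p.ev S fun a => Real.exp (t * g a)) ^ n := by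
  induction n with
  | zero => simp [rep, ev]
  | succ n ih =>
    rw [rep, ev_bind]
    have : ∀ a, ((p.rep n).bind fun L => Prog.ret (a :: L)).ev S
        (fun L => Real.exp (t * (L.map g).sum)) =
        (p.ev S fun a => Real.exp (t * g a)) ^ n * Real.exp (t * g a) := by
      intro a
      rw [ev_bind, ← ih, mul_comm, ← ev_mul]
      congr 1
      funext L
      simp only [ev, List.map_cons, List.sum_cons]
      rw [mul_add, Real.exp_add]
    simp only [this]
    rw [ev_mul, pow_succ]

/-- Chernoff's method with parameter η/2: the exponent is −nη²/2 from Markov's inequality plus nη²/4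
from the moment generating function. The sign σ selects the tail. -/
theorem holds_rep_of_abs_eq_one (p : Prog m α) (f : α → ℝ) (h0 : ∀ a, 0 ≤ f a) (h1 : ∀ a, f a ≤ 1)
    {η : ℝ} (hη0 : 0 ≤ η) (hη1 : η ≤ 1) (n : ℕ) {σ : ℝ} (hσ : |σ| = 1) :
    (p.rep n).Holds S (fun L => σ * (L.map fun a => f a - p.ev S f).sum ≤ n * η)
      (Real.exp (-(n * η ^ 2 / 4))) := by
  classical
  have ht : |σ * (η / 2)| ≤ 1 := by
    rw [abs_mul, hσ, one_mul, abs_of_nonneg (by linarith)]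
    linarith
  have hmgf := ev_exp_le (S := S) p f h0 h1 ht
  have key : ∀ L : List α, (if σ * (L.map fun a => f a - p.ev S f).sum ≤ n * η then (0 : ℝ) else 1) ≤
      Real.exp (-(n * η ^ 2 / 2)) *
        Real.exp ((σ * (η / 2)) * (L.map fun a => f a - p.ev S f).sum) := by
    intro L
    rw [← Real.exp_add]
    split_ifs with h
    · positivity
    · rw [Real.one_le_exp_iff]
      push Not at h
      nlinarith
  refine (ev_mono S _ (g := fun L => Real.exp (-(n * η ^ 2 / 2)) *
    Real.exp ((σ * (η / 2)) * (L.map fun a => f a - p.ev S f).sum)) fun L => ?_).trans ?_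
  · convert key L
  · rw [ev_mul, ev_rep_exp]
    have h2 : (p.ev S fun a => Real.exp (σ * (η / 2) * (f a - p.ev S f))) ^ n ≤
        Real.exp ((σ * (η / 2)) ^ 2) ^ n := by
      refine pow_le_pow_left₀ ?_ hmgf n
      rw [← ev_const S p 0]
      exact ev_mono S p fun a => (Real.exp_pos _).le
    refine (mul_le_mul_of_nonneg_left h2 (Real.exp_pos _).le).trans (le_of_eq ?_)
    rw [← Real.exp_nat_mul, ← Real.exp_add]
    congr 1
    have : σ ^ 2 = 1 := by rw [← sq_abs, hσ]; norm_num
    rw [mul_pow, this]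
    ring

/-- The mean of a function with values in `[0, 1]` is close to the expectation. -/
theorem holds_rep (p : Prog m α) (f : α → ℝ) (h0 : ∀ a, 0 ≤ f a) (h1 : ∀ a, f a ≤ 1)
    {η : ℝ} (hη0 : 0 ≤ η) (hη1 : η ≤ 1) {n : ℕ} (hn : 0 < n) :
    (p.rep n).Holds S (fun L => |(L.map f).sum / n - p.ev S f| ≤ η)
      (2 * Real.exp (-(n * η ^ 2 / 4))) := by
  have hlen : (p.rep n).Holds S (fun L => L.length = n) 0 := by
    clear hn
    induction n with
    | zero => exact holds_ret rfl le_rfl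
    | succ n ih =>
      rw [rep, ← add_zero (0 : ℝ)]
      refine Holds.bind (E := fun _ => True) ?_ le_rfl fun a _ => ?_
      · simp only [Holds, if_true]
        rw [ev_const]
      · rw [← add_zero (0 : ℝ)]
        exact ih.bind le_rfl fun L hL => holds_ret (by simp [hL]) le_rfl
  have e1 := holds_rep_of_abs_eq_one (S := S) p f h0 h1 hη0 hη1 n (σ := 1) (by simp)
  have e2 := holds_rep_of_abs_eq_one (S := S) p f h0 h1 hη0 hη1 n (σ := -1) (by simp)
  refine ((e1.and e2).and hlen).mono ?_ (le_of_eq (by ring))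
  rintro L ⟨⟨a1, a2⟩, hL⟩
  have hs : (L.map fun a => f a - p.ev S f).sum = (L.map f).sum - n * p.ev S f := by
    rw [← hL]
    clear a1 a2 hL
    induction L with
    | nil => simp
    | cons a L ih => simp only [List.map_cons, List.sum_cons, ih, List.length_cons]; push_cast; ring
  rw [hs] at a1 a2
  have hn' : (0 : ℝ) < n := by exact_mod_cast hn
  rw [div_sub' hn'.ne', abs_div, abs_of_pos hn', div_le_iff₀ hn', abs_le]
  constructor <;> nlinarith

end Prog

/-! ## Brackets of stopping times -/

section Brackets

variable {m : ℕ} (σ : Schedule m)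

/-- The stopping times, indexed by natural numbers. -/
def Schedule.timeN (j : ℕ) : ℕ := if h : j < m + 1 then σ.time ⟨j, h⟩ else 0

theorem Schedule.timeN_zero : σ.timeN 0 = 0 := by
  simp only [Schedule.timeN, Nat.zero_lt_succ, dif_pos]
  exact σ.time_zero

theorem Schedule.timeN_mono {i j : ℕ} (h : i ≤ j) (hj : j ≤ m) : σ.timeN i ≤ σ.timeN j := by
  rw [timeN, timeN, dif_pos (by omega), dif_pos (by omega)]
  exact σ.strictMono.monotone (Fin.mk_le_mk.mpr h)

/-- Stopping times are strictly increasing integers. Thus operations on all flags used so far are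
paid for by the running time. -/
theorem Schedule.le_timeN {j : ℕ} (hj : j ≤ m) : j ≤ σ.timeN j := by
  induction j with
  | zero => exact Nat.zero_le _
  | succ j ih =>
    have h1 := ih (by omega)
    have h2 : σ.timeN j < σ.timeN (j + 1) := by
      rw [timeN, timeN, dif_pos (by omega), dif_pos (by omega)]
      exact σ.strictMono (Fin.mk_lt_mk.mpr (Nat.lt_succ_self j))
    omega

/-- The number of steps that end by the time `t`. -/
def Schedule.stepsBy (t : ℝ) : ℕ :=
  @Nat.findGreatest (fun j => (σ.timeN j : ℝ) ≤ t) (Classical.decPred _) m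

theorem Schedule.stepsBy_le (t : ℝ) : σ.stepsBy t ≤ m :=
  @Nat.findGreatest_le _ (Classical.decPred _) m

theorem Schedule.timeN_stepsBy {t : ℝ} (ht : 0 ≤ t) : (σ.timeN (σ.stepsBy t) : ℝ) ≤ t :=
  @Nat.findGreatest_spec 0 (fun j => (σ.timeN j : ℝ) ≤ t) (Classical.decPred _) m (Nat.zero_le m)
    (by rw [σ.timeN_zero]; simpa using ht)

theorem Schedule.stepsBy_cast_le {t : ℝ} (ht : 0 ≤ t) : (σ.stepsBy t : ℝ) ≤ t :=
  le_trans (by exact_mod_cast σ.le_timeN (σ.stepsBy_le t)) (σ.timeN_stepsBy ht)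

theorem Schedule.le_stepsBy {t : ℝ} {j : ℕ} (hj : j ≤ m) (h : (σ.timeN j : ℝ) ≤ t) :
    j ≤ σ.stepsBy t :=
  @Nat.le_findGreatest j (fun j => (σ.timeN j : ℝ) ≤ t) (Classical.decPred _) m hj h

theorem Schedule.lt_time_of_stepsBy_le {t : ℝ} {k : Fin m} (h : σ.stepsBy t ≤ k.val) :
    t < (σ.time k.succ : ℝ) := by
  by_contra hle
  push Not at hle
  have h1 : σ.timeN (k.val + 1) = σ.time k.succ := by
    rw [timeN, dif_pos (by omega)]
    rfl
  have h2 := σ.le_stepsBy (t := t) (j := k.val + 1) k.2 (by rw [h1]; exact hle)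
  omega

theorem Schedule.stepsBy_mono {t t' : ℝ} (ht : 0 ≤ t) (h : t ≤ t') : σ.stepsBy t ≤ σ.stepsBy t' :=
  σ.le_stepsBy (σ.stepsBy_le t) ((σ.timeN_stepsBy ht).trans h)

/-- The ends of the brackets of steps, whose times increase by factors of three. -/
def brackets (U : ℝ) : ℕ → ℕ
  | 0 => 0
  | j + 1 => σ.stepsBy (3 ^ j * U)

variable {U : ℝ}

theorem brackets_mono (hU : 0 ≤ U) : Monotone (brackets σ U) := by
  refine monotone_nat_of_le_succ fun j => ?_
  cases j with
  | zero => exact Nat.zero_le _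
  | succ j =>
    refine σ.stepsBy_mono (by positivity) (mul_le_mul_of_nonneg_right ?_ hU)
    exact pow_le_pow_right₀ (by norm_num) (Nat.le_succ j)

theorem brackets_le (j : ℕ) : brackets σ U j ≤ m := by
  cases j with
  | zero => exact Nat.zero_le _
  | succ j => exact σ.stepsBy_le _

/-! ## The time of the circuits -/

theorem cost_stepGates (J n : ℕ) (h : J + n ≤ m) :
    circCost σ (stepGates m J n) + σ.timeN J = σ.timeN (J + n) := by
  induction n with
  | zero => simp [stepGates, circCost]
  | succ n ih =>
    have h1 := ih (by omega)
    rw [stepGates, dif_pos (by omega), circCost_append]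
    have h2 : circCost σ [Gate.step (w := m + 9) (⟨J + n, by omega⟩ : Fin m) false
        (some (Fin.ofNat (m + 9) 0))] + σ.timeN (J + n) = σ.timeN (J + (n + 1)) := by
      simp only [circCost, List.map_cons, List.map_nil, List.sum_cons, List.sum_nil, Gate.cost,
        Schedule.duration, add_zero]
      have h3 := σ.timeN_mono (show J + n ≤ J + n + 1 by omega) (by omega)
      rw [← add_assoc]
      rw [Schedule.timeN, Schedule.timeN, dif_pos (by omega), dif_pos (by omega)] at h3 ⊢
      exact Nat.sub_add_cancel h3
    omega

theorem cost_parityGates (J n : ℕ) : circCost σ (parityGates m J n) ≤ n := by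
  induction n with
  | zero => simp [parityGates, circCost]
  | succ n ih =>
    rw [parityGates, circCost_append]
    refine Nat.add_le_add ih ?_
    split_ifs
    · exact cost_cg σ _ _ _
    · simp [circCost]

theorem cost_signGates (J : ℕ) : circCost σ (signGates m J) ≤ J := by
  induction J with
  | zero => simp [signGates, circCost]
  | succ n ih =>
    rw [signGates, circCost_append]
    refine Nat.add_le_add ih ?_
    split_ifs
    · exact cost_cg σ _ _ _
    · simp [circCost]

theorem cost_extractGates (J n : ℕ) (a b : ℝ) (hab : 0 ≤ a ∧ a < b) :
    circCost σ (extractGates m J n a b hab) ≤ n + 7 := by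
  simp only [extractGates, circCost_append]
  have h1 := cost_parityGates σ J n
  have h2 := cost_toffoli σ (wk 2 : Fin m ⊕ Fin (m + 9)) (wk 1) true (wk 3)
  have h3 : circCost σ (cnot (wk 0 : Fin m ⊕ Fin (m + 9)) false (wk 3)) ≤ 1 := cost_cg σ _ _ _
  have h4 : circCost σ [Gate.bernoulli (m := m) a b hab false (Fin.ofNat (m + 9) 2)] = 1 := by
    simp [circCost, Gate.cost]
  omega

theorem cost_levelGates (hU : 0 ≤ U) (l : ℕ) (a b : ℝ) (hab : 0 ≤ a ∧ a < b) (j : ℕ) :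
    (circCost σ (levelGates m (brackets σ U) l a b hab j) : ℝ) ≤ 2 * (3 ^ j * U) + 7 := by
  have hstep : ∀ j, (circCost σ (stepGates m (brackets σ U j)
      (brackets σ U (j + 1) - brackets σ U j)) : ℝ) ≤ 3 ^ j * U := by
    intro j
    have h1 : brackets σ U j ≤ brackets σ U (j + 1) := brackets_mono σ hU (Nat.le_succ j)
    have h2 := brackets_le (U := U) σ (j + 1)
    have h3 := cost_stepGates σ (brackets σ U j) (brackets σ U (j + 1) - brackets σ U j)
      (by omega)
    rw [Nat.add_sub_of_le h1] at h3
    have h4 : (σ.timeN (brackets σ U (j + 1)) : ℝ) ≤ 3 ^ j * U :=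
      σ.timeN_stepsBy (by positivity)
    refine le_trans ?_ h4
    exact_mod_cast (by omega)
  have hτ : 0 ≤ 3 ^ j * U := by positivity
  unfold levelGates
  split_ifs with h1 h2
  · linarith [hstep j]
  · subst h2
    rw [circCost_append]
    have h3 := cost_extractGates σ (brackets σ U j) (brackets σ U (j + 1) - brackets σ U j) a b hab
    have h4 : (brackets σ U (j + 1) : ℝ) ≤ 3 ^ j * U := σ.stepsBy_cast_le hτ
    have h5 : (circCost σ (extractGates m (brackets σ U j)
        (brackets σ U (j + 1) - brackets σ U j) a b hab) : ℝ) ≤ 3 ^ j * U + 7 := by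
      refine le_trans (b := ((brackets σ U (j + 1) + 7 : ℕ) : ℝ)) (by exact_mod_cast (by omega)) ?_
      push_cast; linarith
    push_cast
    linarith [hstep j]
  · simp only [circCost, List.map_nil, List.sum_nil, Nat.cast_zero]
    linarith

/-- A level uses the previous circuit and its own gates three times, which costs 3·(2·3^j·U + 7)
beyond the previous circuits. The sign change and the reflection add at most 11·3^j·U + 44. The sum
is at most 82·3^j·U, below 28·3^(j+1)·U. -/
theorem cost_ampCirc (hU : 1 ≤ U) (ν : ℝ) (hν : 0 ≤ ν ∧ ν ≤ 1) (l : ℕ) (a b : ℝ)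
    (hab : 0 ≤ a ∧ a < b) (j : ℕ) :
    (circCost σ (ampCirc m ν hν (brackets σ U) l a b hab j) : ℝ) ≤ 3 ^ j * (1 + 28 * j * U) := by
  induction j with
  | zero =>
    have : circCost σ (ampCirc m ν hν (brackets σ U) l a b hab 0) ≤ 1 := by
      rw [ampCirc, prepGates]
      exact cost_cg σ _ _ _
    simp only [pow_zero, Nat.cast_zero, mul_zero, zero_mul, add_zero, mul_one]
    exact_mod_cast this
  | succ j ih =>
    have h3 : (1 : ℝ) ≤ 3 ^ j := one_le_pow₀ (by norm_num)
    have hτ : (brackets σ U (min j l + 1) : ℝ) ≤ 3 ^ j * U := by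
      refine (σ.stepsBy_cast_le (by positivity)).trans ?_
      refine mul_le_mul_of_nonneg_right ?_ (by linarith)
      exact pow_le_pow_right₀ (by norm_num) (min_le_left j l)
    have hlev := cost_levelGates σ (by linarith : 0 ≤ U) l a b hab j
    have hsign : (circCost σ (levelSign m (brackets σ U) l j) : ℝ) ≤ 3 ^ j * U + 1 := by
      unfold levelSign
      split_ifs with h
      · rw [min_eq_left h.le] at hτ
        have : (circCost σ (signGates m (brackets σ U (j + 1))) : ℝ) ≤ brackets σ U (j + 1) := by
          exact_mod_cast cost_signGates σ _
        linarith
      · have : (circCost σ (signGate (wk 0 : Fin m ⊕ Fin (m + 9)) (wk 3) false) : ℝ) ≤ 1 := by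
          exact_mod_cast cost_cg σ _ _ _
        have : 0 ≤ 3 ^ j * U := by positivity
        linarith
    have hrefl : (circCost σ (reflect m (brackets σ U (min j l + 1))) : ℝ) ≤ 10 * (3 ^ j * U) + 43 := by
      have : (circCost σ (reflect m (brackets σ U (min j l + 1))) : ℝ) ≤
          10 * brackets σ U (min j l + 1) + 43 := by
        exact_mod_cast cost_reflect σ (brackets σ U (min j l + 1))
      linarith
    have h1U : (1 : ℝ) ≤ 3 ^ j * U := by nlinarith
    simp only [ampCirc, circCost_append, circCost_inv]
    push_cast
    rw [pow_succ]
    nlinarith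

theorem cost_sampleCirc (hU : 1 ≤ U) (ν : ℝ) (hν : 0 ≤ ν ∧ ν ≤ 1) (l : ℕ) (a b : ℝ)
    (hab : 0 ≤ a ∧ a < b) (N : ℕ) :
    (circCost σ (sampleCirc m ν hν (brackets σ U) l a b hab N) : ℝ) ≤ 28 * 3 ^ N * (N + 1) * U := by
  have h1 := cost_ampCirc σ hU ν hν l a b hab N
  have h2 := cost_levelGates σ (by linarith : 0 ≤ U) l a b hab N
  have h3 : (1 : ℝ) ≤ 3 ^ N := one_le_pow₀ (by norm_num)
  have h1U : (1 : ℝ) ≤ 3 ^ N * U := by nlinarith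
  have h3U : (3 : ℝ) ^ N ≤ 3 ^ N * U := by nlinarith
  rw [sampleCirc, circCost_append]
  push_cast
  nlinarith

end Brackets

/-! ## The gain -/

/-- As long as the gain is at most 3^j, the amplified good weight is at most 9^j·w_j ≤ α, so the
next factor lies between 3 − 4α and 3. Bernoulli's inequality bounds (1 − 4α/3)^N below by 1 − 4αN/3
≥ 1/2. -/
theorem gain_bounds {w : ℕ → ℝ} {N : ℕ} {α : ℝ} (hα' : 8 * (α * N) ≤ 3) (hα1 : α ≤ 1 / 4)
    (hw0 : ∀ j, 0 ≤ w j) (hw : ∀ j < N, 9 ^ j * w j ≤ α) :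
    3 ^ N / 2 ≤ gain w N := by
  have key : ∀ j ≤ N, 3 ^ j * (1 - 4 / 3 * α) ^ j ≤ gain w j ∧ gain w j ≤ 3 ^ j := by
    intro j hj
    induction j with
    | zero => simp [gain]
    | succ j ih =>
      obtain ⟨h1, h2⟩ := ih (by omega)
      have hx : 0 ≤ 1 - 4 / 3 * α := by linarith
      have hg : 0 ≤ gain w j := le_trans (by positivity) h1
      have h3 : gain w j ^ 2 * w j ≤ α := by
        refine le_trans ?_ (hw j (by omega))
        refine mul_le_mul_of_nonneg_right ?_ (hw0 j)
        refine (pow_le_pow_left₀ hg h2 2).trans (le_of_eq ?_)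
        rw [← pow_mul, mul_comm j 2, pow_mul]
        norm_num
      have h4 : 0 ≤ gain w j ^ 2 * w j := mul_nonneg (sq_nonneg _) (hw0 j)
      rw [gain, pow_succ, pow_succ]
      constructor
      · have : 3 ^ j * 3 * ((1 - 4 / 3 * α) ^ j * (1 - 4 / 3 * α)) =
            3 ^ j * (1 - 4 / 3 * α) ^ j * (3 - 4 * α) := by ring
        rw [this]
        exact mul_le_mul h1 (by linarith) (by linarith) hg
      · exact mul_le_mul h2 (by linarith) (by linarith) (by positivity)
  have hB := one_add_mul_le_pow (show (-2 : ℝ) ≤ -(4 / 3 * α) by linarith) N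
  refine le_trans ?_ (key N le_rfl).1
  have h3 : (0 : ℝ) < 3 ^ N := by positivity
  have : (1 : ℝ) / 2 ≤ (1 - 4 / 3 * α) ^ N := by
    rw [sub_eq_add_neg]
    refine le_trans ?_ hB
    nlinarith
  nlinarith

/-! ## The estimator of a piece of the mean -/

/-- Estimate the contribution of a piece to the mean by comparing the frequencies of the two branches
of the sampling circuit. -/
def pieceProg {m : ℕ} (σ : Schedule m) (U ν κ : ℝ) (hν : 0 ≤ ν ∧ ν ≤ 1) (l N : ℕ) (a b : ℝ)
    (hab : 0 ≤ a ∧ a < b) (n : ℕ) : Prog m ℝ :=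
  ((Prog.run (m + 9) (sampleCirc m ν hν (brackets σ U) l a b hab N) .ret).rep n).bind fun L =>
    .ret (if κ / 2 ≤ (L.map fun o => outcomeWeight 0 1 (o (Fin.ofNat (m + 9) 3))
        (o (Fin.ofNat (m + 9) 0))).sum / n
      then b * ((1 - ν) / ν) * ((L.map fun o => outcomeWeight 1 0 (o (Fin.ofNat (m + 9) 3))
        (o (Fin.ofNat (m + 9) 0))).sum / n) / ((L.map fun o => outcomeWeight 0 1
        (o (Fin.ofNat (m + 9) 3)) (o (Fin.ofNat (m + 9) 0))).sum / n)
      else 0)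

theorem time_pieceProg {m : ℕ} (σ : Schedule m) {U : ℝ} (hU : 1 ≤ U) (ν κ : ℝ) (hν : 0 ≤ ν ∧ ν ≤ 1)
    (l N : ℕ) (a b : ℝ) (hab : 0 ≤ a ∧ a < b) (n : ℕ) :
    ((pieceProg σ U ν κ hν l N a b hab n).time σ : ℝ) ≤ n * (28 * 3 ^ N * (N + 1) * U) := by
  have h1 : (pieceProg σ U ν κ hν l N a b hab n).time σ ≤
      n * circCost σ (sampleCirc m ν hν (brackets σ U) l a b hab N) := by
    refine (Prog.time_bind_le σ _ _ 0 fun L => by simp [Prog.time]).trans ?_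
    rw [add_zero]
    refine (Prog.time_rep_le σ _ n).trans (Nat.mul_le_mul_left n ?_)
    simp [Prog.time]
  have h2 : ((pieceProg σ U ν κ hν l N a b hab n).time σ : ℝ) ≤
      n * (circCost σ (sampleCirc m ν hν (brackets σ U) l a b hab N) : ℝ) := by exact_mod_cast h1
  exact h2.trans (mul_le_mul_of_nonneg_left (cost_sampleCirc σ hU ν hν l a b hab N) n.cast_nonneg)

/-- Once r ≥ κ/2, division by `r` turns the frequency error η into a relative error 2η/κ. Below this
threshold the estimate 0 respects the upper bound anyway, and if κ ≤ Pr, then r ≥ Pr − η ≥ κ/2, so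
this case cannot occur. -/
theorem ratio_bounds {κ η e b ω Pt Pr t r y : ℝ} (hκ : 0 < κ) (he : 0 ≤ e) (hbω : 0 ≤ b * ω)
    (hP : e * Pr = b * ω * Pt) (ht : |t - Pt| ≤ η) (hr : |r - Pr| ≤ η) (ht0 : 0 ≤ t)
    (hη : η ≤ κ / 2) (hy : y = if κ / 2 ≤ r then b * ω * t / r else 0) :
    0 ≤ y ∧ y ≤ e + 2 * η / κ * (b * ω + e) ∧ (κ ≤ Pr → e - 2 * η / κ * (b * ω + e) ≤ y) := by
  have hη0 : 0 ≤ η := (abs_nonneg _).trans ht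
  rw [abs_le] at ht hr
  by_cases h : κ / 2 ≤ r
  · have hr0 : 0 < r := by linarith
    rw [if_pos h] at hy
    have hyr : y * r = b * ω * t := by rw [hy]; field_simp
    have hs : η * (b * ω + e) ≤ 2 * η / κ * (b * ω + e) * r := by
      have : η ≤ 2 * η / κ * r := by
        rw [div_mul_eq_mul_div, le_div_iff₀ hκ]
        nlinarith
      calc η * (b * ω + e) ≤ (2 * η / κ * r) * (b * ω + e) :=
            mul_le_mul_of_nonneg_right this (by linarith)
        _ = _ := by ring
    refine ⟨by rw [hy]; positivity, ?_, fun _ => ?_⟩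
    · refine le_of_mul_le_mul_right ?_ hr0
      rw [hyr, add_mul]
      nlinarith [mul_le_mul_of_nonneg_left ht.2 hbω, mul_le_mul_of_nonneg_left hr.1 he]
    · refine le_of_mul_le_mul_right ?_ hr0
      rw [hyr, sub_mul]
      nlinarith [mul_le_mul_of_nonneg_left ht.1 hbω, mul_le_mul_of_nonneg_left hr.2 he]
  · rw [if_neg h] at hy
    refine ⟨hy.ge, ?_, fun h' => ?_⟩
    · rw [hy]
      have : 0 ≤ 2 * η / κ * (b * ω + e) := by positivity
      linarith
    · push Not at h
      linarith

section Piece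

variable {m : ℕ} {G : Type u} [Fintype G] [DecidableEq G] {Ω : Finset ℝ≥0}
  (S : VarTimeSampler m G Ω)

theorem outcomeWeight_nonneg {u y : ℝ} (hu : 0 ≤ u) (hy : 0 ≤ y) (p q : Bool) :
    0 ≤ outcomeWeight u y p q := by
  unfold outcomeWeight
  split_ifs <;> simp [hu, hy]

theorem outcomeWeight_le_one {u y : ℝ} (hu : u ≤ 1) (hy : y ≤ 1) (p q : Bool) :
    outcomeWeight u y p q ≤ 1 := by
  unfold outcomeWeight
  split_ifs <;> simp [hu, hy]

/-- The squared gain occurs in both expected frequencies and cancels in the relation between them.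
Only the lower bound on the estimate needs the gain to be large. -/
theorem holds_pieceProg {U ν κ : ℝ} (hU : 0 ≤ U) (hν : 0 ≤ ν ∧ ν ≤ 1) (hν0 : 0 < ν) (hκ : 0 < κ)
    (l N : ℕ) (hN : l ≤ N) (a b : ℝ) (hab : 0 ≤ a ∧ a < b) {n : ℕ} (hn : 0 < n) {η : ℝ} (hη0 : 0 ≤ η)
    (hη1 : η ≤ 1) (hη : η ≤ κ / 2) :
    (pieceProg S.sched U ν κ hν l N a b hab n).Holds S (fun y =>
      0 ≤ y ∧
      y ≤ pieceMean S (brackets S.sched U l) (brackets S.sched U (l + 1)) a b + 2 * η / κ *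
        (b * ((1 - ν) / ν) + pieceMean S (brackets S.sched U l) (brackets S.sched U (l + 1)) a b) ∧
      (κ ≤ gain (levelWeight S ν (brackets S.sched U) l a b) N ^ 2 * (1 - ν) →
        pieceMean S (brackets S.sched U l) (brackets S.sched U (l + 1)) a b - 2 * η / κ *
        (b * ((1 - ν) / ν) + pieceMean S (brackets S.sched U l) (brackets S.sched U (l + 1)) a b) ≤ y))
      (4 * Real.exp (-(n * η ^ 2 / 4))) := by
  set J := brackets S.sched U with hJ
  have hJm := brackets_mono S.sched hU
  have hev : ∀ u y, (Prog.run (m + 9) (sampleCirc m ν hν J l a b hab N) .ret).ev S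
      (fun o => outcomeWeight u y (o (Fin.ofNat (m + 9) 3)) (o (Fin.ofNat (m + 9) 0))) =
      gain (levelWeight S ν J l a b) N ^ 2 *
        (u * (ν * (pieceMean S (J l) (J (l + 1)) a b / b)) + (1 - ν) * y) := by
    intro u y
    rw [← pieceProb_eq_pieceMean S (hJm (Nat.le_succ l)) (brackets_le _ _)]
    exact expect_sampleCirc ν hν hJm rfl (brackets_le S.sched) l a b hab N hN u y
  have h1 := Prog.holds_rep (S := S) (Prog.run (m + 9) (sampleCirc m ν hν J l a b hab N) .ret)
    (fun o => outcomeWeight 1 0 (o (Fin.ofNat (m + 9) 3)) (o (Fin.ofNat (m + 9) 0)))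
    (fun o => outcomeWeight_nonneg zero_le_one le_rfl _ _)
    (fun o => outcomeWeight_le_one le_rfl zero_le_one _ _) hη0 hη1 hn
  have h2 := Prog.holds_rep (S := S) (Prog.run (m + 9) (sampleCirc m ν hν J l a b hab N) .ret)
    (fun o => outcomeWeight 0 1 (o (Fin.ofNat (m + 9) 3)) (o (Fin.ofNat (m + 9) 0)))
    (fun o => outcomeWeight_nonneg le_rfl zero_le_one _ _)
    (fun o => outcomeWeight_le_one zero_le_one le_rfl _ _) hη0 hη1 hn
  rw [hev] at h1 h2
  have hb : 0 < b := hab.1.trans_lt hab.2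
  rw [show 4 * Real.exp (-(n * η ^ 2 / 4)) = (2 * Real.exp (-(n * η ^ 2 / 4)) +
    2 * Real.exp (-(n * η ^ 2 / 4))) + 0 by ring]
  refine (h1.and h2).bind le_rfl fun L hL => Prog.holds_ret ?_ le_rfl
  refine ratio_bounds (Pr := gain (levelWeight S ν J l a b) N ^ 2 * (1 - ν)) hκ
    (pieceMean_nonneg S _ _ a b)
    (mul_nonneg hb.le (div_nonneg (by linarith [hν.2]) hν.1)) ?_ hL.1 ?_ ?_ hη rfl
  · field_simp
    ring
  · have := hL.2
    rwa [zero_mul, zero_add, mul_one] at this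
  · refine div_nonneg (List.sum_nonneg ?_) n.cast_nonneg
    intro x hx
    obtain ⟨o, -, rfl⟩ := List.mem_map.mp hx
    exact outcomeWeight_nonneg zero_le_one le_rfl _ _

end Piece

/-! ## Bounds on the pieces of the mean -/

section Pieces

variable {m : ℕ} {G : Type u} [Fintype G] [DecidableEq G] {Ω : Finset ℝ≥0}
  (S : VarTimeSampler m G Ω)

theorem pieceMean_le_sum_large (J J' : ℕ) (a b : ℝ) :
    pieceMean S J J' a b ≤ ∑ y : Fin m × Ω,
      (if a ≤ ((y.2 : ℝ≥0) : ℝ) then ((y.2 : ℝ≥0) : ℝ) else 0) * jointProb S y := by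
  refine Finset.sum_le_sum fun y _ => mul_le_mul_of_nonneg_right ?_ (jointProb_nonneg S y)
  have h0 : (0 : ℝ) ≤ ((y.2 : ℝ≥0) : ℝ) := NNReal.coe_nonneg _
  by_cases h : a ≤ ((y.2 : ℝ≥0) : ℝ)
  · rw [if_pos h]
    split_ifs
    · exact le_rfl
    · exact h0
  · rw [if_neg h, if_neg fun h' => h h'.2.1]

theorem pieceMean_le_sum_long (t : ℝ) (J' : ℕ) (a b : ℝ) :
    pieceMean S (S.sched.stepsBy t) J' a b ≤ ∑ y : Fin m × Ω,
      (if t < (S.sched.time y.1.succ : ℝ) then ((y.2 : ℝ≥0) : ℝ) else 0) * jointProb S y := by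
  refine Finset.sum_le_sum fun y _ => mul_le_mul_of_nonneg_right ?_ (jointProb_nonneg S y)
  have h0 : (0 : ℝ) ≤ ((y.2 : ℝ≥0) : ℝ) := NNReal.coe_nonneg _
  by_cases h : t < (S.sched.time y.1.succ : ℝ)
  · rw [if_pos h]
    split_ifs
    · exact le_rfl
    · exact h0
  · rw [if_neg h, if_neg fun h' => h (S.sched.lt_time_of_stepsBy_le h'.1.1)]

theorem contWeight_stepsBy_le {t : ℝ} (ht : 0 < t) :
    contWeight S (S.sched.stepsBy t) ≤ S.Tl2 ^ 2 / t ^ 2 := by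
  rw [contWeight_eq S _ (S.sched.stepsBy_le t)]
  refine le_trans ?_ (prob_long_le S ht)
  refine Finset.sum_le_sum fun y _ => mul_le_mul_of_nonneg_right ?_ (jointProb_nonneg S y)
  by_cases h : t < (S.sched.time y.1.succ : ℝ)
  · rw [if_pos h]
    split_ifs <;> norm_num
  · rw [if_neg h, if_neg fun h' => h (S.sched.lt_time_of_stepsBy_le h')]

theorem contWeight_nonneg {J : ℕ} (hJ : J ≤ m) : 0 ≤ contWeight S J := by
  rw [contWeight_eq S _ hJ]
  refine Finset.sum_nonneg fun y _ => mul_nonneg ?_ (jointProb_nonneg S y)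
  split_ifs <;> norm_num

theorem sum_pieceMean_steps {J : ℕ → ℕ} (hJ : Monotone J) (hJ0 : J 0 = 0) (a b : ℝ) (n : ℕ) :
    ∑ l ∈ Finset.range n, pieceMean S (J l) (J (l + 1)) a b = pieceMean S 0 (J n) a b := by
  induction n with
  | zero => simp [pieceMean, hJ0]
  | succ n ih =>
    rw [Finset.sum_range_succ, ih]
    simp only [pieceMean]
    rw [← Finset.sum_add_distrib]
    refine Finset.sum_congr rfl fun y _ => ?_
    rw [← add_mul]
    congr 1
    have h1 : J n ≤ J (n + 1) := hJ (Nat.le_succ n)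
    by_cases hx : a ≤ ((y.2 : ℝ≥0) : ℝ) ∧ ((y.2 : ℝ≥0) : ℝ) < b
    · simp only [hx, and_self, and_true, Nat.zero_le, true_and]
      by_cases h2 : y.1.val < J n
      · rw [if_pos h2, if_neg (by omega), if_pos (by omega), add_zero]
      · rw [if_neg h2, zero_add]
        congr 1
        rw [eq_iff_iff]
        omega
    · simp only [hx, and_false, if_false, add_zero]

theorem sum_pieceMean_outputs {c : ℕ → ℝ} (hc : Monotone c) (hc0 : c 0 = 0) (J J' : ℕ) (n : ℕ) :
    ∑ i ∈ Finset.range n, pieceMean S J J' (c i) (c (i + 1)) = pieceMean S J J' 0 (c n) := by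
  induction n with
  | zero =>
    rw [Finset.sum_range_zero, eq_comm]
    refine Finset.sum_eq_zero fun y _ => ?_
    rw [if_neg, zero_mul]
    rw [hc0]
    rintro ⟨-, h1, h2⟩
    linarith
  | succ n ih =>
    rw [Finset.sum_range_succ, ih]
    simp only [pieceMean]
    rw [← Finset.sum_add_distrib]
    refine Finset.sum_congr rfl fun y _ => ?_
    rw [← add_mul]
    congr 1
    have h1 : c n ≤ c (n + 1) := hc (Nat.le_succ n)
    have h0 : (0 : ℝ) ≤ ((y.2 : ℝ≥0) : ℝ) := NNReal.coe_nonneg _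
    by_cases hx : J ≤ y.1.val ∧ y.1.val < J'
    · simp only [hx, and_self, true_and, h0]
      by_cases h2 : ((y.2 : ℝ≥0) : ℝ) < c n
      · rw [if_pos h2, if_neg (by intro h; linarith [h.1]), if_pos (h2.trans_le h1), add_zero]
      · rw [if_neg h2, zero_add]
        push Not at h2
        simp only [h2, true_and]
    · simp only [hx, false_and, if_false, add_zero]

theorem mean_le_pieceMean_add {t b : ℝ} (ht : 0 < t) (hb : 0 < b) :
    S.mean ≤ pieceMean S 0 (S.sched.stepsBy t) 0 b + S.phi * S.Tl2 / t + S.phi ^ 2 / b := by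
  refine le_trans ?_ (add_le_add (add_le_add le_rfl (sum_long_le S ht)) (sum_large_le S hb))
  rw [mean_eq, pieceMean, ← Finset.sum_add_distrib, ← Finset.sum_add_distrib]
  refine Finset.sum_le_sum fun y _ => ?_
  rw [← add_mul, ← add_mul]
  refine mul_le_mul_of_nonneg_right ?_ (jointProb_nonneg S y)
  have h0 : (0 : ℝ) ≤ ((y.2 : ℝ≥0) : ℝ) := NNReal.coe_nonneg _
  by_cases h1 : y.1.val < S.sched.stepsBy t
  · by_cases h2 : ((y.2 : ℝ≥0) : ℝ) < b
    · rw [if_pos ⟨⟨Nat.zero_le _, h1⟩, h0, h2⟩]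
      split_ifs <;> linarith
    · push Not at h2
      rw [if_pos h2]
      split_ifs <;> linarith
  · push Not at h1
    rw [if_pos (S.sched.lt_time_of_stepsBy_le h1)]
    split_ifs <;> linarith

/-- No step ends by time 1/2, since stopping times are integers. So the truncated piece is empty,
and both tail bounds vanish with φ. -/
theorem mean_le_zero_of_phi_le_zero (h : S.phi ≤ 0) : S.mean ≤ 0 := by
  have h0 : S.phi = 0 := le_antisymm h (phi_nonneg S)
  have h1 := mean_le_pieceMean_add S (t := 1 / 2) (b := 1) (by norm_num) one_pos
  have h2 : S.sched.stepsBy (1 / 2) = 0 := by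
    have h3 := S.sched.stepsBy_cast_le (t := 1 / 2) (by norm_num)
    by_contra h4
    have : (1 : ℝ) ≤ S.sched.stepsBy (1 / 2) := by exact_mod_cast Nat.one_le_iff_ne_zero.mpr h4
    linarith
  have h5 : pieceMean S 0 0 0 1 = 0 := by simp [pieceMean]
  rw [h2, h5, h0] at h1
  simpa using h1

end Pieces

/-! ## The estimator of the contribution of a bracket of times and a bracket of outputs -/

/-- The ends of the brackets of outputs. -/
def cut (x : ℝ) : ℕ → ℝ
  | 0 => 0
  | i + 1 => 3 ^ i * x

theorem cut_nonneg {x : ℝ} (hx : 0 ≤ x) (i : ℕ) : 0 ≤ cut x i := by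
  cases i with
  | zero => exact le_rfl
  | succ i => exact mul_nonneg (by positivity) hx

theorem cut_lt {x : ℝ} (hx : 0 < x) (i : ℕ) : cut x i < cut x (i + 1) := by
  cases i with
  | zero => simp only [cut]; positivity
  | succ i =>
    simp only [cut, pow_succ]
    have : 0 < 3 ^ i * x := by positivity
    linarith

/-- The small probability with which the output of the sampler is ignored. -/
def refProb (c : ℝ) (N : ℕ) : ℝ := (9 ^ N * c ^ 2)⁻¹

theorem refProb_pos {c : ℝ} (hc : 6 ≤ c) (N : ℕ) : 0 < refProb c N := by
  unfold refProb; positivity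

theorem refProb_le {c : ℝ} (hc : 6 ≤ c) (N : ℕ) : refProb c N ≤ 1 / 36 := by
  unfold refProb
  rw [inv_eq_one_div]
  refine one_div_le_one_div_of_le (by norm_num) ?_
  have : (1 : ℝ) ≤ 9 ^ N := one_le_pow₀ (by norm_num)
  nlinarith

/-- Estimate the contribution of the `l`-th bracket of times and of the `i`-th bracket of outputs. -/
def bracketProg {m : ℕ} (σ : Schedule m) (c T x s lam : ℝ) (d l i : ℕ) : Prog m ℝ :=
  if h : (0 ≤ 1 - refProb c (max l (i + d)) ∧ 1 - refProb c (max l (i + d)) ≤ 1) ∧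
      (0 ≤ cut x i ∧ cut x i < cut x (i + 1)) then
    pieceProg σ (c * T) (1 - refProb c (max l (i + d))) (1 / (4 * c ^ 2)) h.1 l (max l (i + d))
      (cut x i) (cut x (i + 1)) h.2 ⌈4 * lam / (s * 3 ^ (max l (i + d) - d)) ^ 2⌉₊
  else .ret 0

theorem time_bracketProg {m : ℕ} (σ : Schedule m) {c T x s lam : ℝ} (hcT : 1 ≤ c * T) (d l i : ℕ) :
    ((bracketProg σ c T x s lam d l i).time σ : ℝ) ≤ ⌈4 * lam / (s * 3 ^ (max l (i + d) - d)) ^ 2⌉₊ *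
      (28 * 3 ^ max l (i + d) * ((max l (i + d) : ℕ) + 1) * (c * T)) := by
  unfold bracketProg
  split_ifs with h
  · exact time_pieceProg σ hcT _ _ _ _ _ _ _ _ _
  · simp only [Prog.time, Nat.cast_zero]
    positivity

section Estimate

variable {m : ℕ} {G : Type u} [Fintype G] [DecidableEq G] {Ω : Finset ℝ≥0}
  (S : VarTimeSampler m G Ω)

/-- The parameters `D`, `T`, `v` bound the sampler. -/
structure Valid (D T v : ℝ) : Prop where
  phi_le : S.phi ≤ D * S.mean
  Tl2_le : S.Tl2 ≤ T
  mean_le : S.mean ≤ 2 * v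

variable {S} {D T v c : ℝ}

theorem Valid.phi_sq_le (h : Valid S D T v) : S.phi ^ 2 ≤ D ^ 2 * S.mean ^ 2 := by
  rw [← mul_pow]
  exact pow_le_pow_left₀ (phi_nonneg S) h.phi_le 2

theorem Valid.pieceMean_le_of_output (h : Valid S D T v) (hD : 0 < D) (hv : 0 < v) (hc : 6 ≤ c)
    (J J' i : ℕ) : pieceMean S J J' (cut (c ^ 2 * D ^ 2 * v) (i + 1))
      (cut (c ^ 2 * D ^ 2 * v) (i + 2)) ≤ 2 * S.mean / (3 ^ i * c ^ 2) := by
  have hμ := mean_nonneg S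
  have hx : 0 < c ^ 2 * D ^ 2 * v := by positivity
  refine (pieceMean_le_sum_large S _ _ _ _).trans ?_
  have hpos : 0 < cut (c ^ 2 * D ^ 2 * v) (i + 1) := (cut_nonneg hx.le i).trans_lt (cut_lt hx i)
  refine (sum_large_le S hpos).trans ?_
  rw [div_le_div_iff₀ hpos (by positivity)]
  simp only [cut]
  calc S.phi ^ 2 * (3 ^ i * c ^ 2) ≤ D ^ 2 * S.mean ^ 2 * (3 ^ i * c ^ 2) :=
        mul_le_mul_of_nonneg_right h.phi_sq_le (by positivity)
    _ = (3 ^ i * c ^ 2 * D ^ 2) * S.mean * S.mean := by ring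
    _ ≤ (3 ^ i * c ^ 2 * D ^ 2) * S.mean * (2 * v) :=
        mul_le_mul_of_nonneg_left h.mean_le (by positivity)
    _ = _ := by ring

theorem Valid.pieceMean_le_of_time (h : Valid S D T v) (hT : 0 < T) (hD : 0 < D) (hc : 6 ≤ c)
    (l J' : ℕ) (a b : ℝ) :
    pieceMean S (brackets S.sched (c * T) (l + 1)) J' a b ≤ D * S.mean / (3 ^ l * c) := by
  have hμ := mean_nonneg S
  have hpos : 0 < 3 ^ l * (c * T) := by positivity
  refine (pieceMean_le_sum_long S _ _ _ _).trans ((sum_long_le S hpos).trans ?_)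
  rw [div_le_div_iff₀ hpos (by positivity)]
  calc S.phi * S.Tl2 * (3 ^ l * c) ≤ (D * S.mean) * T * (3 ^ l * c) :=
        mul_le_mul_of_nonneg_right
          (mul_le_mul h.phi_le h.Tl2_le (Tl2_nonneg S) (by positivity)) (by positivity)
    _ = _ := by ring

/-- The contribution of a bracket decreases exponentially. -/
theorem Valid.pieceMean_le (h : Valid S D T v) (hT : 0 < T) (hD : 0 < D) (hv : 0 < v) (hc : 6 ≤ c)
    {d : ℕ} (hd : D ≤ 3 ^ d) (l i : ℕ) :
    pieceMean S (brackets S.sched (c * T) l) (brackets S.sched (c * T) (l + 1))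
      (cut (c ^ 2 * D ^ 2 * v) i) (cut (c ^ 2 * D ^ 2 * v) (i + 1)) ≤
      S.mean / 3 ^ (max l (i + d) - d) := by
  have hμ := mean_nonneg S
  -- If the output bracket dominates, the second moment gives the decay (for i = 0 none is needed).
  -- Otherwise the runs are longer than 3^(l−1)·cT; the tail bound loses a factor D ≤ 3^d, hence the
  -- exponent l − d.
  by_cases hl : l ≤ i + d
  · rw [max_eq_right hl, Nat.add_sub_cancel]
    cases i with
    | zero => simpa using pieceMean_le_mean S _ _ _ _
    | succ i =>
      refine (h.pieceMean_le_of_output hD hv hc _ _ i).trans ?_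
      rw [div_le_div_iff₀ (by positivity) (by positivity), pow_succ]
      have h1 : 0 ≤ S.mean * 3 ^ i := by positivity
      have h2 : 6 ≤ c ^ 2 := by nlinarith
      nlinarith [mul_le_mul_of_nonneg_left h2 h1]
  · obtain ⟨l, rfl⟩ : ∃ l', l = l' + 1 := ⟨l - 1, by omega⟩
    rw [max_eq_left (by omega)]
    refine (h.pieceMean_le_of_time hT hD hc l _ _ _).trans ?_
    rw [div_le_div_iff₀ (by positivity) (by positivity)]
    have h1 : (3 : ℝ) ^ l * 3 = 3 ^ d * 3 ^ (l + 1 - d) := by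
      rw [← pow_add, ← pow_succ]
      congr 1
      omega
    have h2 : D * 3 ^ (l + 1 - d) ≤ 3 ^ l * 3 := by
      rw [h1]
      exact mul_le_mul_of_nonneg_right hd (by positivity)
    have h3 : (3 : ℝ) ^ l * 3 ≤ 3 ^ l * c :=
      mul_le_mul_of_nonneg_left (by linarith) (by positivity)
    calc D * S.mean * 3 ^ (l + 1 - d) = S.mean * (D * 3 ^ (l + 1 - d)) := by ring
      _ ≤ S.mean * (3 ^ l * c) := mul_le_mul_of_nonneg_left (h2.trans h3) hμ

theorem levelWeight_nonneg (S : VarTimeSampler m G Ω) {U : ℝ} (hU : 0 ≤ U) {ν : ℝ}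
    (hν : 0 ≤ ν ∧ ν ≤ 1) (l : ℕ) {a b : ℝ} (hb : 0 ≤ b) (j : ℕ) :
    0 ≤ levelWeight S ν (brackets S.sched U) l a b j := by
  unfold levelWeight
  have h1 : 0 ≤ 1 - ν := by linarith [hν.2]
  split_ifs
  · exact add_nonneg (mul_nonneg hν.1 (contWeight_nonneg S (brackets_le _ _))) h1
  · rw [pieceProb_eq_pieceMean S (brackets_mono _ hU (Nat.le_succ l)) (brackets_le _ _)]
    exact add_nonneg (mul_nonneg hν.1 (div_nonneg (pieceMean_nonneg S _ _ _ _) hb)) h1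

/-- The weights of the levels are small enough for the amplification. -/
theorem Valid.levelWeight_le (h : Valid S D T v) (hT : 0 < T) (hD : 1 ≤ D) (hv : 0 < v) (hc : 6 ≤ c)
    {d : ℕ} (hd : 3 ^ d ≤ 3 * D) (l i j : ℕ) (hj : j < max l (i + d)) :
    9 ^ j * levelWeight S (1 - refProb c (max l (i + d))) (brackets S.sched (c * T)) l
      (cut (c ^ 2 * D ^ 2 * v) i) (cut (c ^ 2 * D ^ 2 * v) (i + 1)) j ≤ 3 / c ^ 2 := by
  have hμ := mean_nonneg S
  have hr0 := refProb_pos hc (max l (i + d))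
  have hr1 := refProb_le hc (max l (i + d))
  have hr : 9 ^ j * refProb c (max l (i + d)) ≤ 1 / c ^ 2 := by
    unfold refProb
    rw [mul_inv, ← mul_assoc, ← one_div (c ^ 2)]
    refine mul_le_of_le_one_left (by positivity) ?_
    rw [mul_inv_le_iff₀ (by positivity), one_mul]
    exact pow_le_pow_right₀ (by norm_num) hj.le
  -- With r the reference probability, a level weight has the form (1 − r)q + r. The budget 3/c² is
  -- split into 2/c² for q and 1/c² for r.
  have key : ∀ q : ℝ, 0 ≤ q → 9 ^ j * q ≤ 2 / c ^ 2 →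
      9 ^ j * ((1 - refProb c (max l (i + d))) * q + (1 - (1 - refProb c (max l (i + d))))) ≤
        3 / c ^ 2 := by
    intro q hq hq'
    have h1 : 9 ^ j * ((1 - refProb c (max l (i + d))) * q + (1 - (1 - refProb c (max l (i + d))))) =
        (9 ^ j * q) * (1 - refProb c (max l (i + d))) + 9 ^ j * refProb c (max l (i + d)) := by ring
    have h2 : (9 ^ j * q) * (1 - refProb c (max l (i + d))) ≤ 9 ^ j * q :=
      mul_le_of_le_one_right (by positivity) (by linarith)
    have h3 : 3 / c ^ 2 = 2 / c ^ 2 + 1 / c ^ 2 := by ring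
    rw [h1, h3]
    linarith
  unfold levelWeight
  split_ifs with hjl
  · refine key _ (contWeight_nonneg S (brackets_le _ _)) ?_
    have hpos : 0 < 3 ^ j * (c * T) := by positivity
    have h1 : contWeight S (brackets S.sched (c * T) (j + 1)) ≤ T ^ 2 / (3 ^ j * (c * T)) ^ 2 := by
      refine (contWeight_stepsBy_le S hpos).trans ?_
      exact div_le_div_of_nonneg_right (pow_le_pow_left₀ (Tl2_nonneg S) h.Tl2_le 2) (by positivity)
    calc 9 ^ j * contWeight S (brackets S.sched (c * T) (j + 1))
        ≤ 9 ^ j * (T ^ 2 / (3 ^ j * (c * T)) ^ 2) := mul_le_mul_of_nonneg_left h1 (by positivity)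
      _ = 1 / c ^ 2 := by
        have : (9 : ℝ) ^ j = (3 ^ j) ^ 2 := by rw [← pow_mul, mul_comm, pow_mul]; norm_num
        rw [this]
        field_simp
      _ ≤ 2 / c ^ 2 := by gcongr; norm_num
  · have hjd : j < i + d := by omega
    have hx : 0 < c ^ 2 * D ^ 2 * v := by positivity
    have hcut : 0 < cut (c ^ 2 * D ^ 2 * v) (i + 1) := (cut_nonneg hx.le i).trans_lt (cut_lt hx i)
    rw [pieceProb_eq_pieceMean S (brackets_mono _ (by positivity) (Nat.le_succ l)) (brackets_le _ _)]
    refine key _ (div_nonneg (pieceMean_nonneg S _ _ _ _) hcut.le) ?_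
    -- From j + 1 ≤ i + d and 3^d ≤ 3D. The factor D² is compensated by the one in the bracket end
    -- 3^i·c²D²v, by which the piece is divided.
    have h9 : (9 : ℝ) ^ j * 9 ≤ 9 ^ i * (9 * D ^ 2) := by
      rw [← pow_succ]
      refine (pow_le_pow_right₀ (by norm_num) (show j + 1 ≤ i + d by omega)).trans ?_
      rw [pow_add]
      refine mul_le_mul_of_nonneg_left ?_ (by positivity)
      have : (9 : ℝ) ^ d = (3 ^ d) ^ 2 := by rw [← pow_mul, mul_comm, pow_mul]; norm_num
      rw [this, show 9 * D ^ 2 = (3 * D) ^ 2 by ring]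
      exact pow_le_pow_left₀ (by positivity) hd 2
    have hmean : S.mean ≤ 2 * v := h.mean_le
    rw [mul_div_assoc', div_le_div_iff₀ hcut (by positivity)]
    -- The lowest output bracket is bounded by the whole mean, the higher ones by the second moment.
    cases i with
    | zero =>
      have h1 := pieceMean_le_mean S (brackets S.sched (c * T) l) (brackets S.sched (c * T) (l + 1))
        (cut (c ^ 2 * D ^ 2 * v) 0) (cut (c ^ 2 * D ^ 2 * v) (0 + 1))
      have h2 := pieceMean_nonneg S (brackets S.sched (c * T) l) (brackets S.sched (c * T) (l + 1))
        (cut (c ^ 2 * D ^ 2 * v) 0) (cut (c ^ 2 * D ^ 2 * v) (0 + 1))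
      calc _ ≤ D ^ 2 * (2 * v) * c ^ 2 := by
            refine mul_le_mul_of_nonneg_right ?_ (by positivity)
            refine mul_le_mul ?_ (h1.trans hmean) h2 (by positivity)
            rw [pow_zero] at h9
            linarith
        _ = _ := by simp only [cut]; ring
    | succ i =>
      have h1 := h.pieceMean_le_of_output (by linarith) hv hc (brackets S.sched (c * T) l)
        (brackets S.sched (c * T) (l + 1)) i
      have h2 := pieceMean_nonneg S (brackets S.sched (c * T) l) (brackets S.sched (c * T) (l + 1))
        (cut (c ^ 2 * D ^ 2 * v) (i + 1)) (cut (c ^ 2 * D ^ 2 * v) (i + 1 + 1))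
      have h3 : 2 * S.mean / (3 ^ i * c ^ 2) ≤ 4 * v / (3 ^ i * c ^ 2) :=
        div_le_div_of_nonneg_right (by linarith) (by positivity)
      calc _ ≤ 9 ^ (i + 1) * D ^ 2 * (4 * v / (3 ^ i * c ^ 2)) * c ^ 2 := by
            refine mul_le_mul_of_nonneg_right ?_ (by positivity)
            refine mul_le_mul ?_ (h1.trans h3) h2 (by positivity)
            linarith
        _ = 12 * (3 ^ (i + 1) * (D ^ 2 * v)) := by
            have : (9 : ℝ) ^ (i + 1) = 3 ^ (i + 1) * (3 ^ i * 3) := by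
              rw [← pow_succ, ← mul_pow]; norm_num
            rw [this]
            field_simp
            norm_num
        _ ≤ 2 * c ^ 2 * (3 ^ (i + 1) * (D ^ 2 * v)) := by
            refine mul_le_mul_of_nonneg_right ?_ (by positivity)
            nlinarith
        _ = _ := by simp only [cut]; ring

/-- The reference probability 1/(9^N·c²) is the inverse of the ideal gain squared, up to c². As the
gain is at least 3^N/2, the amplified reference has probability at least 1/(4c²), the threshold used
in `bracketProg`. -/
theorem Valid.gain_ge (h : Valid S D T v) (hT : 0 < T) (hD : 1 ≤ D) (hv : 0 < v) (hc : 6 ≤ c)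
    {d : ℕ} (hd : 3 ^ d ≤ 3 * D) (l i : ℕ) (hN : 8 * ((max l (i + d) : ℕ) : ℝ) ≤ c ^ 2) :
    1 / (4 * c ^ 2) ≤ gain (levelWeight S (1 - refProb c (max l (i + d))) (brackets S.sched (c * T)) l
      (cut (c ^ 2 * D ^ 2 * v) i) (cut (c ^ 2 * D ^ 2 * v) (i + 1))) (max l (i + d)) ^ 2 *
        (1 - (1 - refProb c (max l (i + d)))) := by
  have hr0 := refProb_pos hc (max l (i + d))
  have hr1 := refProb_le hc (max l (i + d))
  have hx : 0 < c ^ 2 * D ^ 2 * v := by positivity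
  have h1 := gain_bounds (w := levelWeight S (1 - refProb c (max l (i + d))) (brackets S.sched (c * T))
    l (cut (c ^ 2 * D ^ 2 * v) i) (cut (c ^ 2 * D ^ 2 * v) (i + 1))) (N := max l (i + d))
    (α := 3 / c ^ 2) (by
      rw [div_mul_eq_mul_div, mul_div_assoc', div_le_iff₀ (by positivity)]
      linarith) (by
      rw [div_le_iff₀ (by positivity)]
      nlinarith)
    (levelWeight_nonneg S (by positivity) ⟨by linarith, by linarith⟩ l (cut_nonneg hx.le _))
    (h.levelWeight_le hT hD hv hc hd l i)
  have h2 := pow_le_pow_left₀ (by positivity) h1 2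
  refine le_trans (le_of_eq ?_) (mul_le_mul_of_nonneg_right h2 (by linarith))
  have : (9 : ℝ) ^ max l (i + d) = (3 ^ max l (i + d)) ^ 2 := by
    rw [← pow_mul, mul_comm, pow_mul]; norm_num
  rw [sub_sub_cancel, refProb, this]
  field_simp
  norm_num

theorem exp_samples_le {lam η : ℝ} (hη : 0 < η) :
    4 * Real.exp (-((⌈4 * lam / η ^ 2⌉₊ : ℕ) * η ^ 2 / 4)) ≤ 4 * Real.exp (-lam) := by
  have h1 := Nat.le_ceil (4 * lam / η ^ 2)
  rw [div_le_iff₀ (by positivity)] at h1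
  have : Real.exp (-((⌈4 * lam / η ^ 2⌉₊ : ℕ) * η ^ 2 / 4)) ≤ Real.exp (-lam) :=
    Real.exp_le_exp.mpr (by linarith)
  linarith

/-- The relative error is 2η/κ = 8c²η with η = s·3^(N−d), where N = max(l, i + d). It multiplies the
piece and the scale bω of the reference, both of order 3^(−(N−d)), so the coarser accuracy at high
levels is compensated. Without `Valid` the decay of the piece is not available, and 8c²η ≤ 1/10
gives the factor 11/10 instead. -/
theorem holds_bracketProg (S : VarTimeSampler m G Ω) (hT : 0 < T) (hD : 1 ≤ D) (hv : 0 < v)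
    (hc : 6 ≤ c) {d : ℕ} (hd : D ≤ 3 ^ d) {s lam : ℝ} (hs : 0 < s) (hlam : 0 < lam) (l i : ℕ)
    (hη : 80 * c ^ 2 * (s * 3 ^ (max l (i + d) - d)) ≤ 1) :
    (bracketProg S.sched c T (c ^ 2 * D ^ 2 * v) s lam d l i).Holds S (fun y => 0 ≤ y ∧
      y ≤ 11 / 10 * pieceMean S (brackets S.sched (c * T) l) (brackets S.sched (c * T) (l + 1))
        (cut (c ^ 2 * D ^ 2 * v) i) (cut (c ^ 2 * D ^ 2 * v) (i + 1)) + 16 * c ^ 2 * s * v ∧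
      (Valid S D T v → 3 ^ d ≤ 3 * D → 8 * ((max l (i + d) : ℕ) : ℝ) ≤ c ^ 2 →
        pieceMean S (brackets S.sched (c * T) l) (brackets S.sched (c * T) (l + 1))
          (cut (c ^ 2 * D ^ 2 * v) i) (cut (c ^ 2 * D ^ 2 * v) (i + 1)) -
            8 * c ^ 2 * s * (2 * v + S.mean) ≤ y ∧
        y ≤ pieceMean S (brackets S.sched (c * T) l) (brackets S.sched (c * T) (l + 1))
          (cut (c ^ 2 * D ^ 2 * v) i) (cut (c ^ 2 * D ^ 2 * v) (i + 1)) +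
            8 * c ^ 2 * s * (2 * v + S.mean))) (4 * Real.exp (-lam)) := by
  have hr0 := refProb_pos hc (max l (i + d))
  have hr1 := refProb_le hc (max l (i + d))
  have hx : 0 < c ^ 2 * D ^ 2 * v := by positivity
  have hcond : (0 ≤ 1 - refProb c (max l (i + d)) ∧ 1 - refProb c (max l (i + d)) ≤ 1) ∧
      (0 ≤ cut (c ^ 2 * D ^ 2 * v) i ∧ cut (c ^ 2 * D ^ 2 * v) i < cut (c ^ 2 * D ^ 2 * v) (i + 1)) :=
    ⟨⟨by linarith, by linarith⟩, cut_nonneg hx.le i, cut_lt hx i⟩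
  set η := s * 3 ^ (max l (i + d) - d) with hηdef
  have hη0 : 0 < η := by positivity
  have hη1 : η ≤ 1 := by
    have : η ≤ 80 * c ^ 2 * η := le_mul_of_one_le_left hη0.le (by nlinarith)
    linarith
  have hηκ : η ≤ 1 / (4 * c ^ 2) / 2 := by
    rw [div_div, le_div_iff₀ (by positivity)]
    nlinarith
  rw [bracketProg, dif_pos hcond]
  have hn : 0 < ⌈4 * lam / η ^ 2⌉₊ := Nat.ceil_pos.mpr (by positivity)
  refine (holds_pieceProg S (by positivity) hcond.1 (by linarith) (by positivity) l (max l (i + d))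
    (le_max_left _ _) _ _ hcond.2 hn hη0.le hη1 hηκ).mono ?_ (exp_samples_le hη0)
  set p := pieceMean S (brackets S.sched (c * T) l) (brackets S.sched (c * T) (l + 1))
    (cut (c ^ 2 * D ^ 2 * v) i) (cut (c ^ 2 * D ^ 2 * v) (i + 1)) with hp
  have hp0 : 0 ≤ p := pieceMean_nonneg S _ _ _ _
  have hθ : 2 * η / (1 / (4 * c ^ 2)) = 8 * c ^ 2 * η := by field_simp; ring
  -- With r the reference probability, ω = r/(1 − r) ≤ 2r, so bω ≤ 2·3^i·D²·v/9^N. Then D² ≤ 9^d and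
  -- 3^i ≤ 3^(N−d). No assumption on the sampler enters.
  have hω : cut (c ^ 2 * D ^ 2 * v) (i + 1) * ((1 - (1 - refProb c (max l (i + d)))) /
      (1 - refProb c (max l (i + d)))) ≤ 2 * v / 3 ^ (max l (i + d) - d) := by
    have h1 : (1 - (1 - refProb c (max l (i + d)))) / (1 - refProb c (max l (i + d))) ≤
        2 * refProb c (max l (i + d)) := by
      rw [div_le_iff₀ (by linarith)]
      nlinarith
    refine (mul_le_mul_of_nonneg_left h1 (cut_nonneg hx.le _)).trans ?_
    rw [refProb, cut, ← div_eq_mul_inv, mul_div_assoc', div_le_div_iff₀ (by positivity) (by positivity)]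
    have h2 : (3 : ℝ) ^ i * D ^ 2 * 3 ^ (max l (i + d) - d) ≤ 9 ^ max l (i + d) := by
      have h3 : D ^ 2 ≤ 9 ^ d := by
        have : (9 : ℝ) ^ d = (3 ^ d) ^ 2 := by rw [← pow_mul, mul_comm, pow_mul]; norm_num
        rw [this]
        exact pow_le_pow_left₀ (by linarith) hd 2
      have h4 : (3 : ℝ) ^ i ≤ 3 ^ (max l (i + d) - d) :=
        pow_le_pow_right₀ (by norm_num) (by have := le_max_right l (i + d); omega)
      calc (3 : ℝ) ^ i * D ^ 2 * 3 ^ (max l (i + d) - d) ≤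
            3 ^ (max l (i + d) - d) * 9 ^ d * 3 ^ (max l (i + d) - d) := by gcongr
        _ = 9 ^ (max l (i + d) - d) * 9 ^ d := by
            rw [mul_right_comm, ← mul_pow]
            norm_num
        _ = 9 ^ max l (i + d) := by
            rw [← pow_add, Nat.sub_add_cancel]
            have := le_max_right l (i + d)
            omega
    calc 3 ^ i * (c ^ 2 * D ^ 2 * v) * 2 * 3 ^ (max l (i + d) - d) =
          (2 * v * c ^ 2) * (3 ^ i * D ^ 2 * 3 ^ (max l (i + d) - d)) := by ring
      _ ≤ (2 * v * c ^ 2) * 9 ^ max l (i + d) := mul_le_mul_of_nonneg_left h2 (by positivity)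
      _ = _ := by ring
  have herr : 8 * c ^ 2 * η * (2 * v / 3 ^ (max l (i + d) - d)) = 16 * c ^ 2 * s * v := by
    rw [hηdef]; field_simp; norm_num
  have hb := mul_le_mul_of_nonneg_left hω (show 0 ≤ 8 * c ^ 2 * η by positivity)
  rw [herr] at hb
  intro y hy
  rw [hθ] at hy
  obtain ⟨hy0, hy1, hy2⟩ := hy
  rw [mul_add] at hy1 hy2
  refine ⟨hy0, ?_, fun hV hd' hN => ?_⟩
  · nlinarith
  · have hpm := hV.pieceMean_le hT (by linarith) hv hc hd l i
    rw [← hp] at hpm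
    have hpe : 8 * c ^ 2 * η * p ≤ 8 * c ^ 2 * s * S.mean := by
      refine (mul_le_mul_of_nonneg_left hpm (by positivity)).trans (le_of_eq ?_)
      rw [hηdef]; field_simp
    have := hy2 (hV.gain_ge hT hD hv hc hd' l i hN)
    constructor <;> nlinarith

end Estimate

/-! ## The estimator at a given scale -/

/-- The number of brackets of outputs. -/
def numOut (ε : ℝ) : ℕ := Nat.clog 3 ⌈12 / ε⌉₊ + 1

/-- The number of brackets of times. -/
def numTime (Δ : ℕ) (ε : ℝ) : ℕ := Nat.clog 3 Δ + numOut ε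

/-- The accuracy of the frequencies in the estimator. -/
def sampleAcc (Δ : ℕ) (ε : ℝ) : ℝ :=
  ε / (3200 * (numTime Δ ε * numOut ε) * (6 * numTime Δ ε) ^ 2)

/-- Estimate the mean if it is comparable to `v`. -/
def estProg {m : ℕ} (σ : Schedule m) (Δ : ℕ) (T v ε δ : ℝ) : Prog m ℝ :=
  Prog.sum (fun l => Prog.sum (fun i => bracketProg σ (6 * numTime Δ ε) T
    ((6 * numTime Δ ε) ^ 2 * Δ ^ 2 * v) (sampleAcc Δ ε)
    (Real.log (4 * (numTime Δ ε * numOut ε) / δ)) (Nat.clog 3 Δ) l i) (numOut ε)) (numTime Δ ε)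

theorem one_le_numOut (ε : ℝ) : 1 ≤ numOut ε := Nat.le_add_left 1 _

theorem numOut_le_numTime (Δ : ℕ) (ε : ℝ) : numOut ε ≤ numTime Δ ε := Nat.le_add_left _ _

theorem one_le_numTime (Δ : ℕ) (ε : ℝ) : 1 ≤ numTime Δ ε :=
  (one_le_numOut ε).trans (numOut_le_numTime Δ ε)

theorem pow_clog_le {n : ℕ} (hn : 1 ≤ n) : 3 ^ Nat.clog 3 n ≤ 3 * n := by
  rcases hn.eq_or_lt with rfl | h
  · simp
  · have h1 := Nat.pow_pred_clog_lt_self (b := 3) (by norm_num) h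
    have h2 : 0 < Nat.clog 3 n := Nat.clog_pos (by norm_num) h
    obtain ⟨k, hk⟩ : ∃ k, Nat.clog 3 n = k + 1 := ⟨Nat.clog 3 n - 1, by omega⟩
    rw [hk, Nat.pred_succ] at h1
    rw [hk, pow_succ]
    omega

theorem pow_numOut_le {ε : ℝ} (h0 : 0 < ε) (h1 : ε < 1) : (3 : ℝ) ^ (numOut ε - 1) ≤ 39 / ε := by
  have h2 : 1 ≤ ⌈12 / ε⌉₊ := Nat.one_le_ceil_iff.mpr (by positivity)
  have h3 : ((3 ^ Nat.clog 3 ⌈12 / ε⌉₊ : ℕ) : ℝ) ≤ ((3 * ⌈12 / ε⌉₊ : ℕ) : ℝ) := by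
    exact_mod_cast pow_clog_le h2
  have h4 := (Nat.ceil_lt_add_one (show 0 ≤ 12 / ε by positivity)).le
  push_cast at h3
  rw [numOut, Nat.add_sub_cancel]
  refine h3.trans ?_
  have h5 : 1 ≤ 1 / ε := by rw [le_div_iff₀ h0]; linarith
  have h6 : 12 / ε = 12 * (1 / ε) := by ring
  have h7 : 39 / ε = 39 * (1 / ε) := by ring
  linarith

theorem le_pow_numOut (ε : ℝ) : 12 / ε ≤ (3 : ℝ) ^ (numOut ε - 1) := by
  refine (Nat.le_ceil _).trans ?_
  rw [numOut, Nat.add_sub_cancel]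
  exact_mod_cast Nat.le_pow_clog (by norm_num) _

theorem sampleAcc_pos (Δ : ℕ) {ε : ℝ} (h0 : 0 < ε) : 0 < sampleAcc Δ ε := by
  have h1 : (0 : ℝ) < numOut ε := by exact_mod_cast one_le_numOut ε
  have h2 : (0 : ℝ) < numTime Δ ε := by exact_mod_cast one_le_numTime Δ ε
  unfold sampleAcc
  positivity

theorem le_log_samples (Δ : ℕ) {ε δ : ℝ} (hδ : 0 < δ) (hδ1 : δ ≤ 1) :
    1 ≤ Real.log (4 * (numTime Δ ε * numOut ε) / δ) := by
  have h1 : (1 : ℝ) ≤ numOut ε := by exact_mod_cast one_le_numOut ε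
  have h2 : (1 : ℝ) ≤ numTime Δ ε := by exact_mod_cast one_le_numTime Δ ε
  rw [Real.le_log_iff_exp_le (by positivity), le_div_iff₀ hδ]
  have h3 := Real.exp_one_lt_d9
  have h4 := Real.exp_pos 1
  nlinarith

section Holds

variable {m : ℕ} {G : Type u} [Fintype G] [DecidableEq G] {Ω : Finset ℝ≥0}
  (S : VarTimeSampler m G Ω) {Δ : ℕ} {T v ε δ : ℝ}

theorem holds_estProg_aux (hv : 0 < v) (hT : 0 < T) (hΔ : 1 ≤ Δ)
    (hδ : 0 < δ) (A B η : ℝ)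
    (h : ∀ l < numTime Δ ε, ∀ i < numOut ε, (bracketProg S.sched (6 * numTime Δ ε) T
      ((6 * numTime Δ ε) ^ 2 * Δ ^ 2 * v) (sampleAcc Δ ε)
      (Real.log (4 * (numTime Δ ε * numOut ε) / δ)) (Nat.clog 3 Δ) l i).Holds S (fun y =>
        A * pieceMean S (brackets S.sched (6 * numTime Δ ε * T) l)
          (brackets S.sched (6 * numTime Δ ε * T) (l + 1))
          (cut ((6 * numTime Δ ε) ^ 2 * Δ ^ 2 * v) i)
          (cut ((6 * numTime Δ ε) ^ 2 * Δ ^ 2 * v) (i + 1)) - η ≤ y ∧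
        y ≤ B * pieceMean S (brackets S.sched (6 * numTime Δ ε * T) l)
          (brackets S.sched (6 * numTime Δ ε * T) (l + 1))
          (cut ((6 * numTime Δ ε) ^ 2 * Δ ^ 2 * v) i)
          (cut ((6 * numTime Δ ε) ^ 2 * Δ ^ 2 * v) (i + 1)) + η)
      (4 * Real.exp (-Real.log (4 * (numTime Δ ε * numOut ε) / δ)))) :
    (estProg S.sched Δ T v ε δ).Holds S (fun y =>
      A * pieceMean S 0 (brackets S.sched (6 * numTime Δ ε * T) (numTime Δ ε)) 0
        (cut ((6 * numTime Δ ε) ^ 2 * Δ ^ 2 * v) (numOut ε)) - numTime Δ ε * numOut ε * η ≤ y ∧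
      y ≤ B * pieceMean S 0 (brackets S.sched (6 * numTime Δ ε * T) (numTime Δ ε)) 0
        (cut ((6 * numTime Δ ε) ^ 2 * Δ ^ 2 * v) (numOut ε)) + numTime Δ ε * numOut ε * η) δ := by
  have h1 : (0 : ℝ) < numOut ε := by exact_mod_cast one_le_numOut ε
  have h2 : (0 : ℝ) < numTime Δ ε := by exact_mod_cast one_le_numTime Δ ε
  have h3 : (0 : ℝ) < Δ := by exact_mod_cast hΔ
  have hx : 0 < (6 * (numTime Δ ε : ℝ)) ^ 2 * Δ ^ 2 * v := by positivity
  have hf0 : 0 ≤ 4 * Real.exp (-Real.log (4 * (numTime Δ ε * numOut ε) / δ)) := by positivity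
  have hcut : Monotone (cut ((6 * (numTime Δ ε : ℝ)) ^ 2 * Δ ^ 2 * v)) :=
    monotone_nat_of_le_succ fun i => (cut_lt hx i).le
  have hsum := fun C => sum_pieceMean_steps S (brackets_mono S.sched
    (show 0 ≤ 6 * (numTime Δ ε : ℝ) * T by positivity)) rfl 0
    (cut ((6 * (numTime Δ ε : ℝ)) ^ 2 * Δ ^ 2 * v) C) (numTime Δ ε)
  refine (Prog.holds_sum (mul_nonneg h1.le hf0) fun l hl => Prog.holds_sum hf0 (h l hl)).mono ?_ ?_
  · intro y hy
    simp only [Finset.sum_sub_distrib, Finset.sum_add_distrib, ← Finset.mul_sum,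
      sum_pieceMean_outputs S hcut rfl, hsum, Finset.sum_const, Finset.card_range, nsmul_eq_mul] at hy
    constructor <;> linarith [hy.1, hy.2]
  · rw [Real.exp_neg, Real.exp_log (by positivity)]
    refine le_of_eq ?_
    field_simp

theorem holds_estProg (hΔ : 1 ≤ Δ) (hT : 0 < T) (hv : 0 < v) (hε : 0 < ε) (hε1 : ε < 1) (hδ : 0 < δ)
    (hδ1 : δ ≤ 1) :
    (estProg S.sched Δ T v ε δ).Holds S (fun y => y ≤ 11 / 10 * S.mean + ε * v / 200 ∧
      (Valid S Δ T v → |y - S.mean| ≤ ε * (2 * v + S.mean) / 400 + ε * S.mean / 6)) δ := by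
  have h1 : (1 : ℝ) ≤ numOut ε := by exact_mod_cast one_le_numOut ε
  have h2 : (1 : ℝ) ≤ numTime Δ ε := by exact_mod_cast one_le_numTime Δ ε
  have hD : (1 : ℝ) ≤ Δ := by exact_mod_cast hΔ
  have hc : 6 ≤ 6 * (numTime Δ ε : ℝ) := by linarith
  have hs := sampleAcc_pos Δ hε
  have hlam := zero_lt_one.trans_le (le_log_samples Δ (ε := ε) hδ hδ1)
  have hd : (Δ : ℝ) ≤ 3 ^ Nat.clog 3 Δ := by exact_mod_cast Nat.le_pow_clog (by norm_num) Δ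
  have hd' : (3 : ℝ) ^ Nat.clog 3 Δ ≤ 3 * Δ := by exact_mod_cast pow_clog_le hΔ
  -- The accuracy contains the inverse number of pieces, so the errors 8c²s(2v + μ) add up to ε(2v +
  -- μ)/400, and the errors 16c²sv to εv/200.
  have hsc : (6 * (numTime Δ ε : ℝ)) ^ 2 * sampleAcc Δ ε =
      ε / (3200 * (numTime Δ ε * numOut ε)) := by
    unfold sampleAcc; field_simp
  -- The exponent is at most `numOut ε - 1`, so the power is at most 39/ε. The constant 3200 makes
  -- 80·39/3200 less than 1.
  have hη : ∀ l < numTime Δ ε, ∀ i < numOut ε, 80 * (6 * (numTime Δ ε : ℝ)) ^ 2 *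
      (sampleAcc Δ ε * 3 ^ (max l (i + Nat.clog 3 Δ) - Nat.clog 3 Δ)) ≤ 1 := by
    intro l hl i hi
    have h3 : (3 : ℝ) ^ (max l (i + Nat.clog 3 Δ) - Nat.clog 3 Δ) ≤ 39 / ε := by
      refine le_trans (pow_le_pow_right₀ (by norm_num) ?_) (pow_numOut_le hε hε1)
      unfold numTime at hl
      rcases max_cases l (i + Nat.clog 3 Δ) with h | h <;> omega
    calc _ = 80 * ((6 * (numTime Δ ε : ℝ)) ^ 2 * sampleAcc Δ ε) *
          3 ^ (max l (i + Nat.clog 3 Δ) - Nat.clog 3 Δ) := by ring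
      _ ≤ 80 * (ε / (3200 * (numTime Δ ε * numOut ε))) * (39 / ε) := by
        rw [hsc]; exact mul_le_mul_of_nonneg_left h3 (by positivity)
      _ = 39 / 40 / (numTime Δ ε * numOut ε) := by field_simp; norm_num
      _ ≤ 1 := by
        rw [div_le_one (by positivity)]
        nlinarith
  have hb := fun l hl i hi => holds_bracketProg (c := 6 * (numTime Δ ε : ℝ)) S hT hD hv hc hd hs hlam l i
    (hη l hl i hi)
  by_cases hV : Valid S Δ T v
  · have haux := holds_estProg_aux S hv hT hΔ hδ 1 1
      (8 * (6 * (numTime Δ ε : ℝ)) ^ 2 * sampleAcc Δ ε * (2 * v + S.mean)) (ε := ε) (by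
        intro l hl i hi
        refine (hb l hl i hi).mono ?_ le_rfl
        rintro y ⟨-, -, hy⟩
        rw [one_mul]
        refine hy hV hd' ?_
        have : ((max l (i + Nat.clog 3 Δ) : ℕ) : ℝ) ≤ numTime Δ ε := by
          have : max l (i + Nat.clog 3 Δ) ≤ numTime Δ ε := by
            unfold numTime at hl ⊢
            rcases max_cases l (i + Nat.clog 3 Δ) with h | h <;> omega
          exact_mod_cast this
        nlinarith)
    refine haux.mono ?_ le_rfl
    have hμ := mean_nonneg S
    have hle := pieceMean_le_mean S 0 (brackets S.sched (6 * numTime Δ ε * T) (numTime Δ ε)) 0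
        (cut ((6 * numTime Δ ε) ^ 2 * Δ ^ 2 * v) (numOut ε))
    have herr : numTime Δ ε * numOut ε * (8 * (6 * (numTime Δ ε : ℝ)) ^ 2 * sampleAcc Δ ε *
        (2 * v + S.mean)) = ε * (2 * v + S.mean) / 400 := by
      calc _ = 8 * (numTime Δ ε * numOut ε) * ((6 * (numTime Δ ε : ℝ)) ^ 2 * sampleAcc Δ ε) *
            (2 * v + S.mean) := by ring
        _ = _ := by rw [hsc]; field_simp; norm_num
    -- Truncation in time and in output each lose at most μ·3^(−(numOut − 1)) ≤ με/12. This is the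
    -- origin of the 12 in `numOut`.
    have htail : S.mean ≤ pieceMean S 0 (brackets S.sched (6 * numTime Δ ε * T) (numTime Δ ε)) 0
        (cut ((6 * numTime Δ ε) ^ 2 * Δ ^ 2 * v) (numOut ε)) + ε * S.mean / 6 := by
      have hE : 1 / (3 : ℝ) ^ (numOut ε - 1) ≤ ε / 12 := by
        rw [div_le_div_iff₀ (by positivity) (by norm_num)]
        have := le_pow_numOut ε
        rw [div_le_iff₀ hε] at this
        linarith
      have hx : 0 < (6 * (numTime Δ ε : ℝ)) ^ 2 * Δ ^ 2 * v := by positivity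
      have hL : numTime Δ ε = (Nat.clog 3 Δ + (numOut ε - 1)) + 1 := by
        have := one_le_numOut ε
        unfold numTime
        omega
      have hO : numOut ε = (numOut ε - 1) + 1 := by
        have := one_le_numOut ε
        omega
      have hJ : brackets S.sched (6 * numTime Δ ε * T) (numTime Δ ε) =
          S.sched.stepsBy (3 ^ (Nat.clog 3 Δ + (numOut ε - 1)) * (6 * numTime Δ ε * T)) := by
        conv_lhs => rw [show brackets S.sched (6 * numTime Δ ε * T) (numTime Δ ε) =
          brackets S.sched (6 * numTime Δ ε * T) ((Nat.clog 3 Δ + (numOut ε - 1)) + 1) from by rw [← hL]]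
        rfl
      have hC : cut ((6 * (numTime Δ ε : ℝ)) ^ 2 * Δ ^ 2 * v) (numOut ε) =
          3 ^ (numOut ε - 1) * ((6 * (numTime Δ ε : ℝ)) ^ 2 * Δ ^ 2 * v) := by
        conv_lhs => rw [hO]
        rfl
      rw [hJ, hC]
      refine (mean_le_pieceMean_add S (t := 3 ^ (Nat.clog 3 Δ + (numOut ε - 1)) *
        (6 * numTime Δ ε * T)) (b := 3 ^ (numOut ε - 1) * ((6 * (numTime Δ ε : ℝ)) ^ 2 * Δ ^ 2 * v))
        (by positivity) (by positivity)).trans ?_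
      have t1 : S.phi * S.Tl2 / (3 ^ (Nat.clog 3 Δ + (numOut ε - 1)) * (6 * numTime Δ ε * T)) ≤
          S.mean * (1 / 3 ^ (numOut ε - 1)) := by
        rw [mul_one_div, div_le_div_iff₀ (by positivity) (by positivity), pow_add]
        calc S.phi * S.Tl2 * 3 ^ (numOut ε - 1) ≤ (Δ * S.mean) * T * 3 ^ (numOut ε - 1) :=
              mul_le_mul_of_nonneg_right
                (mul_le_mul hV.phi_le hV.Tl2_le (Tl2_nonneg S) (by positivity)) (by positivity)
          _ ≤ (3 ^ Nat.clog 3 Δ * (6 * numTime Δ ε) * S.mean) * T * 3 ^ (numOut ε - 1) := by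
              gcongr
              nlinarith
          _ = _ := by ring
      have t2 : S.phi ^ 2 / (3 ^ (numOut ε - 1) * ((6 * (numTime Δ ε : ℝ)) ^ 2 * Δ ^ 2 * v)) ≤
          S.mean * (1 / 3 ^ (numOut ε - 1)) := by
        rw [mul_one_div, div_le_div_iff₀ (by positivity) (by positivity)]
        have h6 : 2 ≤ (6 * (numTime Δ ε : ℝ)) ^ 2 := by nlinarith
        calc S.phi ^ 2 * 3 ^ (numOut ε - 1) ≤ Δ ^ 2 * S.mean ^ 2 * 3 ^ (numOut ε - 1) :=
              mul_le_mul_of_nonneg_right hV.phi_sq_le (by positivity)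
          _ = Δ ^ 2 * 3 ^ (numOut ε - 1) * S.mean * S.mean := by ring
          _ ≤ Δ ^ 2 * 3 ^ (numOut ε - 1) * S.mean * (2 * v) :=
              mul_le_mul_of_nonneg_left hV.mean_le (by positivity)
          _ = S.mean * (3 ^ (numOut ε - 1) * (2 * Δ ^ 2 * v)) := by ring
          _ ≤ _ := by gcongr
      have t3 := mul_le_mul_of_nonneg_left hE hμ
      linarith
    rintro y ⟨hy1, hy2⟩
    rw [herr, one_mul] at hy1 hy2
    refine ⟨?_, fun _ => abs_le.mpr ⟨by linarith, ?_⟩⟩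
    · nlinarith
    · have : 0 ≤ ε * S.mean / 6 := by positivity
      linarith
  -- Without `Valid` only the upper bound matters; the coefficient 0 reduces the lower bound to a
  -- consequence of y ≥ 0.
  · have haux := holds_estProg_aux S hv hT hΔ hδ 0 (11 / 10)
      (16 * (6 * (numTime Δ ε : ℝ)) ^ 2 * sampleAcc Δ ε * v) (ε := ε) (by
        intro l hl i hi
        refine (hb l hl i hi).mono ?_ le_rfl
        rintro y ⟨hy0, hy1, -⟩
        refine ⟨?_, hy1⟩
        rw [zero_mul]
        have : 0 ≤ 16 * (6 * (numTime Δ ε : ℝ)) ^ 2 * sampleAcc Δ ε * v := by positivity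
        linarith)
    refine haux.mono ?_ le_rfl
    have hle := pieceMean_le_mean S 0 (brackets S.sched (6 * numTime Δ ε * T) (numTime Δ ε)) 0
        (cut ((6 * numTime Δ ε) ^ 2 * Δ ^ 2 * v) (numOut ε))
    have herr : numTime Δ ε * numOut ε * (16 * (6 * (numTime Δ ε : ℝ)) ^ 2 * sampleAcc Δ ε * v) =
        ε * v / 200 := by
      calc _ = 16 * (numTime Δ ε * numOut ε) * ((6 * (numTime Δ ε : ℝ)) ^ 2 * sampleAcc Δ ε) *
            v := by ring
        _ = _ := by rw [hsc]; field_simp; norm_num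
    rintro y ⟨-, hy⟩
    rw [herr] at hy
    exact ⟨by linarith, fun h => absurd h hV⟩

end Holds

theorem log_samples_le (Δ : ℕ) {ε δ : ℝ} (hδ : 0 < δ) (hδ1 : δ ≤ 1) :
    Real.log (4 * (numTime Δ ε * numOut ε) / δ) ≤ 2 * numTime Δ ε * (1 + Real.log (1 / δ)) := by
  have h1 : (1 : ℝ) ≤ numOut ε := by exact_mod_cast one_le_numOut ε
  have h2 : (1 : ℝ) ≤ numTime Δ ε := by exact_mod_cast one_le_numTime Δ ε
  have h3 : (numOut ε : ℝ) ≤ numTime Δ ε := by exact_mod_cast numOut_le_numTime Δ ε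
  have h4 : 0 ≤ Real.log (1 / δ) := Real.log_nonneg (by rw [le_div_iff₀ hδ]; linarith)
  have h5 : Real.log (4 * (numTime Δ ε * numOut ε) / δ) ≤
      Real.log ((2 * numTime Δ ε) ^ 2 * (1 / δ)) := by
    refine Real.log_le_log (by positivity) ?_
    rw [mul_one_div]
    refine div_le_div_of_nonneg_right ?_ hδ.le
    nlinarith
  rw [Real.log_mul (by positivity) (by positivity), Real.log_pow, Real.log_mul (by norm_num)
    (by positivity)] at h5
  have h6 := Real.log_le_sub_one_of_pos (show (0 : ℝ) < numTime Δ ε by linarith)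
  have h7 := Real.log_two_lt_d9
  push_cast at h5
  nlinarith

/-- A piece takes about λ/(s·q)² samples with q = 3^(N−d), on circuits of cost about q·3^d·T. As 3^d
≤ 3Δ and q ≥ 1, every piece costs at most about ΔTλ/s². The 13 powers of `numTime` are 2 from the
number of pieces, 1 from λ, 8 from s⁻² and 2 from the circuit cost. -/
theorem time_estProg {m : ℕ} (σ : Schedule m) {Δ : ℕ} {T : ℝ} (v : ℝ) {ε δ : ℝ} (hΔ : 1 ≤ Δ)
    (hT : 1 ≤ T) (hε : 0 < ε) (hε1 : ε < 1) (hδ : 0 < δ) (hδ1 : δ ≤ 1) :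
    ((estProg σ Δ T v ε δ).time σ : ℝ) ≤
      10 ^ 14 * (Δ * T * ε⁻¹ ^ 2 * numTime Δ ε ^ 13 * (1 + Real.log (1 / δ))) := by
  have h1 : (1 : ℝ) ≤ numOut ε := by exact_mod_cast one_le_numOut ε
  have h2 : (1 : ℝ) ≤ numTime Δ ε := by exact_mod_cast one_le_numTime Δ ε
  have h3 : (numOut ε : ℝ) ≤ numTime Δ ε := by exact_mod_cast numOut_le_numTime Δ ε
  have hD : (1 : ℝ) ≤ Δ := by exact_mod_cast hΔ
  have hs := sampleAcc_pos Δ hε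
  have hlam1 := le_log_samples Δ (ε := ε) hδ hδ1
  have hlam := log_samples_le Δ (ε := ε) hδ hδ1
  have hd' : (3 : ℝ) ^ Nat.clog 3 Δ ≤ 3 * Δ := by exact_mod_cast pow_clog_le hΔ
  have h4 : 0 ≤ Real.log (1 / δ) := Real.log_nonneg (by rw [le_div_iff₀ hδ]; linarith)
  set P : ℝ := (numTime Δ ε : ℝ) with hP
  set lam := Real.log (4 * (P * numOut ε) / δ) with hlamdef
  set s := sampleAcc Δ ε with hsdef
  have hsinv : 1 / s = 3200 * (P * numOut ε) * (6 * P) ^ 2 / ε := by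
    rw [hsdef, sampleAcc, one_div_div]
  have hεinv : 1 ≤ 1 / ε := by rw [le_div_iff₀ hε]; linarith
  have hsinv1 : 39 / ε ≤ 1 / s := by
    rw [hsinv]
    refine div_le_div_of_nonneg_right ?_ hε.le
    have : 1 ≤ P * numOut ε := by nlinarith
    nlinarith
  have hs1 : 1 ≤ 1 / s := by
    have : 39 / ε = 39 * (1 / ε) := by ring
    linarith
  have hsinv2 : (1 / s) ^ 2 ≤ 13271040000 * P ^ 8 * ε⁻¹ ^ 2 := by
    have : 1 / s ≤ 115200 * P ^ 4 * ε⁻¹ := by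
      rw [hsinv, div_eq_mul_inv]
      refine mul_le_mul_of_nonneg_right ?_ (by positivity)
      calc 3200 * (P * numOut ε) * (6 * P) ^ 2 ≤ 3200 * (P * P) * (6 * P) ^ 2 := by gcongr
        _ = _ := by ring
    calc (1 / s) ^ 2 ≤ (115200 * P ^ 4 * ε⁻¹) ^ 2 := pow_le_pow_left₀ (by positivity) this 2
      _ = _ := by ring
  have hpiece : ∀ l < numTime Δ ε, ∀ i < numOut ε, ((bracketProg σ (6 * P) T
      ((6 * P) ^ 2 * Δ ^ 2 * v) s lam (Nat.clog 3 Δ) l i).time σ : ℝ) ≤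
        15 * lam * (1 / s) ^ 2 * Δ * (28 * P * (6 * P * T)) := by
    intro l hl i hi
    have hN : max l (i + Nat.clog 3 Δ) + 1 ≤ numTime Δ ε := by
      unfold numTime at hl ⊢
      rcases max_cases l (i + Nat.clog 3 Δ) with h | h <;> omega
    have hNP : ((max l (i + Nat.clog 3 Δ) : ℕ) : ℝ) + 1 ≤ P := by rw [hP]; exact_mod_cast hN
    have h5 : (3 : ℝ) ^ (max l (i + Nat.clog 3 Δ) - Nat.clog 3 Δ) ≤ 39 / ε := by
      refine le_trans (pow_le_pow_right₀ (by norm_num) ?_) (pow_numOut_le hε hε1)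
      unfold numTime at hl
      rcases max_cases l (i + Nat.clog 3 Δ) with h | h <;> omega
    have h6 : (3 : ℝ) ^ max l (i + Nat.clog 3 Δ) =
        3 ^ (max l (i + Nat.clog 3 Δ) - Nat.clog 3 Δ) * 3 ^ Nat.clog 3 Δ := by
      rw [← pow_add, Nat.sub_add_cancel]
      have := le_max_right l (i + Nat.clog 3 Δ)
      omega
    refine (time_bracketProg σ (by nlinarith) (Nat.clog 3 Δ) l i).trans ?_
    set q : ℝ := 3 ^ (max l (i + Nat.clog 3 Δ) - Nat.clog 3 Δ) with hq
    have hq1 : 1 ≤ q := one_le_pow₀ (by norm_num)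
    have h7 := (Nat.ceil_lt_add_one (show 0 ≤ 4 * lam / (s * q) ^ 2 by positivity)).le
    -- Rounding up adds q, which is at most 39/ε ≤ 1/s ≤ λ/s².
    have h8 : (⌈4 * lam / (s * q) ^ 2⌉₊ : ℝ) * q ≤ 5 * lam * (1 / s) ^ 2 := by
      have h9 : 4 * lam / (s * q) ^ 2 * q ≤ 4 * lam * (1 / s) ^ 2 := by
        rw [div_mul_eq_mul_div, div_le_iff₀ (by positivity)]
        calc 4 * lam * q ≤ 4 * lam * q ^ 2 :=
              mul_le_mul_of_nonneg_left (by nlinarith) (by positivity)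
          _ = _ := by field_simp
      have h10 : q ≤ lam * (1 / s) ^ 2 := by nlinarith [h5.trans hsinv1]
      have := mul_le_mul_of_nonneg_right h7 (zero_le_one.trans hq1)
      linarith
    calc _ = (⌈4 * lam / (s * q) ^ 2⌉₊ * q) * 3 ^ Nat.clog 3 Δ *
          (28 * (((max l (i + Nat.clog 3 Δ) : ℕ) : ℝ) + 1) * (6 * P * T)) := by rw [h6]; ring
      _ ≤ (5 * lam * (1 / s) ^ 2) * (3 * Δ) * (28 * P * (6 * P * T)) := by gcongr
      _ = _ := by ring
  have hsum : ((estProg σ Δ T v ε δ).time σ : ℝ) ≤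
      P * (numOut ε * (15 * lam * (1 / s) ^ 2 * Δ * (28 * P * (6 * P * T)))) := by
    have h5 : ((estProg σ Δ T v ε δ).time σ : ℝ) ≤ ∑ l ∈ Finset.range (numTime Δ ε),
        ∑ i ∈ Finset.range (numOut ε), ((bracketProg σ (6 * P) T
          ((6 * P) ^ 2 * Δ ^ 2 * v) s lam (Nat.clog 3 Δ) l i).time σ : ℝ) := by
      have h6 : (estProg σ Δ T v ε δ).time σ ≤ ∑ l ∈ Finset.range (numTime Δ ε),
          ∑ i ∈ Finset.range (numOut ε), (bracketProg σ (6 * P) T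
            ((6 * P) ^ 2 * Δ ^ 2 * v) s lam (Nat.clog 3 Δ) l i).time σ :=
        (Prog.time_sum_le σ _ _).trans (Finset.sum_le_sum fun l _ => Prog.time_sum_le σ _ _)
      refine (Nat.cast_le.mpr h6).trans_eq ?_
      simp only [Nat.cast_sum]
    refine h5.trans ?_
    rw [hP, ← nsmul_eq_mul, ← nsmul_eq_mul]
    refine (Finset.sum_le_card_nsmul _ _ _ fun l hl => Finset.sum_le_card_nsmul _ _ _ fun i hi =>
      hpiece l (Finset.mem_range.mp hl) i (Finset.mem_range.mp hi)).trans (le_of_eq ?_)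
    rw [Finset.card_range, Finset.card_range]
  refine hsum.trans ?_
  calc P * (numOut ε * (15 * lam * (1 / s) ^ 2 * Δ * (28 * P * (6 * P * T)))) ≤
        P * (P * (15 * (2 * P * (1 + Real.log (1 / δ))) * (13271040000 * P ^ 8 * ε⁻¹ ^ 2) * Δ *
          (28 * P * (6 * P * T)))) := by gcongr
    _ = (15 * 2 * 13271040000 * 28 * 6) *
        (Δ * T * ε⁻¹ ^ 2 * P ^ 13 * (1 + Real.log (1 / δ))) := by ring
    _ ≤ _ := by
      refine mul_le_mul_of_nonneg_right (by norm_num) ?_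
      positivity

/-! ## The search for the scale of the mean -/

/-- Halve `v` until the estimate at scale `v` is large, then estimate with high accuracy. -/
def searchProg {m : ℕ} (σ : Schedule m) (Δ : ℕ) (T ε δ : ℝ) : ℕ → ℝ → Prog m ℝ
  | 0, _ => .ret 0
  | n + 1, v => (estProg σ Δ T v (1 / 2) δ).bind fun r =>
      if v / 2 ≤ r then estProg σ Δ T v ε δ else searchProg σ Δ T ε δ n (v / 2)

theorem time_searchProg_le {m : ℕ} (σ : Schedule m) (Δ : ℕ) (T ε δ : ℝ) {B B' : ℕ}
    (h : ∀ v, (estProg σ Δ T v (1 / 2) δ).time σ ≤ B) (h' : ∀ v, (estProg σ Δ T v ε δ).time σ ≤ B')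
    (n : ℕ) (v : ℝ) : (searchProg σ Δ T ε δ n v).time σ ≤ n * B + B' := by
  induction n generalizing v with
  | zero => simp [searchProg, Prog.time]
  | succ n ih =>
    rw [searchProg, Nat.succ_mul, add_right_comm, add_comm _ B]
    refine (Prog.time_bind_le σ _ _ (n * B + B') fun r => ?_).trans (Nat.add_le_add_right (h v) _)
    split_ifs
    · exact (h' v).trans (Nat.le_add_left _ _)
    · exact ih _

section Search

variable {m : ℕ} {G : Type u} [Fintype G] [DecidableEq G] {Ω : Finset ℝ≥0}
  (S : VarTimeSampler m G Ω) {Δ : ℕ} {T ε δ : ℝ}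

/-- The search ends with an estimate only if v/2 ≤ r. The upper bound on r valid for every sampler,
11μ/10 + v/400, then makes v a bounded multiple of μ, and so the last error εv/200 is harmless. If
the search runs out of scales, the output is 0. -/
theorem holds_searchProg_le (hΔ : 1 ≤ Δ) (hT : 0 < T) (hε : 0 < ε) (hε1 : ε < 1) (hδ : 0 < δ)
    (hδ1 : δ ≤ 1) (n : ℕ) {v : ℝ} (hv : 0 < v) :
    (searchProg S.sched Δ T ε δ n v).Holds S (fun y => y ≤ 2 * S.mean) ((n + 1 : ℕ) * δ) := by
  have hμ := mean_nonneg S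
  induction n generalizing v with
  | zero => exact Prog.holds_ret (by linarith) (by positivity)
  | succ n ih =>
    have h1 := holds_estProg S hΔ hT hv (ε := 1 / 2) (by norm_num) (by norm_num) hδ hδ1
    rw [searchProg, show ((n + 1 + 1 : ℕ) : ℝ) * δ = δ + (n + 1 : ℕ) * δ by push_cast; ring]
    refine h1.bind (by positivity) fun r hr => ?_
    split_ifs with hvr
    · refine (holds_estProg S hΔ hT hv hε hε1 hδ hδ1).mono ?_ ?_
      · rintro y ⟨hy, -⟩
        have : ε * v ≤ v := mul_le_of_le_one_left hv.le hε1.le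
        linarith [hr.1]
      · refine le_mul_of_one_le_left hδ.le ?_
        exact_mod_cast Nat.le_add_left 1 n
    · exact ih (by positivity)

/-- The invariant μ ≤ 2v keeps `Valid` true: a coarse estimate below v/2 forces μ ≤ v. The invariant
2v < 2^n·μ contradicts it at n = 0, so the search ends in time. On exit v ≤ 3μ, which makes the
error of the last estimate relative to μ. -/
theorem holds_searchProg (hΔ : 1 ≤ Δ) (hT : 0 < T) (hε : 0 < ε) (hε1 : ε < 1) (hδ : 0 < δ)
    (hδ1 : δ ≤ 1) (hφ : S.phi ≤ Δ * S.mean) (hTl : S.Tl2 ≤ T) (n : ℕ) {v : ℝ} (hv : 0 < v)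
    (hμv : S.mean ≤ 2 * v) (hvn : 2 * v < 2 ^ n * S.mean) :
    (searchProg S.sched Δ T ε δ n v).Holds S (fun y => |y - S.mean| ≤ ε * S.mean)
      ((n + 1 : ℕ) * δ) := by
  have hμ := mean_nonneg S
  induction n generalizing v with
  | zero => linarith
  | succ n ih =>
    have hV : Valid S Δ T v := ⟨hφ, hTl, hμv⟩
    have h1 := holds_estProg S hΔ hT hv (ε := 1 / 2) (by norm_num) (by norm_num) hδ hδ1
    rw [searchProg, show ((n + 1 + 1 : ℕ) : ℝ) * δ = δ + (n + 1 : ℕ) * δ by push_cast; ring]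
    refine h1.bind (by positivity) fun r hr => ?_
    split_ifs with hvr
    · refine (holds_estProg S hΔ hT hv hε hε1 hδ hδ1).mono ?_ ?_
      · rintro y ⟨-, hy⟩
        refine (hy hV).trans ?_
        have : ε * v ≤ ε * (3 * S.mean) := mul_le_mul_of_nonneg_left (by linarith [hr.1]) hε.le
        have : 0 ≤ ε * S.mean := by positivity
        linarith
      · refine le_mul_of_one_le_left hδ.le ?_
        exact_mod_cast Nat.le_add_left 1 n
    · push Not at hvr
      have h2 := (abs_le.mp (hr.2 hV)).1
      refine ih (by positivity) (by linarith) ?_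
      rw [pow_succ] at hvn
      linarith

end Search

/-! ## The algorithm -/

/-- The number of scales in the search. -/
def numScales (L H : ℝ) : ℕ := Nat.clog 2 ⌈2 * H / L⌉₊

/-- The mean estimation algorithm. -/
def meanAlg (m : ℕ) (σ : Schedule m) (Δ : ℕ) (L H T ε δ : ℝ) : QAlgorithm m :=
  if Δ = 0 then .output 0
  else (searchProg σ Δ T ε (δ / (numScales L H + 1 : ℕ)) (numScales L H) H).toAlg

theorem lt_pow_numScales {L H x : ℝ} (hL : 0 < L) (hx : L < x) : 2 * H < 2 ^ numScales L H * x := by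
  have h1 : 2 * H / L ≤ (2 : ℝ) ^ numScales L H := by
    refine (Nat.le_ceil _).trans ?_
    exact_mod_cast Nat.le_pow_clog (by norm_num) _
  rw [div_le_iff₀ hL] at h1
  refine h1.trans_lt (mul_lt_mul_of_pos_left hx (by positivity))

theorem numScales_le {L H : ℝ} (hL : 0 < L) (hLH : L < H) :
    (numScales L H : ℝ) ≤ 3 + 2 * Real.log (H / L) := by
  have h1 : 1 ≤ H / L := by rw [le_div_iff₀ hL]; linarith
  have h2 : 1 < ⌈2 * H / L⌉₊ := by
    rw [Nat.lt_ceil, mul_div_assoc]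
    push_cast
    linarith
  have h3 := Nat.pow_pred_clog_lt_self (b := 2) (by norm_num) h2
  have h4 : 0 < Nat.clog 2 ⌈2 * H / L⌉₊ := Nat.clog_pos (by norm_num) h2
  obtain ⟨k, hk⟩ : ∃ k, Nat.clog 2 ⌈2 * H / L⌉₊ = k + 1 := ⟨_, (Nat.succ_pred_eq_of_pos h4).symm⟩
  rw [hk, Nat.pred_succ] at h3
  have h5 : (2 : ℝ) ^ k ≤ 4 * (H / L) := by
    have h6 : ((2 ^ k : ℕ) : ℝ) < (⌈2 * H / L⌉₊ : ℕ) := by exact_mod_cast h3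
    push_cast at h6
    have h7 := (Nat.ceil_lt_add_one (show 0 ≤ 2 * H / L by rw [mul_div_assoc]; linarith)).le
    rw [mul_div_assoc] at h7 h6
    linarith
  have h8 := Real.log_le_log (by positivity) h5
  rw [Real.log_pow, Real.log_mul (by norm_num) (by positivity),
    show (4 : ℝ) = 2 ^ 2 by norm_num, Real.log_pow] at h8
  have h9 := Real.log_two_gt_d9
  have h10 := Real.log_nonneg h1
  rw [numScales, hk]
  push_cast at h8 ⊢
  have h11 : ((k : ℝ) - 2) * Real.log 2 ≤ Real.log (H / L) := by linarith
  by_contra hcon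
  push Not at hcon
  nlinarith

theorem clog_three_le {n : ℕ} {x : ℝ} (h : (3 : ℝ) ^ n ≤ x) : (n : ℝ) ≤ Real.log x := by
  have h1 := Real.log_le_log (by positivity) h
  rw [Real.log_pow] at h1
  have h2 : 1 ≤ Real.log 3 := by
    rw [Real.le_log_iff_exp_le (by norm_num)]
    linarith [Real.exp_one_lt_d9]
  have h3 : (n : ℝ) ≤ n * Real.log 3 := le_mul_of_one_le_right n.cast_nonneg h2
  linarith

theorem numTime_le {Δ : ℕ} (hΔ : 1 ≤ Δ) {ε : ℝ} (hε : 0 < ε) (hε1 : ε < 1) :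
    (numTime Δ ε : ℝ) ≤ 7 + Real.log Δ + Real.log (1 / ε) := by
  have hD : (1 : ℝ) ≤ Δ := by exact_mod_cast hΔ
  have h1 := clog_three_le (x := 3 * (Δ : ℝ)) (n := Nat.clog 3 Δ) (by exact_mod_cast pow_clog_le hΔ)
  have h2 := clog_three_le (pow_numOut_le hε hε1)
  rw [Real.log_mul (by norm_num) (by positivity)] at h1
  rw [← mul_one_div, Real.log_mul (by norm_num) (by positivity)] at h2
  have h3 : Real.log 3 + Real.log 39 ≤ 5 := by
    rw [← Real.log_mul (by norm_num) (by norm_num), Real.log_le_iff_le_exp (by norm_num)]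
    have h4 : Real.exp 5 = Real.exp 1 ^ 5 := by rw [← Real.exp_nat_mul]; norm_num
    have h5 := pow_le_pow_left₀ (by norm_num) Real.exp_one_gt_d9.le 5
    rw [h4]
    refine le_trans (by norm_num) h5
  have h6 : (numTime Δ ε : ℝ) = Nat.clog 3 Δ + ((numOut ε - 1 : ℕ) : ℝ) + 1 := by
    have : numTime Δ ε = Nat.clog 3 Δ + (numOut ε - 1) + 1 := by
      have := one_le_numOut ε
      unfold numTime
      omega
    rw [this]
    push_cast
    ring
  rw [h6]
  linarith

theorem complexity_zero (L H T ε δ : ℝ) (t : ℕ) : complexity 0 L H T ε δ t = 0 := by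
  simp [complexity]

theorem time_meanAlg {m : ℕ} (σ : Schedule m) {Δ : ℕ} {L H T ε δ : ℝ} (hL : 0 < L) (hLH : L < H)
    (hT : 1 ≤ T) (hε : 0 < ε) (hε1 : ε < 1) (hδ : 0 < δ) (hδ1 : δ < 1) :
    ((meanAlg m σ Δ L H T ε δ).time σ : ℝ) ≤ (39 * 10 ^ 14 * 8 ^ 13) *
      complexity Δ L H T ε δ σ.Tmax * (1 + Real.log (complexity Δ L H T ε δ σ.Tmax)) ^ 14 := by
  rcases Nat.eq_zero_or_pos Δ with rfl | hΔ
  · simp [meanAlg, QAlgorithm.time, complexity_zero]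
  have hD : (1 : ℝ) ≤ Δ := by exact_mod_cast hΔ
  set n := numScales L H with hn
  have hn1 : (1 : ℝ) ≤ (n + 1 : ℕ) := by exact_mod_cast Nat.le_add_left 1 n
  have hδ'0 : 0 < δ / (n + 1 : ℕ) := by positivity
  have hδ'1 : δ / (n + 1 : ℕ) ≤ 1 := by
    rw [div_le_one (by positivity)]
    linarith
  have hℓ : 0 ≤ Real.log (H / L) := Real.log_nonneg (by rw [le_div_iff₀ hL]; linarith)
  have hlδ : 0 ≤ Real.log (1 / δ) := Real.log_nonneg (by rw [le_div_iff₀ hδ]; linarith)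
  have hεi : 1 ≤ ε⁻¹ := (one_le_inv₀ hε).mpr hε1.le
  have hεi2 : 1 ≤ ε⁻¹ ^ 2 := one_le_pow₀ hεi
  have hεl : Real.log (1 / ε) ≤ Real.log (ε⁻¹ ^ 2) := by
    rw [one_div]
    exact Real.log_le_log (by positivity) (by nlinarith)
  set X₀ : ℝ := Δ * (ε⁻¹ ^ 2 + Real.log (H / L)) * T * (1 + Real.log (1 / δ)) with hX₀
  have hX₀1 : Δ * ε⁻¹ ^ 2 ≤ X₀ := by
    calc (Δ : ℝ) * ε⁻¹ ^ 2 = Δ * (ε⁻¹ ^ 2 + 0) * 1 * (1 + 0) := by ring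
      _ ≤ X₀ := by rw [hX₀]; gcongr
  have hX₀2 : ε⁻¹ ^ 2 + Real.log (H / L) ≤ X₀ := by
    calc ε⁻¹ ^ 2 + Real.log (H / L) = 1 * (ε⁻¹ ^ 2 + Real.log (H / L)) * 1 * (1 + 0) := by ring
      _ ≤ X₀ := by rw [hX₀]; gcongr
  have hX₀3 : 1 ≤ X₀ := by linarith
  set Y : ℝ := 1 + Real.log X₀ with hY
  have hY1 : 1 ≤ Y := by linarith [Real.log_nonneg hX₀3]
  have hlog := Real.log_le_log (by positivity) hX₀1
  rw [Real.log_mul (by positivity) (by positivity)] at hlog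
  have hlogD := Real.log_nonneg hD
  have hlogε := Real.log_nonneg hεi2
  have hP : (numTime Δ ε : ℝ) ≤ 8 * Y := by
    have := numTime_le hΔ hε hε1
    linarith
  have hP' : (numTime Δ (1 / 2) : ℝ) ≤ 8 * Y := by
    have := numTime_le hΔ (ε := 1 / 2) (by norm_num) (by norm_num)
    have h2 := Real.log_two_lt_d9
    rw [show (1 : ℝ) / (1 / 2) = 2 by norm_num] at this
    linarith
  have hnle : (n : ℝ) ≤ 3 + 2 * Real.log (H / L) := numScales_le hL hLH
  -- Dividing the failure probability among the n + 1 estimates costs log(n + 1), and n + 1 ≤ 4X₀.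
  have hlδ' : 1 + Real.log (1 / (δ / (n + 1 : ℕ))) ≤ 3 * Y * (1 + Real.log (1 / δ)) := by
    have h1 : Real.log (n + 1 : ℕ) ≤ Real.log (4 * X₀) := by
      refine Real.log_le_log (by positivity) ?_
      push_cast
      linarith
    have h2 := Real.log_two_lt_d9
    rw [Real.log_mul (by norm_num) (by positivity), show (4 : ℝ) = 2 ^ 2 by norm_num,
      Real.log_pow] at h1
    push_cast at h1
    rw [one_div_div, div_eq_mul_one_div, Real.log_mul (by positivity) (by positivity)]
    push_cast
    nlinarith
  have hest : ∀ ε' : ℝ, 0 < ε' → ε' < 1 → (numTime Δ ε' : ℝ) ≤ 8 * Y → ∀ v,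
      (estProg σ Δ T v ε' (δ / (n + 1 : ℕ))).time σ ≤
        ⌊10 ^ 14 * (Δ * T * ε'⁻¹ ^ 2 * (8 * Y) ^ 13 * (3 * Y * (1 + Real.log (1 / δ))))⌋₊ := by
    intro ε' h0 h1 hP v
    refine Nat.le_floor ((time_estProg σ v hΔ hT h0 h1 hδ'0 hδ'1).trans ?_)
    have : 0 ≤ 1 + Real.log (1 / (δ / (n + 1 : ℕ))) := by
      have := Real.log_nonneg (show 1 ≤ 1 / (δ / (n + 1 : ℕ)) by rwa [le_div_iff₀ hδ'0, one_mul])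
      linarith
    gcongr
  have htime := time_searchProg_le σ Δ T ε (δ / (n + 1 : ℕ))
    (hest (1 / 2) (by norm_num) (by norm_num) hP') (hest ε hε hε1 hP) n H
  rw [meanAlg, if_neg (by omega), ← hn, Prog.time_toAlg]
  have h1 : ((searchProg σ Δ T ε (δ / (n + 1 : ℕ)) n H).time σ : ℝ) ≤
      n * (10 ^ 14 * (Δ * T * (1 / 2 : ℝ)⁻¹ ^ 2 * (8 * Y) ^ 13 * (3 * Y * (1 + Real.log (1 / δ))))) +
        10 ^ 14 * (Δ * T * ε⁻¹ ^ 2 * (8 * Y) ^ 13 * (3 * Y * (1 + Real.log (1 / δ)))) := by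
    refine (Nat.cast_le.mpr htime).trans ?_
    rw [Nat.cast_add, Nat.cast_mul]
    refine add_le_add (mul_le_mul_of_nonneg_left (Nat.floor_le ?_) n.cast_nonneg) (Nat.floor_le ?_)
      <;> positivity
  -- The factor with T_max is only used through being at least 1.
  have hX : X₀ ≤ complexity Δ L H T ε δ σ.Tmax := by
    have h2 : 1 ≤ (1 + Real.log σ.Tmax) ^ 4 :=
      one_le_pow₀ (by linarith [Real.log_natCast_nonneg σ.Tmax])
    have h3 : complexity Δ L H T ε δ σ.Tmax = X₀ * (1 + Real.log σ.Tmax) ^ 4 := by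
      rw [complexity, hX₀]; ring
    rw [h3]
    exact le_mul_of_one_le_right (by linarith) h2
  calc _ ≤ _ := h1
    -- The 4 is the inverse square of the coarse accuracy 1/2. Thirteen of the powers of Y come from
    -- `numTime`, the last one from the divided failure probability. With n ≤ 3 + 2·log(H/L), the
    -- sum 4n + ε⁻² is at most 13(ε⁻² + log(H/L)).
    _ = (3 * 10 ^ 14 * 8 ^ 13) * Y ^ 14 * (Δ * T * (1 + Real.log (1 / δ))) * (4 * n + ε⁻¹ ^ 2) := by
      ring
    _ ≤ (3 * 10 ^ 14 * 8 ^ 13) * Y ^ 14 * (Δ * T * (1 + Real.log (1 / δ))) *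
        (13 * (ε⁻¹ ^ 2 + Real.log (H / L))) :=
      mul_le_mul_of_nonneg_left (by linarith) (by positivity)
    _ = (39 * 10 ^ 14 * 8 ^ 13) * X₀ * Y ^ 14 := by rw [hX₀]; ring
    _ ≤ _ := by
      rw [hY]
      have hX0 : 0 ≤ complexity Δ L H T ε δ σ.Tmax := by linarith
      gcongr

end QMean

end

/-! ### Assembly of the main theorem -/

theorem mainTheorem7 :
    ∃ (alg : ∀ m : ℕ, QMean.Schedule m → (Δ : ℕ) → (L H T ε δ : ℝ) → QMean.QAlgorithm m)
      (K : ℝ) (k : ℕ),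
      ∀ (m : ℕ) (G : Type u) [Fintype G] [DecidableEq G] (Ω : Finset ℝ≥0)
        (S : QMean.VarTimeSampler m G Ω) (Δ : ℕ) (L H T ε δ : ℝ),
        0 < L → L < H → 1 ≤ T → 0 < ε → ε < 1 → 0 < δ → δ < 1 →
        (S.phi / S.mean ≤ Δ → S.Tl2 ≤ T → L < S.mean → S.mean < H →
          1 - δ ≤ (alg m S.sched Δ L H T ε δ).prob S {y | |y - S.mean| ≤ ε * S.mean}) ∧
        1 - δ ≤ (alg m S.sched Δ L H T ε δ).prob S {y | y ≤ 2 * S.mean} ∧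
        ((alg m S.sched Δ L H T ε δ).time S.sched : ℝ) ≤
          K * QMean.complexity Δ L H T ε δ S.sched.Tmax *
            (1 + Real.log (QMean.complexity Δ L H T ε δ S.sched.Tmax)) ^ k := by
  refine ⟨QMean.meanAlg, 39 * 10 ^ 14 * 8 ^ 13, 14, ?_⟩
  intro m G _ _ Ω S Δ L H T ε δ hL hLH hT hε hε1 hδ hδ1
  refine ⟨fun hφ hTl hLμ hμH => ?_, ?_, QMean.time_meanAlg S.sched hL hLH hT hε hε1 hδ hδ1⟩
  · have hμ : 0 < S.mean := hL.trans hLμ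
    rw [div_le_iff₀ hμ] at hφ
    -- For Δ = 0 the promise would give φ ≤ 0, hence a mean that is not positive, against L < μ.
    have hΔ : Δ ≠ 0 := by
      rintro rfl
      rw [Nat.cast_zero, zero_mul] at hφ
      linarith [QMean.mean_le_zero_of_phi_le_zero S hφ]
    rw [QMean.meanAlg, if_neg hΔ]
    have hδ' : δ / (QMean.numScales L H + 1 : ℕ) ≤ 1 := by
      refine (div_le_self hδ.le ?_).trans hδ1.le
      exact_mod_cast Nat.le_add_left 1 _
    refine QMean.Prog.Holds.le_prob ((QMean.holds_searchProg S (Nat.one_le_iff_ne_zero.mpr hΔ)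
      (by linarith) hε hε1 (by positivity) hδ' hφ hTl (QMean.numScales L H) (hL.trans hLH)
      (by linarith) (QMean.lt_pow_numScales hL hLμ)).mono (fun y hy => hy) (le_of_eq ?_))
    field_simp
  · by_cases hΔ : Δ = 0
    · have h0 : (0 : ℝ) ∈ {y | y ≤ 2 * S.mean} := by
        have := QMean.mean_nonneg S
        rw [Set.mem_ofPred_eq]
        linarith
      rw [QMean.meanAlg, if_pos hΔ, QMean.QAlgorithm.prob, Set.indicator_of_mem h0]
      simp only [Pi.one_apply]
      linarith
    · rw [QMean.meanAlg, if_neg hΔ]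
      have hδ' : δ / (QMean.numScales L H + 1 : ℕ) ≤ 1 := by
        refine (div_le_self hδ.le ?_).trans hδ1.le
        exact_mod_cast Nat.le_add_left 1 _
      refine QMean.Prog.Holds.le_prob ((QMean.holds_searchProg_le S (Nat.one_le_iff_ne_zero.mpr hΔ)
        (by linarith) hε hε1 (by positivity) hδ' (QMean.numScales L H) (hL.trans hLH)).mono
        (fun y hy => hy) (le_of_eq ?_))
      field_simp
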